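/- Let $G$ be a compact abelian Lie group acting smoothly on compact manifolds with corners $X$ and $X_1$ with fixed isotropy groups $K$ and $B$ respectively, where $K\subset B\subset G$ are closed subgroups, and let $p:X\to Y=X/G$ and $p_1:X_1\to Y_1=X_1/G$ be the smooth quotients. Let $\pi:X\to X_1$ be a $G$-equivariant fibration (a smooth surjective locally trivial map with compact fibres) and let $\pi_1:Y\to Y_1$ be the induced map, so $\pi_1p=p_1\pi$. Notation. $\widehat G$ is the group of continuous characters of $G$, and $\widehat{G/B}$ is identified with the subgroup of characters of $G$ trivial on $B$. For an equivariant bundle $U$ on $X$ and $\chi\in\widehat G$, the descent of $\chi\otimes U$ to $Y$ is the family whose fibre at $y$ is the space of $G$-invariant sections of $\chi\otimes U$ over the orbit $p^{-1}(y)$, with the smooth sections being those which are smooth on $X$. For $\hat h\in\widehat{G/K}$, $\mathrm{shf}(\hat h)$ is the line bundle on $Y$ obtained by descent of the trivial line bundle on $X$ with $G$ acting through $\hat h$. The category $\mathrm{Bun}^K_c(\widehat G\times Y)$ has as objects families of smooth complex vector bundles $W_{\hat g}$ on $Y$, $\hat g\in\widehat G$ (ranks may vary between components), such that only finitely many elements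 of $\widehat K$ are restrictions of characters $\hat g$ with $W_{\hat g}\neq0$, with unital and associative isomorphisms $\mathrm{shf}(\hat h)\otimes W_{\hat h\hat g}\cong W_{\hat g}$ for $\hat h\in\widehat{G/K}$, $\hat g\in\widehat G$; morphisms are families of bundle maps commuting with these isomorphisms. The reduction functor $R$ sends a $G$-equivariant bundle $U$ over $X$ to the family $R(U)_{\hat g}$ given by the descent to $Y$ of $\hat g^{-1}\otimes U$, equivalently of $\hat g^{-1}\otimes U_{\hat k}$, where $U_{\hat k}\subset U$ is the summand on which $K$ acts through $\hat k=\hat g|_K$, with the twisting isomorphisms given by multiplication. The category $\mathrm{Bun}^B_c(\widehat G\times Y_1)$ and the functor $R_1$ are defined in the same way from $X_1\to Y_1$ and $B$. Proposition. The map $\pi_1$ is smooth, every character of $B$ is the restriction of a character of $G$, and $R$ and $R_1$ are functors $\mathrm{Bun}_G(X)\to\mathrm{Bun}^K_c(\widehat G\times Y)$ and $\mathrm{Bun}_G(X_1)\to\mathrm{Bun}^B_c(\widehat G\times Y_1)$. There is a functor (the augmented pull-back) $$\pi_1^{\#}:\mathrm{Bun}^B_c(\widehat G\times Y_1)\longrightarrow\mathrm{Bun}^K_c(\widehat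 G\times Y)$$ to which the pull-back of equivariant bundles descends, in the sense that there is a natural isomorphism of functors $R\circ\pi^*\cong\pi_1^{\#}\circ R_1$ on $\mathrm{Bun}_G(X_1)$. It is given by fibrewise pull-back followed by summation: for every map $\tau_1:\widehat B\to\widehat G$ with $\tau_1(\hat b)|_B=\hat b$ for all $\hat b$, there are isomorphisms $$\bigl(\pi_1^{\#}V\bigr)_{\hat g}\;\cong\bigoplus_{\hat b\in\widehat B,\ \hat b|_K=\hat g|_K}\mathrm{shf}(\hat h_{\hat b})\otimes\pi_1^*V_{\hat h_{\hat b}\hat g},\qquad \hat h_{\hat b}\in\widehat{G/K},\quad \hat h_{\hat b}\,\hat g=\tau_1(\hat b),\qquad \hat g\in\widehat G,$$ natural in $V$ and compatible with the twisting isomorphisms, where those on the right are given by the multiplication $\mathrm{shf}(\hat h)\otimes\mathrm{shf}(\hat h')\to\mathrm{shf}(\hat h\hat h')$. -/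

import Mathlib

open CategoryTheory Filter Topology Manifold
open scoped ContDiff TensorProduct DirectSum

universe u

set_option linter.unusedSectionVars false

noncomputable section

/-! ### Smooth functions, fibrations and smooth quotients -/

/-- The model for `n`-dimensional manifolds with corners: the quadrant `[0, ∞)ⁿ` in `ℝⁿ`. -/
abbrev cornersModel (n : ℕ) :
    ModelWithCorners ℝ (EuclideanSpace ℝ (Fin n)) (EuclideanQuadrant n) :=
  modelWithCornersEuclideanQuadrant n

/-- The complex valued function `f` is smooth on a neighbourhood of `x`. -/
def SmoothNear {EM HM M : Type*} [NormedAddCommGroup EM] [NormedSpace ℝ EM] [TopologicalSpace HM]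
    (I : ModelWithCorners ℝ EM HM) [TopologicalSpace M] [ChartedSpace HM M]
    (f : M → ℂ) (x : M) : Prop :=
  ∀ᶠ y in 𝓝 x, ContMDiffAt I 𝓘(ℝ, ℂ) ∞ f y

theorem ContMDiffAt.mul_complex {EM HM M : Type*} [NormedAddCommGroup EM] [NormedSpace ℝ EM]
    [TopologicalSpace HM] {I : ModelWithCorners ℝ EM HM} [TopologicalSpace M]
    [ChartedSpace HM M] {f g : M → ℂ} {x : M} (hf : ContMDiffAt I 𝓘(ℝ, ℂ) ∞ f x)
    (hg : ContMDiffAt I 𝓘(ℝ, ℂ) ∞ g x) : ContMDiffAt I 𝓘(ℝ, ℂ) ∞ (fun y => f y * g y) x :=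
  (contDiff_mul (𝕜 := ℝ) (𝔸 := ℂ)).contMDiff.contMDiffAt.comp x (hf.prodMk_space hg)

/-- A fibration of manifolds with corners: a smooth surjective map `f : M → N` such that each
point of the base has an open neighbourhood `U` for which `f ⁻¹' U` is diffeomorphic, over `U`, to
`U × Z` with `Z` a compact manifold with corners. The diffeomorphism is `x ↦ (f x, φ x)`, with
inverse `ψ`. -/
structure IsFibration {m n : ℕ} {M N : Type u}
    [TopologicalSpace M] [ChartedSpace (EuclideanQuadrant m) M]
    [TopologicalSpace N] [ChartedSpace (EuclideanQuadrant n) N] (f : M → N) : Prop where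
  smooth : ContMDiff (cornersModel m) (cornersModel n) ∞ f
  surjective : Function.Surjective f
  locally_trivial : ∀ y₀ : N, ∃ U : Set N, IsOpen U ∧ y₀ ∈ U ∧
    ∃ (k : ℕ) (Z : Type u) (_ : TopologicalSpace Z) (_ : ChartedSpace (EuclideanQuadrant k) Z)
      (φ : M → Z) (ψ : N × Z → M),
      IsManifold (cornersModel k) ∞ Z ∧ CompactSpace Z ∧ T2Space Z ∧
      ContMDiffOn (cornersModel m) (cornersModel k) ∞ φ (f ⁻¹' U) ∧
      ContMDiffOn ((cornersModel n).prod (cornersModel k)) (cornersModel m) ∞ ψ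
        (U ×ˢ Set.univ) ∧
      (∀ x, f x ∈ U → ψ (f x, φ x) = x) ∧
      (∀ y ∈ U, ∀ z, f (ψ (y, z)) = y ∧ φ (ψ (y, z)) = z)

/-- `p : X → Y` exhibits the manifold with corners `Y` as the smooth quotient `X / G`: it is a
fibration whose fibres are exactly the orbits of `G`. -/
structure IsSmoothQuotient (G : Type u) [Group G] {m n : ℕ} {X Y : Type u} [MulAction G X]
    [TopologicalSpace X] [ChartedSpace (EuclideanQuadrant m) X]
    [TopologicalSpace Y] [ChartedSpace (EuclideanQuadrant n) Y] (p : X → Y) : Prop where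
  fibration : IsFibration (m := m) (n := n) p
  fibres : ∀ x x' : X, p x = p x' ↔ ∃ g : G, g • x = x'

/-! ### Smooth vector bundles

A smooth vector bundle is described by its fibres and its smooth sections; it is required to be
locally free of finite rank. The rank may vary from one component of the base to another, so the
fixed model fibre of `VectorBundle` is not suitable. -/

/-- A family of complex vector spaces over `M` together with a notion of smooth section:
`SmoothAt s x` means that the section `s` is smooth on a neighbourhood of `x`. -/
structure PreBundle (M : Type u) where
  Fib : M → Type u
  [addCommGroup : ∀ x, AddCommGroup (Fib x)]
  [module : ∀ x, Module ℂ (Fib x)]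
  SmoothAt : (∀ x, Fib x) → M → Prop

attribute [instance] PreBundle.addCommGroup PreBundle.module

namespace PreBundle

/-- Smooth bundle maps (over the identity): fibrewise linear maps which take smooth sections to
smooth sections. -/
@[ext]
structure Hom {M : Type u} (E F : PreBundle M) where
  map : ∀ x, E.Fib x →ₗ[ℂ] F.Fib x
  smooth : ∀ s x, E.SmoothAt s x → F.SmoothAt (fun y => map y (s y)) x

instance (M : Type u) : Category (PreBundle M) where
  Hom E F := Hom E F
  id E := ⟨fun _ => LinearMap.id, fun _ _ h => h⟩
  comp f g := ⟨fun x => g.map x ∘ₗ f.map x, fun s x h => g.smooth _ x (f.smooth s x h)⟩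

section

variable {EM HM : Type*} [NormedAddCommGroup EM] [NormedSpace ℝ EM] [TopologicalSpace HM]
  (I : ModelWithCorners ℝ EM HM) {M : Type u} [TopologicalSpace M] [ChartedSpace HM M]

/-- A family is a smooth complex vector bundle if near each point there are finitely many
sections which form a basis of each fibre, and such that the smooth sections are precisely the
combinations of these with smooth coefficients. -/
def IsVectorBundle (E : PreBundle M) : Prop :=
  ∀ x, ∃ (n : ℕ) (e : Fin n → ∀ y, E.Fib y), ∀ᶠ y in 𝓝 x,
    LinearIndependent ℂ (fun i => e i y) ∧
    Submodule.span ℂ (Set.range fun i => e i y) = ⊤ ∧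
    ∀ s, E.SmoothAt s y ↔ ∃ c : Fin n → M → ℂ, (∀ i, SmoothNear I (c i) y) ∧
      ∀ᶠ z in 𝓝 y, s z = ∑ i, c i z • e i z

/-- The germs of sections at `x` generated by a set `S` of sections, as a module over the smooth
functions. -/
inductive Generated {Fib : M → Type u} [∀ x, AddCommGroup (Fib x)] [∀ x, Module ℂ (Fib x)]
    (S : Set (∀ x, Fib x)) (x : M) : (∀ x, Fib x) → Prop
  | of (s : ∀ x, Fib x) : s ∈ S → Generated S x s
  | zero : Generated S x (fun _ => 0)
  | add (s t : ∀ x, Fib x) : Generated S x s → Generated S x t →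
      Generated S x (fun y => s y + t y)
  | smul (a : M → ℂ) (s : ∀ x, Fib x) : SmoothNear I a x → Generated S x s →
      Generated S x (fun y => a y • s y)
  | congr (s t : ∀ x, Fib x) : (∀ᶠ y in 𝓝 x, s y = t y) → Generated S x s → Generated S x t

/-- The pull-back `f^* E`: its smooth sections are generated by the pull-backs of smooth sections
of `E`. -/
def pullback {N : Type u} (f : M → N) (E : PreBundle N) : PreBundle M where
  Fib x := E.Fib (f x)
  SmoothAt s x := Generated I {s' | ∃ t, E.SmoothAt t (f x) ∧ s' = fun y => t (f y)} x s

/-- The tensor product: its smooth sections are generated by the products of smooth sections. -/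
def tensor (E F : PreBundle M) : PreBundle M where
  Fib x := E.Fib x ⊗[ℂ] F.Fib x
  SmoothAt s x := Generated I {s' | ∃ t t', E.SmoothAt t x ∧ F.SmoothAt t' x ∧
    s' = fun y => t y ⊗ₜ[ℂ] t' y} x s

variable {I} in
theorem Generated.map {Fib Fib' : M → Type u} [∀ x, AddCommGroup (Fib x)]
    [∀ x, Module ℂ (Fib x)] [∀ x, AddCommGroup (Fib' x)] [∀ x, Module ℂ (Fib' x)]
    {S : Set (∀ x, Fib x)} {S' : Set (∀ x, Fib' x)} {x : M} (φ : ∀ y, Fib y →ₗ[ℂ] Fib' y)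
    (h : ∀ s ∈ S, Generated I S' x (fun y => φ y (s y))) {s : ∀ x, Fib x}
    (hs : Generated I S x s) : Generated I S' x (fun y => φ y (s y)) := by
  induction hs with
  | of s hs => exact h s hs
  | zero => simpa using Generated.zero (I := I) (S := S') (x := x)
  | add s t _ _ hs ht => simpa using Generated.add _ _ hs ht
  | smul a s ha _ hs => simpa using Generated.smul a _ ha hs
  | congr s t hst _ hs =>
    exact Generated.congr _ _ (hst.mono fun y hy => by simp only [hy]) hs

/-- Pull-back as a functor. -/
def pullbackMap {N : Type u} (f : M → N) {E F : PreBundle N} (φ : E ⟶ F) :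
    pullback I f E ⟶ pullback I f F where
  map x := φ.map (f x)
  smooth s x hs := Generated.map (fun y => φ.map (f y))
    (by rintro _ ⟨t, ht, rfl⟩; exact .of _ ⟨_, φ.smooth t _ ht, rfl⟩) hs

/-- Tensor product with a fixed family as a functor. -/
def tensorMap (E : PreBundle M) {F F' : PreBundle M} (φ : F ⟶ F') :
    tensor I E F ⟶ tensor I E F' where
  map x := (φ.map x).lTensor (E.Fib x)
  smooth s x hs := Generated.map (fun y => (φ.map y).lTensor (E.Fib y))
    (by rintro _ ⟨t, t', ht, ht', rfl⟩; exact .of _ ⟨t, _, ht, φ.smooth t' _ ht', rfl⟩) hs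

end

/-- The direct sum, with componentwise smooth sections. (It is only used where all but finitely
many of the summands vanish.) -/
def directSum {M ι : Type u} (F : ι → PreBundle M) : PreBundle M where
  Fib x := ⨁ i, (F i).Fib x
  SmoothAt s x := ∀ i, (F i).SmoothAt (fun y => (s y : ⨁ i, (F i).Fib y) i) x

/-- The direct sum as a functor. -/
def directSumMap {M ι : Type u} {F F' : ι → PreBundle M} (φ : ∀ i, F i ⟶ F' i) :
    directSum F ⟶ directSum F' where
  map x := DirectSum.lmap fun i => (φ i).map x
  smooth s x hs i := (φ i).smooth (fun y => (show ⨁ i, (F i).Fib y from s y) i) x (hs i)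

/-- Composition with a smooth map takes germs generated by a set of sections to germs generated by
the pulled back sections. -/
theorem Generated.comp {EM HM : Type*} [NormedAddCommGroup EM] [NormedSpace ℝ EM]
    [TopologicalSpace HM] {I : ModelWithCorners ℝ EM HM}
    {EM' HM' : Type*} [NormedAddCommGroup EM'] [NormedSpace ℝ EM'] [TopologicalSpace HM']
    {I' : ModelWithCorners ℝ EM' HM'} {M N : Type u}
    [TopologicalSpace M] [ChartedSpace HM M] [TopologicalSpace N] [ChartedSpace HM' N]
    {f : M → N} (hf : ContMDiff I I' ∞ f)
    {Fib : N → Type u} [∀ x, AddCommGroup (Fib x)] [∀ x, Module ℂ (Fib x)]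
    {S : Set (∀ x, Fib x)} {S' : Set (∀ x, Fib (f x))} {x : M}
    (h : ∀ s ∈ S, Generated I S' x (fun y => s (f y))) {s : ∀ x, Fib x}
    (hs : Generated I' S (f x) s) : Generated I S' x (fun y => s (f y)) := by
  induction hs with
  | of s hs => exact h s hs
  | zero => exact Generated.zero
  | add s t _ _ hs ht => exact Generated.add _ _ hs ht
  | smul a s ha _ hs =>
    refine Generated.smul (fun y => a (f y)) _ ?_ hs
    exact (hf.continuous.continuousAt.eventually ha).mono fun y hy =>
      ContMDiffAt.comp y hy (hf y)
  | congr s t hst _ hs =>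
    exact Generated.congr _ _ (hf.continuous.continuousAt.eventually hst) hs

theorem Generated.sum {EM HM : Type*} [NormedAddCommGroup EM] [NormedSpace ℝ EM]
    [TopologicalSpace HM] {I : ModelWithCorners ℝ EM HM} {M : Type u}
    [TopologicalSpace M] [ChartedSpace HM M]
    {Fib : M → Type u} [∀ x, AddCommGroup (Fib x)] [∀ x, Module ℂ (Fib x)]
    {S : Set (∀ x, Fib x)} {x : M} {n : ℕ} (s : Fin n → ∀ x, Fib x)
    (h : ∀ i, Generated I S x (s i)) : Generated I S x (fun y => ∑ i, s i y) := by
  induction n with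
  | zero => simpa using Generated.zero
  | succ n ih =>
    simp only [Fin.sum_univ_succ]
    exact Generated.add _ _ (h 0) (ih (fun i => s i.succ) fun i => h _)

theorem IsVectorBundle.pullback {EM HM : Type*} [NormedAddCommGroup EM] [NormedSpace ℝ EM]
    [TopologicalSpace HM] {I : ModelWithCorners ℝ EM HM}
    {EM' HM' : Type*} [NormedAddCommGroup EM'] [NormedSpace ℝ EM'] [TopologicalSpace HM']
    {I' : ModelWithCorners ℝ EM' HM'} {M N : Type u}
    [TopologicalSpace M] [ChartedSpace HM M] [TopologicalSpace N] [ChartedSpace HM' N]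
    {f : M → N} (hf : ContMDiff I I' ∞ f) {E : PreBundle N} (hE : IsVectorBundle I' E) :
    IsVectorBundle I (pullback I f E) := by
  have near : ∀ (a : N → ℂ) (y : M), SmoothNear I' a (f y) →
      SmoothNear I (fun z => a (f z)) y := fun a y ha =>
    (hf.continuous.continuousAt.eventually ha).mono fun y hy => ContMDiffAt.comp y hy (hf y)
  intro x
  obtain ⟨n, e, he⟩ := hE (f x)
  refine ⟨n, fun i y => e i (f y), (hf.continuous.continuousAt.eventually he).mono ?_⟩
  rintro y ⟨hli, hsp, hsm⟩
  suffices key : ∀ s : ∀ z, E.Fib (f z),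
      Generated I {s' | ∃ t, E.SmoothAt t (f y) ∧ s' = fun y => t (f y)} y s ↔
        ∃ c : Fin n → M → ℂ, (∀ i, SmoothNear I (c i) y) ∧
          ∀ᶠ z in 𝓝 y, s z = ∑ i, c i z • e i (f z) from ⟨hli, hsp, key⟩
  refine fun s => ⟨fun hs => ?_, ?_⟩
  · induction hs with
    | of s hs =>
      obtain ⟨t, ht, rfl⟩ := hs
      obtain ⟨c, hc, hct⟩ := (hsm t).1 ht
      exact ⟨fun i z => c i (f z), fun i => near _ _ (hc i),
        hf.continuous.continuousAt.eventually hct⟩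
    | zero =>
      exact ⟨fun _ _ => 0, fun _ => .of_forall fun _ => contMDiffAt_const,
        .of_forall fun z => by simp⟩
    | add s t _ _ hs ht =>
      obtain ⟨c, hc, hs⟩ := hs
      obtain ⟨d, hd, ht⟩ := ht
      refine ⟨fun i z => c i z + d i z, fun i => ?_, ?_⟩
      · filter_upwards [hc i, hd i] with z h1 h2 using h1.add h2
      · filter_upwards [hs, ht] with z h1 h2
        simp only [add_smul, Finset.sum_add_distrib, h1, h2]
    | smul a s ha _ hs =>
      obtain ⟨c, hc, hs⟩ := hs
      refine ⟨fun i z => a z * c i z, fun i => ?_, ?_⟩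
      · filter_upwards [hc i, ha] with z h1 h2 using h2.mul_complex h1
      · filter_upwards [hs] with z h1
        simp only [mul_smul, ← Finset.smul_sum, h1]
    | congr s t hst _ hs =>
      obtain ⟨c, hc, hs⟩ := hs
      refine ⟨c, hc, ?_⟩
      filter_upwards [hst, hs] with z h1 h2 using h1.symm.trans h2
  · rintro ⟨c, hc, hs⟩
    refine Generated.congr _ _ (hs.mono fun z hz => hz.symm) ?_
    refine Generated.sum (fun i z => c i z • e i (f z)) fun i => ?_
    refine Generated.smul _ (fun z => e i (f z)) (hc i) (.of _ ⟨e i, ?_, rfl⟩)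
    refine (hsm _).2 ⟨fun j _ => if j = i then 1 else 0,
      fun j => .of_forall fun _ => contMDiffAt_const, .of_forall fun z => ?_⟩
    simp

/-- Transport of fibres along an equality of points of the base. -/
def cast {M : Type u} (E : PreBundle M) {x y : M} (h : x = y) : E.Fib x →ₗ[ℂ] E.Fib y where
  toFun v := h ▸ v
  map_add' v w := by subst h; rfl
  map_smul' c v := by subst h; rfl

theorem cast_heq {M : Type u} (E : PreBundle M) {x y : M} (h : x = y) (v : E.Fib x) :
    HEq (cast E h v) v := by
  subst h; rfl

theorem cast_map {M : Type u} {E F : PreBundle M} (φ : ∀ x, E.Fib x →ₗ[ℂ] F.Fib x) {x y : M} (h : x = y)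
    (v : E.Fib x) : φ y (cast E h v) = cast F h (φ x v) := by
  subst h; rfl

theorem cast_section {M : Type u} (E : PreBundle M) (t : ∀ x, E.Fib x) {x y : M} (h : x = y) :
    cast E h (t x) = t y := by
  subst h; rfl

end PreBundle

/-! ### Equivariant bundles -/

/-- A family of vector spaces over the `G`-space `X` with a smooth fibrewise linear action of `G`
covering the action on `X`. Smoothness means that the action is a smooth bundle map over `G × X`
from the pull-back under the projection to the pull-back under the action map. -/
structure EquivPreBundle {EG HG : Type*} [NormedAddCommGroup EG] [NormedSpace ℝ EG]
    [TopologicalSpace HG] (J : ModelWithCorners ℝ EG HG)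
    {EM HM : Type*} [NormedAddCommGroup EM] [NormedSpace ℝ EM] [TopologicalSpace HM]
    (I : ModelWithCorners ℝ EM HM)
    (G X : Type u) [Group G] [TopologicalSpace G] [ChartedSpace HG G]
    [TopologicalSpace X] [ChartedSpace HM X] [MulAction G X] extends PreBundle X where
  act : ∀ (g : G) (x : X), Fib x →ₗ[ℂ] Fib (g • x)
  one_act : ∀ (x : X) (v : Fib x), (⟨(1 : G) • x, act 1 x v⟩ : Σ x, Fib x) = ⟨x, v⟩
  mul_act : ∀ (g h : G) (x : X) (v : Fib x),
    (⟨(g * h) • x, act (g * h) x v⟩ : Σ x, Fib x) = ⟨g • h • x, act g (h • x) (act h x v)⟩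
  act_smooth : ∀ (s : ∀ z : G × X, Fib z.2) (z : G × X),
    (PreBundle.pullback (J.prod I) Prod.snd toPreBundle).SmoothAt s z →
    (PreBundle.pullback (J.prod I) (fun z : G × X => z.1 • z.2) toPreBundle).SmoothAt
      (fun z => act z.1 z.2 (s z)) z

namespace EquivPreBundle

open PreBundle (cast cast_heq cast_map cast_section)

variable {EG HG : Type*} [NormedAddCommGroup EG] [NormedSpace ℝ EG]
  [TopologicalSpace HG] {J : ModelWithCorners ℝ EG HG}
  {EM HM : Type*} [NormedAddCommGroup EM] [NormedSpace ℝ EM] [TopologicalSpace HM]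
  {I : ModelWithCorners ℝ EM HM}
  {EM' HM' : Type*} [NormedAddCommGroup EM'] [NormedSpace ℝ EM'] [TopologicalSpace HM']
  {I' : ModelWithCorners ℝ EM' HM'}
  {G X X₁ : Type u} [Group G] [TopologicalSpace G] [ChartedSpace HG G]
  [TopologicalSpace X] [ChartedSpace HM X] [MulAction G X]
  [TopologicalSpace X₁] [ChartedSpace HM' X₁] [MulAction G X₁]

/-- Smooth bundle maps intertwining the actions. -/
@[ext]
structure Hom (E F : EquivPreBundle J I G X) extends
    PreBundle.Hom E.toPreBundle F.toPreBundle where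
  equivariant : ∀ (g : G) (x : X) (v : E.Fib x),
    map (g • x) (E.act g x v) = F.act g x (map x v)

instance : Category (EquivPreBundle J I G X) where
  Hom E F := Hom E F
  id E := ⟨𝟙 E.toPreBundle, fun _ _ _ => rfl⟩
  comp {E F H} f g := ⟨(show E.toPreBundle ⟶ F.toPreBundle from f.toHom) ≫
      (show F.toPreBundle ⟶ H.toPreBundle from g.toHom), fun a x v => by
    change g.map _ (f.map _ _) = H.act a x (g.map _ (f.map _ _))
    rw [f.equivariant, g.equivariant]⟩

/-- The pull-back of an equivariant family under a smooth equivariant map. -/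
def pullback (π : X → X₁) (hπ : ContMDiff I I' ∞ π) (hG : ∀ (g : G) x, π (g • x) = g • π x)
    (E : EquivPreBundle J I' G X₁) : EquivPreBundle J I G X where
  toPreBundle := PreBundle.pullback I π E.toPreBundle
  act g x := cast E.toPreBundle (hG g x).symm ∘ₗ E.act g (π x)
  one_act x v := by
    refine Sigma.ext (one_smul G x) ((cast_heq _ _ _).trans ?_)
    exact (Sigma.mk.inj_iff.1 (E.one_act (π x) v)).2
  mul_act g h x v := by
    refine Sigma.ext (mul_smul g h x) ((cast_heq _ _ _).trans ?_)
    refine HEq.trans ?_ (cast_heq _ _ _).symm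
    refine ((Sigma.mk.inj_iff.1 (E.mul_act g h (π x) v)).2).trans ?_
    have key : ∀ (y : X₁) (hy : h • π x = y), HEq (E.act g (h • π x) (E.act h (π x) v))
        (E.act g y (cast E.toPreBundle hy (E.act h (π x) v))) := by
      rintro y rfl; rfl
    exact key _ (hG h x).symm
  act_smooth s z hs := by
    have hf : ContMDiff (J.prod I) (J.prod I') ∞ (fun w : G × X => (w.1, π w.2)) :=
      contMDiff_fst.prodMk (hπ.comp contMDiff_snd)
    refine PreBundle.Generated.map
      (φ := fun w => cast E.toPreBundle (hG w.1 w.2).symm ∘ₗ E.act w.1 (π w.2)) ?_ hs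
    rintro _ ⟨t, ht, rfl⟩
    -- over `G × X`, a section of the pull-back of `π^* E` comes from sections of `E`
    have h1 : PreBundle.Generated (J.prod I)
        {s' | ∃ u, E.SmoothAt u (π z.2) ∧ s' = fun y : G × X => u (π y.2)} z
        (fun y => t y.2) := by
      refine PreBundle.Generated.comp (I := J.prod I) (I' := I) (x := z) (f := Prod.snd)
        contMDiff_snd ?_ ht
      rintro _ ⟨u, hu, rfl⟩
      exact .of _ ⟨u, hu, rfl⟩
    refine PreBundle.Generated.map
      (φ := fun w => cast E.toPreBundle (hG w.1 w.2).symm ∘ₗ E.act w.1 (π w.2)) ?_ h1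
    rintro _ ⟨u, hu, rfl⟩
    have h2 := E.act_smooth (fun w => u w.2) (z.1, π z.2) (.of _ ⟨u, hu, rfl⟩)
    have h3 := PreBundle.Generated.comp (I := J.prod I) (I' := J.prod I') (x := z)
      (f := fun w : G × X => (w.1, π w.2)) hf
      (S' := {s' | ∃ u, E.SmoothAt u (z.1 • π z.2) ∧ s' = fun y : G × X => u (y.1 • π y.2)})
      (by rintro _ ⟨u, hu, rfl⟩; exact .of _ ⟨u, hu, rfl⟩) h2
    refine PreBundle.Generated.map (φ := fun w : G × X => cast E.toPreBundle (hG w.1 w.2).symm)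
      ?_ h3
    rintro _ ⟨w, hw, rfl⟩
    refine .of _ ⟨fun y => w (π y), .of _ ⟨w, ?_, rfl⟩, ?_⟩
    · rwa [hG]
    · funext y
      exact cast_section _ w _

/-- The pull-back functor on equivariant families. -/
def pullbackFunctor (π : X → X₁) (hπ : ContMDiff I I' ∞ π)
    (hG : ∀ (g : G) x, π (g • x) = g • π x) :
    EquivPreBundle J I' G X₁ ⥤ EquivPreBundle J I G X where
  obj := pullback π hπ hG
  map {E F} φ :=
    { toHom := PreBundle.pullbackMap I π
        (show E.toPreBundle ⟶ F.toPreBundle from φ.toHom)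
      equivariant := fun g x v => by
        change φ.map (π (g • x)) (cast E.toPreBundle (hG g x).symm (E.act g (π x) v)) =
          cast F.toPreBundle (hG g x).symm (F.act g (π x) (φ.map (π x) v))
        rw [cast_map φ.map]
        exact congrArg _ (φ.equivariant g (π x) v) }

end EquivPreBundle

section BunG

variable {EG HG : Type*} [NormedAddCommGroup EG] [NormedSpace ℝ EG]
  [TopologicalSpace HG] (J : ModelWithCorners ℝ EG HG)
  {EM HM : Type*} [NormedAddCommGroup EM] [NormedSpace ℝ EM] [TopologicalSpace HM]
  (I : ModelWithCorners ℝ EM HM)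
  {EM' HM' : Type*} [NormedAddCommGroup EM'] [NormedSpace ℝ EM'] [TopologicalSpace HM']
  (I' : ModelWithCorners ℝ EM' HM')
  (G X X₁ : Type u) [Group G] [TopologicalSpace G] [ChartedSpace HG G]
  [TopologicalSpace X] [ChartedSpace HM X] [MulAction G X]
  [TopologicalSpace X₁] [ChartedSpace HM' X₁] [MulAction G X₁]

/-- The equivariant families which are smooth vector bundles. -/
def IsEquivariantBundle : ObjectProperty (EquivPreBundle J I G X) :=
  fun U => PreBundle.IsVectorBundle I U.toPreBundle

/-- The category `Bun_G(X)` of `G`-equivariant smooth complex vector bundles over `X`. -/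
abbrev BunG := ObjectProperty.FullSubcategory (IsEquivariantBundle J I G X)

variable {I I' G X X₁}

/-- The pull-back functor `π^* : Bun_G(X₁) ⥤ Bun_G(X)` of a smooth equivariant map. -/
def BunG.pullback (π : X → X₁) (hπ : ContMDiff I I' ∞ π)
    (hG : ∀ (g : G) x, π (g • x) = g • π x) : BunG J I' G X₁ ⥤ BunG J I G X :=
  (IsEquivariantBundle J I G X).lift
    ((IsEquivariantBundle J I' G X₁).ι ⋙ EquivPreBundle.pullbackFunctor π hπ hG)
    fun U => PreBundle.IsVectorBundle.pullback hπ U.property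

end BunG

/-! ### Descent to the quotient, twisted bundles over `Ĝ × Y`, and reduction -/

/-- The characters of `G` which are trivial on `B`; these are the characters of `G / B`, viewed
as characters of `G` (see `mem_quotientDual_iff`). -/
def quotientDual {G : Type u} [CommGroup G] [TopologicalSpace G] (B : Subgroup G) : Subgroup (PontryaginDual G) where
  carrier := {h | ∀ b ∈ B, h b = 1}
  one_mem' _ _ := rfl
  mul_mem' {h h'} hh hh' b hb := by
    change h b * h' b = 1
    rw [hh b hb, hh' b hb, one_mul]
  inv_mem' {h} hh b hb := by
    change (h b)⁻¹ = 1
    rw [hh b hb, inv_one]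

theorem mem_quotientDual_iff {G : Type u} [CommGroup G] [TopologicalSpace G] (B : Subgroup G) (h : PontryaginDual G) :
    h ∈ quotientDual B ↔ ∃ χ : PontryaginDual (G ⧸ B), ∀ g : G, χ (g : G ⧸ B) = h g := by
  constructor
  · intro hh
    let φ : G ⧸ B →* Circle := QuotientGroup.lift B (h : G →* Circle) hh
    have hφ : Continuous φ := (map_continuous h).quotient_lift _
    exact ⟨(⟨φ, hφ⟩ : G ⧸ B →ₜ* Circle), fun g => rfl⟩
  · rintro ⟨χ, hχ⟩ b hb
    rw [← hχ, (QuotientGroup.eq_one_iff b).2 hb, map_one]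

section Reduction

variable {EG HG : Type*} [NormedAddCommGroup EG] [NormedSpace ℝ EG]
  [TopologicalSpace HG] {J : ModelWithCorners ℝ EG HG}
  {EX HX : Type*} [NormedAddCommGroup EX] [NormedSpace ℝ EX] [TopologicalSpace HX]
  (I : ModelWithCorners ℝ EX HX)
  {EY HY : Type*} [NormedAddCommGroup EY] [NormedSpace ℝ EY] [TopologicalSpace HY]
  (I' : ModelWithCorners ℝ EY HY)
  {G X Y : Type u} [CommGroup G] [TopologicalSpace G] [ChartedSpace HG G]
  [TopologicalSpace X] [ChartedSpace HX X] [MulAction G X]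
  [TopologicalSpace Y] [ChartedSpace HY Y]

/-- `shf(χ)`: the descent to `Y = X / G` of the trivial line bundle over `X` on which `G` acts
through the character `χ`. The fibre at `y` consists of the invariant sections over the orbit
`p ⁻¹ {y}`, i.e. the functions with `f (a • x) = χ a * f x`; a section is smooth if it is smooth
on `X`. If the action has fixed isotropy group `B` this is a line bundle for the characters `χ` of
`G / B`. -/
def shift (p : X → Y) (χ : PontryaginDual G) : PreBundle Y where
  Fib y := ({ carrier := {f | ∀ (a : G) (x : X) (hx : p x = y) (hax : p (a • x) = y),
                f ⟨a • x, hax⟩ = (χ a : ℂ) * f ⟨x, hx⟩}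
              zero_mem' := by intro a x hx hax; simp
              add_mem' := by
                intro f f' hf hf' a x hx hax
                simp only [Pi.add_apply, hf a x hx hax, hf' a x hx hax, mul_add]
              smul_mem' := by
                intro c f hf a x hx hax
                simp only [Pi.smul_apply, hf a x hx hax, smul_eq_mul]; ring } :
            Submodule ℂ ({x : X // p x = y} → ℂ))
  SmoothAt t y := ∀ᶠ y' in 𝓝 y, ∀ x, p x = y' →
    SmoothNear I (fun x' => (t (p x')).1 ⟨x', rfl⟩) x

/-- The descent of `χ ⊗ U` to `Y = X / G`, for an equivariant bundle `U` over `X`. The fibre at `y`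
consists of the invariant sections of `χ ⊗ U` over the orbit `p ⁻¹ {y}`; a section is smooth if it
is smooth on `X`. Such invariant sections take their values in the summand of `U` on which the
isotropy group `B` acts through the restriction of `χ⁻¹` to `B`, so this is the descent of the
tensor product of `χ` with that summand, on which the action of `B` is trivial. -/
def descend (p : X → Y) (χ : PontryaginDual G) (U : EquivPreBundle J I G X) : PreBundle Y where
  Fib y := ({ carrier := {s | ∀ (a : G) (x : X) (hx : p x = y) (hax : p (a • x) = y),
                s ⟨a • x, hax⟩ = (χ a : ℂ) • U.act a x (s ⟨x, hx⟩)}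
              zero_mem' := by intro a x hx hax; simp
              add_mem' := by
                intro f f' hf hf' a x hx hax
                simp only [Pi.add_apply, hf a x hx hax, hf' a x hx hax, map_add, smul_add]
              smul_mem' := by
                intro c f hf a x hx hax
                simp only [Pi.smul_apply, hf a x hx hax, map_smul]
                rw [smul_comm] } :
            Submodule ℂ (∀ x : {x : X // p x = y}, U.Fib x.1))
  SmoothAt t y := ∀ᶠ y' in 𝓝 y, ∀ x, p x = y' →
    U.SmoothAt (fun x' => (t (p x')).1 ⟨x', rfl⟩) x

/-- The multiplication `shf(χ) × shf(χ') → shf(χ χ')`. -/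
def shiftMul (p : X → Y) {χ χ' χ'' : PontryaginDual G} (e : χ'' = χ * χ') (y : Y) :
    (shift I p χ).Fib y →ₗ[ℂ] (shift I p χ').Fib y →ₗ[ℂ] (shift I p χ'').Fib y :=
  LinearMap.mk₂ ℂ
    (fun f f' => ⟨fun x => f.1 x * f'.1 x, by
      intro a x hx hax
      subst e
      have h1 := f.2 a x hx hax
      have h2 := f'.2 a x hx hax
      have h3 : (((χ * χ') a : Circle) : ℂ) = (χ a : ℂ) * (χ' a : ℂ) :=
        Circle.coe_mul (χ a) (χ' a)
      change f.1 _ * f'.1 _ = (((χ * χ') a : Circle) : ℂ) * (f.1 _ * f'.1 _)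
      rw [h1, h2, h3, mul_mul_mul_comm]⟩)
    (fun f₁ f₂ f' => Subtype.ext (funext fun x => add_mul (f₁.1 x) (f₂.1 x) (f'.1 x)))
    (fun c f f' => Subtype.ext (funext fun x => mul_assoc c (f.1 x) (f'.1 x)))
    (fun f f₁ f₂ => Subtype.ext (funext fun x => mul_add (f.1 x) (f₁.1 x) (f₂.1 x)))
    (fun c f f' => Subtype.ext (funext fun x => mul_left_comm (f.1 x) c (f'.1 x)))

/-- Multiplication of invariant functions and invariant sections,
`shf(h) × (χ ⊗ U) / G → (h χ ⊗ U) / G`. -/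
def descendMul (p : X → Y) {h χ χ' : PontryaginDual G} (e : χ' = h * χ)
    (U : EquivPreBundle J I G X) (y : Y) :
    (shift I p h).Fib y →ₗ[ℂ] (descend I p χ U).Fib y →ₗ[ℂ] (descend I p χ' U).Fib y :=
  LinearMap.mk₂ ℂ
    (fun f s => ⟨fun x => f.1 x • s.1 x, by
      intro a x hx hax
      subst e
      have h1 := f.2 a x hx hax
      have h2 := s.2 a x hx hax
      have h3 : (((h * χ) a : Circle) : ℂ) = (h a : ℂ) * (χ a : ℂ) :=
        Circle.coe_mul (h a) (χ a)
      change f.1 _ • s.1 _ = (((h * χ) a : Circle) : ℂ) • U.act a x (f.1 _ • s.1 _)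
      rw [h1, h2, h3, map_smul, smul_smul, smul_smul, mul_right_comm]⟩)
    (fun f₁ f₂ s => Subtype.ext (funext fun x => add_smul (f₁.1 x) (f₂.1 x) (s.1 x)))
    (fun c f s => Subtype.ext (funext fun x => mul_smul c (f.1 x) (s.1 x)))
    (fun f s₁ s₂ => Subtype.ext (funext fun x => smul_add (f.1 x) (s₁.1 x) (s₂.1 x)))
    (fun c f s => Subtype.ext (funext fun x => smul_comm (f.1 x) c (s.1 x)))

/-- A family of `W_g`, `g ∈ Ĝ`, over `Y` with natural maps `shf(h) ⊗ W_{hg} → W_g` for `h` a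
character of `G / B`, which are unital and associative. (The product `g' = h g` is recorded by an
equation.) -/
structure TwistedFamily (p : X → Y) (B : Subgroup G) where
  W : PontryaginDual G → PreBundle Y
  twist : ∀ h g g' : PontryaginDual G, h ∈ quotientDual B → g' = h * g →
    (PreBundle.tensor I' (shift I p h) (W g') ⟶ W g)
  twist_one : ∀ (g : PontryaginDual G) (hm : 1 ∈ quotientDual B) (e : g = 1 * g) (y : Y)
    (f : (shift I p 1).Fib y) (w : (W g).Fib y), (∀ x, f.1 x = 1) →
    (twist 1 g g hm e).map y (f ⊗ₜ w) = w
  twist_mul : ∀ (h h' h'' g g' g'' : PontryaginDual G) (hm : h ∈ quotientDual B)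
    (hm' : h' ∈ quotientDual B) (hm'' : h'' ∈ quotientDual B) (e : g' = h * g)
    (e' : g'' = h' * g') (e'' : g'' = h'' * g) (eh : h'' = h * h') (y : Y)
    (f : (shift I p h).Fib y) (f' : (shift I p h').Fib y) (w : (W g'').Fib y),
    (twist h g g' hm e).map y (f ⊗ₜ (twist h' g' g'' hm' e').map y (f' ⊗ₜ w)) =
      (twist h'' g g'' hm'' e'').map y (shiftMul I p eh y f f' ⊗ₜ w)

namespace TwistedFamily

variable {I I'} {p : X → Y} {B : Subgroup G}

/-- Morphisms: maps `V_g → W_g` for each `g`, natural with respect to the twisting. -/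
@[ext]
structure Hom (V W : TwistedFamily I I' p B) where
  app : ∀ g, V.W g ⟶ W.W g
  natural : ∀ (h g g' : PontryaginDual G) (hm : h ∈ quotientDual B) (e : g' = h * g),
    V.twist h g g' hm e ≫ app g =
      PreBundle.tensorMap I' (shift I p h) (app g') ≫ W.twist h g g' hm e

theorem tensorMap_comp {M : Type u} [TopologicalSpace M] [ChartedSpace HY M] (E : PreBundle M)
    {F F' F'' : PreBundle M} (φ : F ⟶ F') (ψ : F' ⟶ F'') :
    PreBundle.tensorMap I' E (φ ≫ ψ) = PreBundle.tensorMap I' E φ ≫ PreBundle.tensorMap I' E ψ :=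
  PreBundle.Hom.ext (funext fun x => LinearMap.lTensor_comp _ (ψ.map x) (φ.map x))

theorem tensorMap_id {M : Type u} [TopologicalSpace M] [ChartedSpace HY M] (E F : PreBundle M) :
    PreBundle.tensorMap I' E (𝟙 F) = 𝟙 (PreBundle.tensor I' E F) :=
  PreBundle.Hom.ext (funext fun _ => LinearMap.lTensor_id _ _)

instance : Category (TwistedFamily I I' p B) where
  Hom V W := Hom V W
  id V := ⟨fun g => 𝟙 _, fun h g g' hm e => by
    rw [tensorMap_id, Category.comp_id, Category.id_comp]⟩
  comp φ ψ := ⟨fun g => φ.app g ≫ ψ.app g, fun h g g' hm e => by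
    rw [tensorMap_comp, ← Category.assoc, φ.natural, Category.assoc, ψ.natural,
      Category.assoc]⟩

end TwistedFamily

/-- The twisted families which are reduced bundles: each `W_g` is a smooth vector bundle, the
support has finite projection to `B̂`, and the maps `shf(h) ⊗ W_{hg} → W_g` are isomorphisms. -/
def IsReducedBundle (p : X → Y) (B : Subgroup G) : ObjectProperty (TwistedFamily I I' p B) :=
  fun V => (∀ g, (V.W g).IsVectorBundle I') ∧
    {b : PontryaginDual B | ∃ g : PontryaginDual G, (∀ x : B, g x = b x) ∧
      ∃ y, Nontrivial ((V.W g).Fib y)}.Finite ∧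
    ∀ (h g g' : PontryaginDual G) (hm : h ∈ quotientDual B) (e : g' = h * g),
      IsIso (V.twist h g g' hm e)

/-- The category `Bun_c^B(Ĝ × Y)` of twisted bundles over `Ĝ × Y`, for `p : X → Y = X / G`. -/
abbrev BunC (p : X → Y) (B : Subgroup G) :=
  ObjectProperty.FullSubcategory (IsReducedBundle I I' p B)

variable {I}

/-- The smooth germs of a vector bundle form a module over the smooth functions. -/
theorem PreBundle.IsVectorBundle.generated {M : Type u} [TopologicalSpace M] [ChartedSpace HX M]
    {E : PreBundle M} (hE : E.IsVectorBundle I) {x : M} {s : ∀ x, E.Fib x}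
    (hs : PreBundle.Generated I {t | E.SmoothAt t x} x s) : E.SmoothAt s x := by
  obtain ⟨n, e, he⟩ := hE x
  obtain ⟨-, -, hsm⟩ := he.self_of_nhds
  induction hs with
  | of s hs => exact hs
  | zero =>
    exact (hsm _).2 ⟨fun _ _ => 0, fun _ => .of_forall fun _ => contMDiffAt_const,
      .of_forall fun z => by simp⟩
  | add s t _ _ hs ht =>
    obtain ⟨c, hc, hs⟩ := (hsm _).1 hs
    obtain ⟨d, hd, ht⟩ := (hsm _).1 ht
    refine (hsm _).2 ⟨fun i z => c i z + d i z, fun i => ?_, ?_⟩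
    · filter_upwards [hc i, hd i] with z h1 h2 using h1.add h2
    · filter_upwards [hs, ht] with z h1 h2
      simp only [add_smul, Finset.sum_add_distrib, h1, h2]
  | smul a s ha _ hs =>
    obtain ⟨c, hc, hs⟩ := (hsm _).1 hs
    refine (hsm _).2 ⟨fun i z => a z * c i z, fun i => ?_, ?_⟩
    · filter_upwards [hc i, ha] with z h1 h2 using h2.mul_complex h1
    · filter_upwards [hs] with z h1
      simp only [mul_smul, ← Finset.smul_sum, h1]
  | congr s t hst _ hs =>
    obtain ⟨c, hc, hs⟩ := (hsm _).1 hs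
    refine (hsm _).2 ⟨c, hc, ?_⟩
    filter_upwards [hst, hs] with z h1 h2 using h1.symm.trans h2

variable {I'}

theorem descend_generated {p : X → Y} (hp : ContMDiff I I' ∞ p) (χ : PontryaginDual G)
    (U : BunG J I G X) {y : Y} {s : ∀ y, (descend I p χ U.obj).Fib y}
    (hs : PreBundle.Generated I' {t | (descend I p χ U.obj).SmoothAt t y} y s) :
    (descend I p χ U.obj).SmoothAt s y := by
  have hU : U.obj.toPreBundle.IsVectorBundle I := U.property
  induction hs with
  | of s hs => exact hs
  | zero => exact .of_forall fun y' x _ => hU.generated .zero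
  | add s t _ _ hs ht =>
    filter_upwards [hs, ht] with y' h1 h2 x hx
    exact hU.generated (.add _ _ (.of _ (h1 x hx)) (.of _ (h2 x hx)))
  | smul a s ha _ hs =>
    filter_upwards [hs, ha.eventually_nhds] with y' h1 h2 x hx
    subst hx
    refine hU.generated (.smul (fun x' => a (p x')) _ ?_ (.of _ (h1 x rfl)))
    exact (hp.continuous.continuousAt.eventually h2).mono fun z hz =>
      ContMDiffAt.comp z hz (hp z)
  | congr s t hst _ hs =>
    filter_upwards [hs, hst.eventually_nhds] with y' h1 h2 x hx
    subst hx
    refine hU.generated (.congr _ _ ?_ (.of _ (h1 x rfl)))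
    exact (hp.continuous.continuousAt.eventually h2).mono fun z hz => by simp only [hz]

/-- The map induced by a morphism of equivariant bundles on the descended bundles. -/
def descendMap (p : X → Y) (χ : PontryaginDual G) {U U' : EquivPreBundle J I G X} (φ : U ⟶ U') :
    descend I p χ U ⟶ descend I p χ U' where
  map y :=
    { toFun := fun s => ⟨fun x => φ.map x.1 (s.1 x), fun a x hx hax => by
        have h1 := s.2 a x hx hax
        have h2 := φ.equivariant a x (s.1 ⟨x, hx⟩)
        change φ.map (a • x) (s.1 ⟨a • x, hax⟩) =
          ((χ a : Circle) : ℂ) • U'.act a x (φ.map x (s.1 ⟨x, hx⟩))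
        rw [h1, map_smul, h2]⟩
      map_add' := fun s t => Subtype.ext (funext fun x => map_add (φ.map x.1) (s.1 x) (t.1 x))
      map_smul' := fun c s => Subtype.ext (funext fun x => map_smul (φ.map x.1) c (s.1 x)) }
  smooth s y hs := hs.mono fun y' h x hx => φ.smooth _ x (h x hx)

/-- The reduction functor `R`, for an action with fixed isotropy group `B`: the value of `R(U)` at
the character `g` is the descent to `Y` of `g⁻¹ ⊗ U_b`, with `U_b` the summand of `U` on which `B`
acts through `b`, the restriction of `g` to `B`. -/
def reduction (p : X → Y) (hp : ContMDiff I I' ∞ p) (B : Subgroup G) :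
    BunG J I G X ⥤ TwistedFamily I I' p B where
  obj U :=
    { W := fun g => descend I p g⁻¹ U.obj
      twist := fun h g g' hm e =>
        { map := fun y => TensorProduct.lift
            (descendMul I p (χ := g'⁻¹) (χ' := g⁻¹) (by rw [e, mul_inv, mul_inv_cancel_left])
              U.obj y)
          smooth := by
            intro s y hs
            refine descend_generated hp _ U (PreBundle.Generated.map (fun y => TensorProduct.lift
              (descendMul I p (χ := g'⁻¹) (χ' := g⁻¹) _ U.obj y)) ?_ hs)
            rintro _ ⟨t, t', ht, ht', rfl⟩
            refine .of _ ?_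
            change ∀ᶠ y' in 𝓝 y, _
            have hU : U.obj.toPreBundle.IsVectorBundle I := U.property
            filter_upwards [ht, ht'] with y' h1 h2 x hx
            exact hU.generated (.smul _ _ (h1 x hx) (.of _ (h2 x hx))) }
      twist_one := fun g hm e y f w hf => Subtype.ext (funext fun x => by
        change f.1 x • w.1 x = w.1 x
        rw [hf, one_smul])
      twist_mul := by
        intro h h' h'' g g' g'' hm hm' hm'' e e' e'' eh y f f' w
        refine Subtype.ext (funext fun x => ?_)
        exact smul_smul (f.1 x) (f'.1 x) (w.1 x) }
  map {U U'} φ :=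
    { app := fun g => descendMap p g⁻¹ φ.hom
      natural := fun h g g' hm e => by
        refine PreBundle.Hom.ext (funext fun y => TensorProduct.ext' fun f s => ?_)
        refine Subtype.ext (funext fun x => ?_)
        exact map_smul (φ.hom.map x.1) (f.1 x) (s.1 x) }

end Reduction

/-! ### The augmented pull-back -/

section AugmentedPullback

variable {EX HX : Type*} [NormedAddCommGroup EX] [NormedSpace ℝ EX] [TopologicalSpace HX]
  {I : ModelWithCorners ℝ EX HX}
  {EY HY : Type*} [NormedAddCommGroup EY] [NormedSpace ℝ EY] [TopologicalSpace HY]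
  {I' : ModelWithCorners ℝ EY HY}
  {EX₁ HX₁ : Type*} [NormedAddCommGroup EX₁] [NormedSpace ℝ EX₁] [TopologicalSpace HX₁]
  {I₁ : ModelWithCorners ℝ EX₁ HX₁}
  {EY₁ HY₁ : Type*} [NormedAddCommGroup EY₁] [NormedSpace ℝ EY₁] [TopologicalSpace HY₁]
  {I₁' : ModelWithCorners ℝ EY₁ HY₁}
  {G X Y X₁ Y₁ : Type u} [CommGroup G] [TopologicalSpace G]
  [TopologicalSpace X] [ChartedSpace HX X] [MulAction G X]
  [TopologicalSpace Y] [ChartedSpace HY Y]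
  [TopologicalSpace X₁] [ChartedSpace HX₁ X₁] [MulAction G X₁]
  [TopologicalSpace Y₁] [ChartedSpace HY₁ Y₁]

/-- `τ` chooses, for each character of `B`, a character of `G` restricting to it. -/
def IsLift (B : Subgroup G) (τ : PontryaginDual B → PontryaginDual G) : Prop :=
  ∀ (b : PontryaginDual B) (x : B), τ b x = b x

/-- The characters of `B` whose restriction to `K` is the restriction of the character `g` of
`G`. -/
abbrev RestrictsTo {K B : Subgroup G} (hKB : K ≤ B) (g : PontryaginDual G) : Type u :=
  {b : PontryaginDual B // ∀ (k : G) (hk : k ∈ K), b ⟨k, hKB hk⟩ = g k}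

theorem restrictsTo_iff {K B : Subgroup G} (hKB : K ≤ B) {h g g' : PontryaginDual G}
    (hm : h ∈ quotientDual K) (e : g' = h * g) (b : PontryaginDual B) :
    (∀ (k : G) (hk : k ∈ K), b ⟨k, hKB hk⟩ = g k) ↔
      (∀ (k : G) (hk : k ∈ K), b ⟨k, hKB hk⟩ = g' k) := by
  have key : ∀ k ∈ K, g' k = g k := fun k hk => by
    subst e
    change h k * g k = g k
    rw [hm k hk, one_mul]
  exact forall₂_congr fun k hk => by rw [key k hk]

/-- The summand with index `b` in the value of the augmented pull-back of `V` at `g`: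
`shf(h) ⊗ π₁^* V_{hg}`, where `h = τ(b) g⁻¹` is the character with `h g = τ(b)`; it is a character
of `G / K` if `b` and `g` have the same restriction to `K`. -/
def augSummand (I : ModelWithCorners ℝ EX HX) (I' : ModelWithCorners ℝ EY HY) (p : X → Y)
    (π₁ : Y → Y₁) {B : Subgroup G} (τ : PontryaginDual B → PontryaginDual G)
    (V : PontryaginDual G → PreBundle Y₁) (g : PontryaginDual G) (b : PontryaginDual B) :
    PreBundle Y :=
  PreBundle.tensor I' (shift I p (τ b * g⁻¹)) (PreBundle.pullback I' π₁ (V (τ b)))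

/-- The twisting of the summands by multiplication,
`shf(h) ⊗ shf(τ(b) (h g)⁻¹) ⊗ π₁^* V_{τ(b)} → shf(τ(b) g⁻¹) ⊗ π₁^* V_{τ(b)}`. -/
def augSummandMul (p : X → Y) (π₁ : Y → Y₁) {B : Subgroup G}
    (τ : PontryaginDual B → PontryaginDual G) (V : PontryaginDual G → PreBundle Y₁)
    {h g g' : PontryaginDual G} (e : g' = h * g) (b : PontryaginDual B) (y : Y) :
    (shift I p h).Fib y →ₗ[ℂ] (augSummand I I' p π₁ τ V g' b).Fib y →ₗ[ℂ]
      (augSummand I I' p π₁ τ V g b).Fib y :=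
  (LinearMap.rTensorHom ((V (τ b)).Fib (π₁ y))).comp
    (shiftMul I p (χ := h) (χ' := τ b * g'⁻¹) (χ'' := τ b * g⁻¹)
      (by rw [e, mul_inv, mul_left_comm, mul_inv_cancel_left]) y)

/-- The twisting of the sum over the characters `b` of `B` with given restriction to `K`, summand
by summand. -/
def augTwist (p : X → Y) (π₁ : Y → Y₁) {K B : Subgroup G} (hKB : K ≤ B)
    (τ : PontryaginDual B → PontryaginDual G) (V : PontryaginDual G → PreBundle Y₁)
    {h g g' : PontryaginDual G} (hm : h ∈ quotientDual K) (e : g' = h * g) (y : Y) :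
    (shift I p h).Fib y →ₗ[ℂ]
      (⨁ b : RestrictsTo hKB g', (augSummand I I' p π₁ τ V g' b.1).Fib y) →ₗ[ℂ]
      (⨁ b : RestrictsTo hKB g, (augSummand I I' p π₁ τ V g b.1).Fib y) :=
  LinearMap.mk₂ ℂ
    (fun f v => DFinsupp.comapDomain'
      (fun b : RestrictsTo hKB g => (⟨b.1, (restrictsTo_iff hKB hm e b.1).1 b.2⟩ :
        RestrictsTo hKB g'))
      (h' := fun b => ⟨b.1, (restrictsTo_iff hKB hm e b.1).2 b.2⟩) (fun _ => rfl)
      (DirectSum.lmap (fun b : RestrictsTo hKB g' => augSummandMul p π₁ τ V e b.1 y f) v))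
    (fun f₁ f₂ v => DFinsupp.ext fun b =>
      LinearMap.map_add₂ (augSummandMul p π₁ τ V e b.1 y) f₁ f₂ (v ⟨b.1, (restrictsTo_iff hKB hm e b.1).1 b.2⟩))
    (fun c f v => DFinsupp.ext fun b =>
      LinearMap.map_smul₂ (augSummandMul p π₁ τ V e b.1 y) c f (v ⟨b.1, (restrictsTo_iff hKB hm e b.1).1 b.2⟩))
    (fun f v₁ v₂ => DFinsupp.ext fun b =>
      map_add (augSummandMul p π₁ τ V e b.1 y f) (v₁ ⟨b.1, (restrictsTo_iff hKB hm e b.1).1 b.2⟩) (v₂ ⟨b.1, (restrictsTo_iff hKB hm e b.1).1 b.2⟩))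
    (fun c f v => DFinsupp.ext fun b =>
      map_smul (augSummandMul p π₁ τ V e b.1 y f) c (v ⟨b.1, (restrictsTo_iff hKB hm e b.1).1 b.2⟩))

theorem augTwist_one (p : X → Y) (π₁ : Y → Y₁) {K B : Subgroup G} (hKB : K ≤ B)
    (τ : PontryaginDual B → PontryaginDual G) (V : PontryaginDual G → PreBundle Y₁)
    {g : PontryaginDual G} (hm : 1 ∈ quotientDual K) (e : g = 1 * g) (y : Y)
    (f : (shift I p 1).Fib y) (hf : ∀ x, f.1 x = 1)
    (w : ⨁ b : RestrictsTo hKB g, (augSummand I I' p π₁ τ V g b.1).Fib y) :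
    augTwist p π₁ hKB τ V hm e y f w = w := by
  refine DFinsupp.ext fun b => ?_
  have key : shiftMul I p (χ := 1) (χ' := τ b.1 * g⁻¹) (χ'' := τ b.1 * g⁻¹)
      (one_mul _).symm y f = LinearMap.id := by
    refine LinearMap.ext fun f' => Subtype.ext (funext fun x => ?_)
    change f.1 x * f'.1 x = f'.1 x
    rw [hf, one_mul]
  change LinearMap.rTensor ((V (τ b.1)).Fib (π₁ y)) (shiftMul I p _ y f) (w b) = w b
  rw [key, LinearMap.rTensor_id]
  rfl

theorem augTwist_mul (p : X → Y) (π₁ : Y → Y₁) {K B : Subgroup G} (hKB : K ≤ B)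
    (τ : PontryaginDual B → PontryaginDual G) (V : PontryaginDual G → PreBundle Y₁)
    {h h' h'' g g' g'' : PontryaginDual G} (hm : h ∈ quotientDual K)
    (hm' : h' ∈ quotientDual K) (hm'' : h'' ∈ quotientDual K) (e : g' = h * g)
    (e' : g'' = h' * g') (e'' : g'' = h'' * g) (eh : h'' = h * h') (y : Y)
    (f : (shift I p h).Fib y) (f' : (shift I p h').Fib y)
    (w : ⨁ b : RestrictsTo hKB g'', (augSummand I I' p π₁ τ V g'' b.1).Fib y) :
    augTwist p π₁ hKB τ V hm e y f (augTwist p π₁ hKB τ V hm' e' y f' w) =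
      augTwist p π₁ hKB τ V hm'' e'' y (shiftMul I p eh y f f') w := by
  refine DFinsupp.ext fun b => ?_
  let wb := w ⟨b.1, (restrictsTo_iff hKB hm'' e'' b.1).1 b.2⟩
  change ((LinearMap.rTensor ((V (τ b.1)).Fib (π₁ y)) (shiftMul I p _ y f)).comp
    (LinearMap.rTensor ((V (τ b.1)).Fib (π₁ y)) (shiftMul I p _ y f'))) wb =
    LinearMap.rTensor ((V (τ b.1)).Fib (π₁ y)) (shiftMul I p _ y (shiftMul I p eh y f f')) wb
  rw [← LinearMap.rTensor_comp]
  congr 2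
  refine LinearMap.ext fun f'' => Subtype.ext (funext fun x => ?_)
  exact (mul_assoc (f.1 x) (f'.1 x) (f''.1 x)).symm

theorem augTwist_natural (p : X → Y) (π₁ : Y → Y₁) {K B : Subgroup G} (hKB : K ≤ B)
    (τ : PontryaginDual B → PontryaginDual G) {V V' : PontryaginDual G → PreBundle Y₁}
    (φ : ∀ g, V g ⟶ V' g) {h g g' : PontryaginDual G} (hm : h ∈ quotientDual K)
    (e : g' = h * g) (y : Y) (f : (shift I p h).Fib y)
    (w : ⨁ b : RestrictsTo hKB g', (augSummand I I' p π₁ τ V g' b.1).Fib y) :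
    DirectSum.lmap (fun b : RestrictsTo hKB g =>
        ((φ (τ b.1)).map (π₁ y)).lTensor ((shift I p (τ b.1 * g⁻¹)).Fib y))
      (augTwist (I := I) (I' := I') p π₁ hKB τ V hm e y f w) =
    augTwist (I := I) (I' := I') p π₁ hKB τ V' hm e y f (DirectSum.lmap (fun b : RestrictsTo hKB g' =>
        ((φ (τ b.1)).map (π₁ y)).lTensor ((shift I p (τ b.1 * g'⁻¹)).Fib y)) w) := by
  refine DFinsupp.ext fun b => ?_
  let wb := w ⟨b.1, (restrictsTo_iff hKB hm e b.1).1 b.2⟩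
  change (((φ (τ b.1)).map (π₁ y)).lTensor _ ∘ₗ LinearMap.rTensor _ (shiftMul I p _ y f)) wb =
    (LinearMap.rTensor _ (shiftMul I p _ y f) ∘ₗ ((φ (τ b.1)).map (π₁ y)).lTensor _) wb
  rw [LinearMap.lTensor_comp_rTensor, LinearMap.rTensor_comp_lTensor]

/-- The augmented pull-back functor `π₁^#` determined by lifts `τ` of the characters of `B`:
fibrewise pull-back followed by summation over the characters of `B` with given restriction to `K`,
`π₁^#(V)_g = ⨁ shf(h) ⊗ π₁^* V_{hg}`, the sum being over the `b` in the dual of `B` with the same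
restriction to `K` as `g`, and `h` being determined by `h g = τ(b)`. -/
def augPullback (p : X → Y) (p₁ : X₁ → Y₁) (π₁ : Y → Y₁) {K B : Subgroup G} (hKB : K ≤ B)
    (τ : PontryaginDual B → PontryaginDual G) :
    TwistedFamily I₁ I₁' p₁ B ⥤ TwistedFamily I I' p K where
  obj V :=
    { W := fun g => PreBundle.directSum fun b : RestrictsTo hKB g =>
        augSummand I I' p π₁ τ V.W g b.1
      twist := fun h g g' hm e =>
        { map := fun y => TensorProduct.lift (augTwist p π₁ hKB τ V.W hm e y)
          smooth := by
            intro s y hs b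
            refine PreBundle.Generated.map
              (φ := fun y => (DirectSum.component ℂ _ _ b).comp
                (TensorProduct.lift (augTwist p π₁ hKB τ V.W hm e y))) ?_ hs
            rintro _ ⟨u, v, hu, hv, rfl⟩
            refine PreBundle.Generated.map
              (φ := fun y => augSummandMul p π₁ τ V.W e b.1 y (u y)) ?_
              (hv ⟨b.1, (restrictsTo_iff hKB hm e b.1).1 b.2⟩)
            rintro _ ⟨u', v', hu', hv', rfl⟩
            refine .of _ ⟨fun y => shiftMul I p _ y (u y) (u' y), v', ?_, hv', rfl⟩
            change ∀ᶠ y' in 𝓝 y, _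
            filter_upwards [hu, hu'] with y' h1 h2 x hx
            filter_upwards [h1 x hx, h2 x hx] with z h3 h4 using h3.mul_complex h4 }
      twist_one := fun g hm e y f w hf => augTwist_one p π₁ hKB τ V.W hm e y f hf w
      twist_mul := fun h h' h'' g g' g'' hm hm' hm'' e e' e'' eh y f f' w =>
        augTwist_mul p π₁ hKB τ V.W hm hm' hm'' e e' e'' eh y f f' w }
  map {V V'} φ :=
    { app := fun g => PreBundle.directSumMap fun b =>
        PreBundle.tensorMap I' _ (PreBundle.pullbackMap I' π₁ (φ.app (τ b.1)))
      natural := fun h g g' hm e =>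
        PreBundle.Hom.ext (funext fun y => TensorProduct.ext' fun f v =>
          augTwist_natural p π₁ hKB τ φ.app hm e y f v) }
  map_id V := by
    refine TwistedFamily.Hom.ext (funext fun g => PreBundle.Hom.ext (funext fun y =>
      LinearMap.ext fun w => DFinsupp.ext fun b => ?_))
    exact LinearMap.congr_fun (LinearMap.lTensor_id _ _) _
  map_comp φ ψ := by
    refine TwistedFamily.Hom.ext (funext fun g => PreBundle.Hom.ext (funext fun y =>
      LinearMap.ext fun w => DFinsupp.ext fun b => ?_))
    exact LinearMap.congr_fun (LinearMap.lTensor_comp _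
      ((ψ.app (τ b.1)).map (π₁ y)) ((φ.app (τ b.1)).map (π₁ y))) _

end AugmentedPullback

end

/-! ### Unitary representations of compact abelian groups and the Gelfand transform -/

section UnitaryRepresentation

open MeasureTheory

variable {G : Type*} [CommGroup G] [TopologicalSpace G] [IsTopologicalGroup G] [CompactSpace G]
  [MeasurableSpace G] [BorelSpace G]
  {H : Type*} [NormedAddCommGroup H] [InnerProductSpace ℂ H] [CompleteSpace H]

/-! The heart of the matter is fibrewise. Let `x` lie over `y`. An invariant section of `g⁻¹ ⊗ π^*U`
over the orbit of `x` is determined by its value at `x`, and the possible values are the vectors of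
the fibre of `U` at `π x` on which `K` acts through the restriction of `g`. The larger group `B`
acts on this fibre of `U`, and the fibre is the sum of its `B`-weight spaces. So the vectors in
question form the sum of the weight spaces of those `b` whose restriction to `K` is that of `g`. The
weight space of `b` is in turn the fibre at `π₁ y` of the descent of `τ(b)⁻¹ ⊗ U`. Multiplication by
functions in `shf(τ(b) g⁻¹)` turns invariant sections for `τ(b)⁻¹` into invariant sections for
`g⁻¹`. The multiplication map from the sum of the products to the reduction of `π^*U` is therefore
bijective on fibres (`injective_pullbackMulSum`, `surjective_pullbackMulSum`); it is visibly smooth,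
natural and compatible with the twisting.

To pass from fibres to bundles one needs both sides to be smooth vector bundles; then a fibrewise
bijective bundle map is an isomorphism by Cramer's rule (`isIso_of_bijective`). That descents are
vector bundles (`isVectorBundle_descend`) is the main analytic point. A local frame, cut off near a
point, is averaged over `G` against a character. The result is smooth by differentiation under the
integral sign (`contMDiffAt_integral`), it is equivariant, and for a small cut-off it is close to a
multiple of the identity on the invariant vectors at the point. The constancy of the isotropy group
ensures that the averaged sections span the invariant vectors at all nearby points
(`exists_invariantFrame`). The line bundles `shf` are the case of the trivial line.

Finiteness of the support holds because the weights near a point are uniformly close to `1` on a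
neighbourhood of the identity of the isotropy group, which leaves finitely many characters;
compactness of the base does the rest (`finite_weights`). The invertibility of the twisting maps
follows from the unit and associativity laws (`bijective_twist`).

The facts used about compact abelian groups, namely that characters separate points, extend from
closed subgroups and diagonalize finite dimensional representations, are derived from the Gelfand
transform of a commutative algebra attached to the regular representation, and from the
Stone–Weierstrass theorem.

The augmented pull-back is defined with one choice of lifts `τ`. For another choice `τ'` the
summands are compared by twisting with a nowhere vanishing function in `shf(τ(b) τ'(b)⁻¹)` and
dividing by its pull-back; rescaling the function has no effect (`liftChangeMap_smul`), so the
comparison is canonical. -/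

theorem Continuous.integrable_of_compactSpace {Γ : Type*} [TopologicalSpace Γ] [CompactSpace Γ]
    [MeasurableSpace Γ] [OpensMeasurableSpace Γ] (μ : Measure Γ) [IsFiniteMeasureOnCompacts μ]
    {E : Type*} [NormedAddCommGroup E] {f : Γ → E} (hf : Continuous f) : Integrable f μ :=
  hf.integrable_of_hasCompactSupport (HasCompactSupport.of_compactSpace f)

omit [IsTopologicalGroup G] [CompleteSpace H] in
theorem integrable_smul_orbit (μ : Measure G) [IsFiniteMeasure μ] (ρ : G →* (H ≃ₗᵢ[ℂ] H))
    (hρ : ∀ v, Continuous fun g => ρ g v) (f : C(G, ℂ)) (v : H) :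
    Integrable (fun h => f h • ρ h v) μ :=
  (f.continuous.smul (hρ v)).integrable_of_compactSpace μ

/-- The operator `∫ f(h) ρ(h) dh` of a strongly continuous unitary representation `ρ`. -/
noncomputable def averageOperator (μ : Measure G) [IsFiniteMeasure μ] (ρ : G →* (H ≃ₗᵢ[ℂ] H))
    (hρ : ∀ v, Continuous fun g => ρ g v) : C(G, ℂ) →L[ℂ] H →L[ℂ] H :=
  have hi := integrable_smul_orbit μ ρ hρ
  LinearMap.mkContinuous₂
    (LinearMap.mk₂ ℂ (fun f v => ∫ h, f h • ρ h v ∂μ)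
      (fun f f' v => by
        simp only [ContinuousMap.add_apply, add_smul]; exact integral_add (hi f v) (hi f' v))
      (fun c f v => by
        simp only [ContinuousMap.smul_apply, smul_assoc]; exact integral_smul c _)
      (fun f v w => by
        simp only [map_add, smul_add]; exact integral_add (hi f v) (hi f w))
      (fun c f v => by
        simp only [map_smul, smul_comm _ c]; exact integral_smul c _))
    (μ.real Set.univ) (fun f v => by
      refine (norm_integral_le_of_norm_le_const (C := ‖f‖ * ‖v‖) (.of_forall fun h => ?_)).trans
        (by rw [mul_comm, mul_assoc])
      rw [norm_smul, LinearIsometryEquiv.norm_map]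
      exact mul_le_mul_of_nonneg_right (f.norm_coe_le_norm h) (norm_nonneg v))

omit [IsTopologicalGroup G] [CompleteSpace H] in
theorem averageOperator_apply (μ : Measure G) [IsFiniteMeasure μ] (ρ : G →* (H ≃ₗᵢ[ℂ] H))
    (hρ : ∀ v, Continuous fun g => ρ g v) (f : C(G, ℂ)) (v : H) :
    averageOperator μ ρ hρ f v = ∫ h, f h • ρ h v ∂μ := rfl

/-- Left translation of continuous functions. -/
noncomputable def translateFun (f : C(G, ℂ)) : C(G, C(G, ℂ)) :=
  ContinuousMap.curry ⟨fun z : G × G => f (z.1⁻¹ * z.2), by fun_prop⟩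

theorem apply_averageOperator (μ : Measure G) [IsFiniteMeasure μ] [μ.IsMulLeftInvariant]
    (ρ : G →* (H ≃ₗᵢ[ℂ] H)) (hρ : ∀ v, Continuous fun g => ρ g v) (f : C(G, ℂ)) (g : G) (v : H) :
    ρ g (averageOperator μ ρ hρ f v) = averageOperator μ ρ hρ (translateFun f g) v := by
  rw [averageOperator_apply, averageOperator_apply,
    ← integral_mul_left_eq_self (fun h => translateFun f g h • ρ h v) g]
  have := ((ρ g).toContinuousLinearEquiv : H →L[ℂ] H).integral_comp_comm
    (integrable_smul_orbit μ ρ hρ f v)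
  refine Eq.trans this.symm (integral_congr_ae (.of_forall fun h => ?_))
  simp [translateFun]

/-- In a strongly continuous unitary representation of a compact abelian group, an element acting
nontrivially is detected by a character. -/
theorem exists_character_ne_one_of_unitary (μ : Measure G) [μ.IsHaarMeasure]
    (ρ : G →* (H ≃ₗᵢ[ℂ] H)) (hρ : ∀ v, Continuous fun g => ρ g v) (g : G) (v : H)
    (hv : ρ g v ≠ v) : ∃ χ : PontryaginDual G, χ g ≠ 1 := by
  classical
  -- `T` approximates the identity at `v`
  obtain ⟨f, hf⟩ : ∃ f : C(G, ℂ), ρ g (averageOperator μ ρ hρ f v) ≠ averageOperator μ ρ hρ f v := by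
    by_contra! hcon
    -- If `ρ g` fixed all averages, both `c v` and `c ρ(g) v` would be within `c ε` of the same
    -- vector, for the mass `c` of a bump function near `1`. With a third of the displacement this
    -- reads `3 ε ≤ 2 ε`.
    set ε : ℝ := ‖ρ g v - v‖ / 3 with hε
    have hε0 : 0 < ε := div_pos (norm_pos_iff.2 (sub_ne_zero.2 hv)) (by norm_num)
    have hU : {h | ‖ρ h v - v‖ < ε} ∈ 𝓝 (1 : G) := by
      have : Continuous fun h => ‖ρ h v - v‖ := ((hρ v).sub continuous_const).norm
      refine this.continuousAt.eventually (gt_mem_nhds ?_)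
      simpa using hε0
    obtain ⟨U, hUs, hUo, h1U⟩ := mem_nhds_iff.1 hU
    obtain ⟨b, hb1, hb0, -, hb⟩ := exists_continuous_one_zero_of_isCompact
      (isCompact_singleton (x := (1 : G))) hUo.isClosed_compl (by simpa using h1U)
    have hbi : Integrable (fun h => b h) μ := b.continuous.integrable_of_compactSpace μ
    set c : ℝ := ∫ h, b h ∂μ with hc
    have hc0 : 0 < c := by
      refine b.continuous.integral_pos_of_hasCompactSupport_nonneg_nonzero
        (HasCompactSupport.of_compactSpace _) (fun h => (hb h).1) (x := 1) ?_
      simp [hb1 (Set.mem_singleton 1)]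
    let f : C(G, ℂ) := ⟨fun h => (b h : ℂ), by fun_prop⟩
    have hT : ‖averageOperator μ ρ hρ f v - (c : ℂ) • v‖ ≤ c * ε := by
      have h1 : (c : ℂ) • v = ∫ h, (b h : ℂ) • v ∂μ := by
        rw [integral_smul_const, hc]
        congr 1
        exact integral_ofReal.symm
      rw [h1, averageOperator_apply, ← integral_sub
        (integrable_smul_orbit μ ρ hρ f v)
        (show Integrable (fun h => (b h : ℂ) • v) μ from
          (f.continuous.smul continuous_const).integrable_of_compactSpace μ), hc,
        ← integral_mul_const]
      refine norm_integral_le_of_norm_le (hbi.mul_const _) (.of_forall fun h => ?_)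
      change ‖(b h : ℂ) • ρ h v - (b h : ℂ) • v‖ ≤ b h * ε
      rw [← smul_sub, norm_smul, Complex.norm_real, Real.norm_of_nonneg (hb h).1]
      by_cases hh : h ∈ U
      · exact mul_le_mul_of_nonneg_left (hUs hh).le (hb h).1
      · simp [hb0 (show h ∈ Uᶜ from hh)]
    have h3 : ‖(c : ℂ) • ρ g v - (c : ℂ) • v‖ ≤ c * ε + c * ε := by
      have h4 : ‖ρ g (averageOperator μ ρ hρ f v) - (c : ℂ) • ρ g v‖ ≤ c * ε := by
        rw [← map_smul, ← map_sub, LinearIsometryEquiv.norm_map]; exact hT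
      rw [hcon f] at h4
      rw [norm_sub_rev] at h4
      calc _ = ‖((c : ℂ) • ρ g v - averageOperator μ ρ hρ f v) +
            (averageOperator μ ρ hρ f v - (c : ℂ) • v)‖ := by congr 1; abel
        _ ≤ _ := (norm_add_le _ _).trans (add_le_add h4 hT)
    rw [← smul_sub, norm_smul, Complex.norm_real, Real.norm_of_nonneg hc0.le] at h3
    have h5 : ‖ρ g v - v‖ = 3 * ε := by rw [hε]; ring
    rw [h5] at h3
    nlinarith [mul_pos hc0 hε0]
  let L : G →* (H →L[ℂ] H) :=
    { toFun := fun h => ((ρ h).toContinuousLinearEquiv : H →L[ℂ] H)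
      map_one' := by ext; simp
      map_mul' := fun _ _ => by ext; simp }
  have hL : ∀ h v, L h v = ρ h v := fun _ _ => rfl
  have hstar : ∀ h, star (L h) = L h⁻¹ := fun h => by
    rw [ContinuousLinearMap.star_eq_adjoint]
    refine ((ContinuousLinearMap.eq_adjoint_iff _ _).2 fun x y => ?_).symm
    rw [← (ρ h).inner_map_map]
    change inner ℂ (ρ h (ρ h⁻¹ x)) _ = _
    have h1 : ρ h (ρ h⁻¹ x) = x := by
      change (ρ h * ρ h⁻¹) x = x
      rw [← map_mul, mul_inv_cancel, map_one]
      rfl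
    rw [h1]
    rfl
  -- The double commutant `A` of the representation. As the operators `L h` commute with each other,
  -- they lie in `C`; hence `A` is contained in `C` and so is commutative. It is norm closed and
  -- contains the averages, which makes it a commutative C*-algebra.
  set C := StarSubalgebra.centralizer ℂ (Set.range L) with hC
  set A := StarSubalgebra.centralizer ℂ (C : Set (H →L[ℂ] H)) with hA
  have hLC : ∀ h, L h ∈ C := fun h => by
    rw [hC, StarSubalgebra.mem_centralizer_iff]
    rintro _ ⟨h', rfl⟩
    rw [hstar, ← map_mul, ← map_mul, ← map_mul, ← map_mul, mul_comm, mul_comm h'⁻¹]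
    exact ⟨rfl, rfl⟩
  have memA : ∀ T : H →L[ℂ] H, (∀ b : H →L[ℂ] H, (∀ h, L h * b = b * L h) → b * T = T * b) →
      T ∈ A := by
    intro T hT
    rw [hA, StarSubalgebra.mem_centralizer_iff]
    intro b hb
    have key : ∀ b ∈ C, b * T = T * b := fun b hb => hT b fun h =>
      ((StarSubalgebra.mem_centralizer_iff ℂ).1 hb _ ⟨h, rfl⟩).1
    exact ⟨key b hb, key _ (star_mem hb)⟩
  have hLA : ∀ h, L h ∈ A := fun h => memA _ fun b hb => (hb h).symm
  have hTA : averageOperator μ ρ hρ f ∈ A := memA _ fun b hb => by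
    ext w
    change b (averageOperator μ ρ hρ f w) = averageOperator μ ρ hρ f (b w)
    rw [averageOperator_apply, averageOperator_apply, ← b.integral_comp_comm
      (integrable_smul_orbit μ ρ hρ f w)]
    refine integral_congr_ae (.of_forall fun h => ?_)
    change b (f h • ρ h w) = f h • ρ h (b w)
    rw [map_smul]
    congr 1
    exact (DFunLike.congr_fun (hb h) w).symm
  have hcomm : ∀ a b : A, a * b = b * a := fun a b => by
    have hb : (b : H →L[ℂ] H) ∈ C := by
      rw [hC, StarSubalgebra.mem_centralizer_iff]
      rintro _ ⟨h, rfl⟩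
      exact (StarSubalgebra.mem_centralizer_iff ℂ).1 b.2 _ (hLC h)
    exact Subtype.ext ((StarSubalgebra.mem_centralizer_iff ℂ).1 a.2 _ hb).1.symm
  have hclosed : IsClosed (A : Set (H →L[ℂ] H)) := by
    rw [hA, StarSubalgebra.coe_centralizer]
    exact Set.isClosed_centralizer _
  let _ : CommCStarAlgebra A := { StarSubalgebra.cstarAlgebra A with mul_comm := hcomm }
  let T : A := ⟨_, hTA⟩
  let l : G →* A := { toFun := fun h => ⟨L h, hLA h⟩
                      map_one' := Subtype.ext (map_one L)
                      map_mul' := fun _ _ => Subtype.ext (map_mul L _ _) }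
  have hne : (l g - 1) * T ≠ 0 := fun h0 => hf <| by
    have := DFunLike.congr_fun (congrArg (Subtype.val) h0) v
    change ρ g (averageOperator μ ρ hρ f v) - averageOperator μ ρ hρ f v = 0 at this
    exact sub_eq_zero.1 this
  obtain ⟨φ, hφ⟩ : ∃ φ : WeakDual.characterSpace ℂ A, φ ((l g - 1) * T) ≠ 0 := by
    by_contra! hcon
    refine hne ((gelfandTransform_isometry A).injective ?_)
    ext φ
    rw [WeakDual.gelfandTransform_apply_apply, hcon φ, map_zero]
    rfl
  rw [map_mul, map_sub, map_one] at hφ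
  have hφT : φ T ≠ 0 := right_ne_zero_of_mul hφ
  have hφg : φ (l g) ≠ 1 := fun h => left_ne_zero_of_mul hφ (by rw [h, sub_self])
  -- The representation is only strongly continuous, so continuity of `φ` says nothing about `h ↦ φ
  -- (l h)` directly. But `l h * T` is the average of the translated function, which varies
  -- continuously in norm, and `φ T ≠ 0` can be divided out.
  have hcont : Continuous fun h => φ (l h) := by
    have h1 : Continuous fun h => φ (l h * T) := by
      refine (map_continuous φ).comp (Continuous.subtype_mk ?_ _ :
        Continuous fun h => (⟨((l h * T : A) : H →L[ℂ] H), (l h * T).2⟩ : A))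
      have h2 : (fun h => ((l h * T : A) : H →L[ℂ] H)) =
          fun h => averageOperator μ ρ hρ (translateFun f h) := by
        funext h
        ext w
        exact apply_averageOperator μ ρ hρ f h w
      rw [h2]
      exact (averageOperator μ ρ hρ).continuous.comp (translateFun f).continuous
    simp only [map_mul] at h1
    simpa [mul_div_assoc, div_self hφT] using h1.div_const (φ T)
  -- Both `φ (l h)` and `φ (l h⁻¹)` have norm at most one, and their product is one.
  have hnorm : ∀ h, φ (l h) ∈ Submonoid.unitSphere ℂ := fun h => by
    have h1 : ∀ h, ‖φ (l h)‖ ≤ 1 := fun h => by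
      refine (AlgHom.norm_apply_le_self_mul_norm_one φ _).trans ?_
      have h2 : ‖(l h : A)‖ ≤ 1 := by
        refine ContinuousLinearMap.opNorm_le_bound _ zero_le_one fun w => ?_
        rw [one_mul]
        exact ((ρ h).norm_map w).le
      have h3 : ‖(1 : A)‖ ≤ 1 := ContinuousLinearMap.norm_id_le
      nlinarith [norm_nonneg (l h), norm_nonneg (1 : A)]
    refine mem_sphere_zero_iff_norm.2 ?_
    refine le_antisymm (h1 h) ?_
    have h2 : ‖φ (l h)‖ * ‖φ (l h⁻¹)‖ = 1 := by
      rw [← norm_mul, ← map_mul, ← map_mul, mul_inv_cancel, map_one, map_one, norm_one]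
    nlinarith [h1 h⁻¹, norm_nonneg (φ (l h))]
  let χ : G →ₜ* Circle :=
    { toFun := fun h => ⟨φ (l h), hnorm h⟩
      map_one' := Subtype.ext (by simp)
      map_mul' := fun a b => Subtype.ext (by
        change φ (l (a * b)) = φ (l a) * φ (l b)
        rw [map_mul, map_mul])
      continuous_toFun := hcont.subtype_mk _ }
  exact ⟨χ, fun h => hφg (congrArg Subtype.val h)⟩

end UnitaryRepresentation

/-! ### Separation, extension and weights for compact abelian groups -/

section Characters

open MeasureTheory

variable {G : Type*} [CommGroup G] [TopologicalSpace G] [IsTopologicalGroup G] [CompactSpace G]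

/-- The characters of a compact abelian group separate its points. -/
theorem PontryaginDual.exists_apply_ne_one [T2Space G] {g : G} (hg : g ≠ 1) :
    ∃ χ : PontryaginDual G, χ g ≠ 1 := by
  borelize G
  let μ : Measure G := Measure.haar
  have : Fact ((2 : ENNReal) ≠ ⊤) := ⟨by simp⟩
  -- The regular representation. `DomMulAct` reverses products, which does not matter in a
  -- commutative group.
  let ρ : G →* (Lp ℂ 2 μ ≃ₗᵢ[ℂ] Lp ℂ 2 μ) :=
    { toFun := fun a =>
        { toFun := fun v => DomMulAct.mk a • v
          invFun := fun v => DomMulAct.mk a⁻¹ • v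
          map_add' := fun v w => smul_add _ v w
          map_smul' := fun c v => smul_comm _ c v
          left_inv := fun v => by
            change DomMulAct.mk a⁻¹ • DomMulAct.mk a • v = v
            rw [smul_smul, ← DomMulAct.mk_mul, mul_inv_cancel, DomMulAct.mk_one, one_smul]
          right_inv := fun v => by
            change DomMulAct.mk a • DomMulAct.mk a⁻¹ • v = v
            rw [smul_smul, ← DomMulAct.mk_mul, inv_mul_cancel, DomMulAct.mk_one, one_smul]
          norm_map' := fun v => DomMulAct.norm_smul_Lp _ v }
      map_one' := by
        ext1 v
        change DomMulAct.mk (1 : G) • v = v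
        rw [DomMulAct.mk_one, one_smul]
      map_mul' := fun a b => by
        ext1 v
        change DomMulAct.mk (a * b) • v = DomMulAct.mk a • DomMulAct.mk b • v
        rw [smul_smul, ← DomMulAct.mk_mul, mul_comm] }
  have hρ : ∀ v, Continuous fun a => ρ a v := fun v => by
    change Continuous fun a => DomMulAct.mk a • v
    exact (DomMulAct.continuous_mk).smul continuous_const
  -- Translation by `g` moves the class of a continuous function which is `1` at the identity and
  -- `0` at `g`, because Haar measure does not identify different continuous functions.
  obtain ⟨f, hf1, hf0, -, -⟩ := exists_continuous_one_zero_of_isCompact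
      (isCompact_singleton (x := (1 : G))) (isClosed_singleton (x := g))
      (by simpa using hg.symm)
  let F : C(G, ℂ) := ⟨fun x => (f x : ℂ), by fun_prop⟩
  refine exists_character_ne_one_of_unitary μ ρ hρ g (F.toLp 2 μ ℂ) fun h => ?_
  have h1 : (DomMulAct.mk g • F.toLp 2 μ ℂ : Lp ℂ 2 μ) =ᵐ[μ] fun x => F (g * x) := by
    refine (DomMulAct.smul_Lp_ae_eq _ _).trans ?_
    exact (measurePreserving_mul_left μ g).quasiMeasurePreserving.ae_eq_comp
      (ContinuousMap.coeFn_toLp (p := 2) (𝕜 := ℂ) μ F)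
  have h2 : (fun x => F (g * x)) =ᵐ[μ] F := by
    refine h1.symm.trans ?_
    change ((ρ g (F.toLp 2 μ ℂ) : Lp ℂ 2 μ) : G → ℂ) =ᵐ[μ] F
    rw [h]
    exact ContinuousMap.coeFn_toLp (p := 2) (𝕜 := ℂ) μ F
  have h3 := congrFun ((Continuous.ae_eq_iff_eq μ (by fun_prop) F.continuous).1 h2) 1
  change ((f (g * 1) : ℝ) : ℂ) = (f 1 : ℂ) at h3
  rw [mul_one, hf1 rfl, hf0 rfl] at h3
  simp at h3

theorem PontryaginDual.coe_apply_mul {A : Type*} [Monoid A] [TopologicalSpace A]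
    (χ : PontryaginDual A) (x y : A) : (χ (x * y) : ℂ) = χ x * χ y := by
  rw [_root_.map_mul, Circle.coe_mul]

theorem PontryaginDual.coe_mul_apply {A : Type*} [Monoid A] [TopologicalSpace A]
    (χ ψ : PontryaginDual A) (x : A) : ((χ * ψ) x : ℂ) = χ x * ψ x := rfl

theorem PontryaginDual.coe_inv_apply {A : Type*} [Monoid A] [TopologicalSpace A]
    (χ : PontryaginDual A) (x : A) : (χ⁻¹ x : ℂ) = (χ x : ℂ)⁻¹ := Circle.coe_inv _

/-- A character as a complex valued continuous function. -/
noncomputable def PontryaginDual.toComplex : PontryaginDual G →* C(G, ℂ) where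
  toFun χ := ⟨fun x => (χ x : ℂ), continuous_subtype_val.comp (map_continuous χ)⟩
  map_one' := rfl
  map_mul' _ _ := rfl

/-- A continuous function orthogonal to a group of characters which separates points vanishes. -/
theorem ContinuousMap.eq_zero_of_integral_character [MeasurableSpace G] [BorelSpace G]
    (μ : Measure G) [μ.IsHaarMeasure] (D : Subgroup (PontryaginDual G))
    (hD : ∀ x y : G, x ≠ y → ∃ χ ∈ D, χ x ≠ χ y) (f : C(G, ℂ))
    (hf : ∀ χ ∈ D, ∫ x, f x * (χ x : ℂ) ∂μ = 0) : f = 0 := by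
  let S : Submonoid C(G, ℂ) := D.toSubmonoid.map PontryaginDual.toComplex
  let A : StarSubalgebra ℂ C(G, ℂ) :=
    { Algebra.adjoin ℂ (S : Set C(G, ℂ)) with
      star_mem' := by
        intro a ha
        induction ha using Algebra.adjoin_induction with
        | mem a ha =>
          obtain ⟨χ, hχ, rfl⟩ := ha
          refine Algebra.subset_adjoin ⟨χ⁻¹, D.inv_mem hχ, ?_⟩
          ext x
          exact Circle.coe_inv_eq_conj (χ x)
        | algebraMap r =>
          rw [algebraMap_star_comm r |>.symm]
          exact (Algebra.adjoin ℂ (S : Set C(G, ℂ))).algebraMap_mem _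
        | add a b _ _ ha hb => rw [star_add]; exact Subalgebra.add_mem _ ha hb
        | mul a b _ _ ha hb => rw [star_mul]; exact Subalgebra.mul_mem _ hb ha }
  have hA : A.SeparatesPoints := fun x y hxy => by
    obtain ⟨χ, hχ, h⟩ := hD x y hxy
    exact ⟨_, ⟨PontryaginDual.toComplex χ, Algebra.subset_adjoin ⟨χ, hχ, rfl⟩, rfl⟩,
      fun h' => h (Subtype.ext h')⟩
  have hdense := ContinuousMap.starSubalgebra_topologicalClosure_eq_top_of_separatesPoints A hA
  have hint : ∀ a : C(G, ℂ), Integrable (fun x => f x * a x) μ := fun a =>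
    (f.continuous.mul a.continuous).integrable_of_compactSpace μ
  have hspan : ∀ a ∈ A, ∫ x, f x * a x ∂μ = 0 := by
    intro a hA'
    -- The characters in `D` are closed under multiplication, so the algebra they generate is merely
    -- their linear span, on which the hypothesis can be used.
    have ha' : a ∈ Submodule.span ℂ (S : Set C(G, ℂ)) := by
      have := Algebra.adjoin_eq_span ℂ (S : Set C(G, ℂ))
      rw [Submonoid.closure_eq] at this
      rw [← this]
      exact hA'
    clear hA'
    induction ha' using Submodule.span_induction with
    | mem a ha => obtain ⟨χ, hχ, rfl⟩ := ha; exact hf χ hχ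
    | zero => simp
    | add a b _ _ ha hb =>
      simp only [ContinuousMap.add_apply, mul_add]
      rw [integral_add (hint a) (hint b), ha, hb, add_zero]
    | smul c a _ ha =>
      simp only [ContinuousMap.smul_apply, smul_eq_mul, mul_left_comm _ c]
      rw [integral_const_mul, ha, mul_zero]
  have hall : ∀ a : C(G, ℂ), ∫ x, f x * a x ∂μ = 0 := by
    intro a
    have hcl : IsClosed {a : C(G, ℂ) | ∫ x, f x * a x ∂μ = 0} := by
      refine isClosed_eq ?_ continuous_const
      let L : C(G, ℂ) →ₗ[ℂ] ℂ :=
        { toFun := fun a => ∫ x, f x * a x ∂μ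
          map_add' := fun a b => by
            simp only [ContinuousMap.add_apply, mul_add]
            exact integral_add (hint a) (hint b)
          map_smul' := fun c a => by
            simp only [ContinuousMap.smul_apply, smul_eq_mul, mul_left_comm _ c]
            exact integral_const_mul _ _ }
      refine (L.mkContinuous (‖f‖ * μ.real Set.univ) fun a => ?_).continuous
      refine (norm_integral_le_of_norm_le_const (C := ‖f‖ * ‖a‖) (.of_forall fun x => ?_)).trans
        (le_of_eq (by ring))
      rw [norm_mul]
      exact mul_le_mul (f.norm_coe_le_norm x) (a.norm_coe_le_norm x) (norm_nonneg _)
        (norm_nonneg _)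
    have : (A.topologicalClosure : Set C(G, ℂ)) ⊆ {a : C(G, ℂ) | ∫ x, f x * a x ∂μ = 0} := by
      rw [StarSubalgebra.topologicalClosure_coe]
      exact closure_minimal hspan hcl
    exact this (by rw [hdense]; trivial)
  -- Orthogonality to everything is applied to the conjugate of `f` itself.
  have hzero : ∫ x, ‖f x‖ ^ 2 ∂μ = 0 := by
    have := hall (star f)
    have h2 : ∀ x, f x * (star f) x = ((‖f x‖ ^ 2 : ℝ) : ℂ) := fun x => by
      rw [ContinuousMap.star_apply, Complex.star_def, Complex.mul_conj, Complex.normSq_eq_norm_sq]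
    simp only [h2] at this
    exact Complex.ofReal_injective ((integral_ofReal (𝕜 := ℂ)).symm.trans this)
  by_contra hne
  obtain ⟨x, hx⟩ : ∃ x, f x ≠ 0 := by
    by_contra! h
    exact hne (ContinuousMap.ext h)
  refine (Continuous.integral_pos_of_hasCompactSupport_nonneg_nonzero (μ := μ)
    (f := fun x => ‖f x‖ ^ 2) (by fun_prop) (HasCompactSupport.of_compactSpace _)
    (fun x => by positivity) (x := x) (by positivity)).ne' hzero

/-- Translating the integral by `y` multiplies it by `χ y`, which may be taken different from `1`.
-/
theorem PontryaginDual.integral_eq_zero [MeasurableSpace G] [BorelSpace G]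
    (μ : Measure G) [μ.IsHaarMeasure] {χ : PontryaginDual G} (hχ : χ ≠ 1) :
    ∫ x, (χ x : ℂ) ∂μ = 0 := by
  obtain ⟨y, hy⟩ : ∃ y, χ y ≠ 1 := by
    by_contra! h
    exact hχ (PontryaginDual.ext h)
  have h1 := integral_mul_left_eq_self (μ := μ) (fun x => (χ x : ℂ)) y
  have h3 : (fun x => ((χ (y * x) : Circle) : ℂ)) = fun x => (χ y : ℂ) * (χ x : ℂ) :=
    funext fun x => coe_apply_mul χ y x
  rw [h3, integral_const_mul] at h1
  have h2 : ((χ y : ℂ) - 1) * ∫ x, (χ x : ℂ) ∂μ = 0 := by rw [sub_mul, h1, one_mul, sub_self]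
  refine (mul_eq_zero.1 h2).resolve_left fun h => hy (Subtype.ext ?_)
  exact sub_eq_zero.1 h

/-- Characters of closed subgroups of a compact abelian group extend. -/
theorem PontryaginDual.exists_extension [T2Space G] (B : Subgroup G) (hB : IsClosed (B : Set G))
    (b : PontryaginDual B) : ∃ χ : PontryaginDual G, ∀ x : B, χ x = b x := by
  have : CompactSpace B := isCompact_iff_compactSpace.1 hB.isCompact
  let _ : MeasurableSpace B := borel B
  have : BorelSpace B := ⟨rfl⟩
  let μ : Measure B := Measure.haar
  let i : B →ₜ* G := ⟨B.subtype, continuous_subtype_val⟩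
  let r : PontryaginDual G →* PontryaginDual B :=
    { toFun := fun χ => PontryaginDual.map i χ
      map_one' := rfl
      map_mul' := fun _ _ => rfl }
  -- A character of `B` which is no restriction has non-trivial product with every restriction, so
  -- it is orthogonal to all of them. The restrictions form a group separating the points of `B`, so
  -- the character would vanish identically, although its value at the identity is `1`.
  by_contra! hcon
  have h0 := ContinuousMap.eq_zero_of_integral_character μ r.range (fun x y hxy => by
    obtain ⟨χ, hχ⟩ := exists_apply_ne_one (g := (x : G) * (y : G)⁻¹) fun h =>
      hxy (Subtype.ext (mul_inv_eq_one.1 h))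
    refine ⟨r χ, ⟨χ, rfl⟩, fun h => hχ ?_⟩
    rw [_root_.map_mul, map_inv, mul_inv_eq_one]
    exact h) (PontryaginDual.toComplex b) (by
    rintro _ ⟨χ, rfl⟩
    refine integral_eq_zero μ (χ := b * r χ) fun h => ?_
    obtain ⟨x, hx⟩ := hcon χ⁻¹
    refine hx ?_
    change (χ x)⁻¹ = b x
    have := DFunLike.congr_fun h x
    exact (eq_inv_of_mul_eq_one_left this).symm)
  have := DFunLike.congr_fun h0 1
  change ((b 1 : Circle) : ℂ) = 0 at this
  simp at this

/-- A finite dimensional continuous representation of a compact abelian group is spanned by its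
weight vectors. -/
theorem span_weightVectors_eq_top [T2Space G] {V : Type*} [AddCommGroup V] [Module ℂ V]
    [FiniteDimensional ℂ V] (A : G →* Module.End ℂ V)
    (hA : ∀ (v : V) (l : Module.Dual ℂ V), Continuous fun g => l (A g v)) :
    Submodule.span ℂ {v : V | ∃ χ : PontryaginDual G, ∀ g, A g v = (χ g : ℂ) • v} = ⊤ := by
  borelize G
  let μ : Measure G := Measure.haar
  by_contra hne
  obtain ⟨l, hl0, hl⟩ := Submodule.exists_le_ker_of_lt_top _ (lt_top_iff_ne_top.2 hne)
  refine hl0 (LinearMap.ext fun v => ?_)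
  let b := Module.finBasis ℂ V
  have hint : ∀ (χ : PontryaginDual G) (m : Module.Dual ℂ V),
      Integrable (fun g => m (A g v) * (χ g : ℂ)) μ := fun χ m =>
    ((hA v m).mul (PontryaginDual.toComplex χ).continuous).integrable_of_compactSpace μ
  -- The vector `∫ χ(g) A(g) v dg`, written in coordinates. It has weight `χ⁻¹`, so `l` kills it;
  -- this says that all Fourier coefficients of `g ↦ l (A g v)` vanish. The function is then zero,
  -- and its value at the identity is `l v`.
  let P : PontryaginDual G → V := fun χ => ∑ i, (∫ g, b.coord i (A g v) * (χ g : ℂ) ∂μ) • b i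
  have hP : ∀ χ (m : Module.Dual ℂ V), m (P χ) = ∫ g, m (A g v) * (χ g : ℂ) ∂μ := by
    intro χ m
    simp only [P, map_sum, map_smul, smul_eq_mul]
    simp_rw [← integral_mul_const]
    rw [← integral_finsetSum _ fun i _ => (hint χ (b.coord i)).mul_const _]
    refine integral_congr_ae (.of_forall fun g => ?_)
    change ∑ i, b.coord i (A g v) * (χ g : ℂ) * m (b i) = m (A g v) * (χ g : ℂ)
    conv_rhs => rw [← b.sum_repr (A g v), map_sum, Finset.sum_mul]
    refine Finset.sum_congr rfl fun i _ => ?_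
    rw [map_smul, smul_eq_mul, Module.Basis.coord_apply]
    ring
  have hw : ∀ χ, l (P χ) = 0 := fun χ => hl (Submodule.subset_span ⟨χ⁻¹, fun h => by
    rw [← sub_eq_zero, ← Module.forall_dual_apply_eq_zero_iff ℂ]
    intro m
    have h1 : m (A h (P χ)) = ∫ g, m (A (h * g) v) * (χ g : ℂ) ∂μ := by
      rw [← LinearMap.comp_apply, hP χ (m ∘ₗ A h)]
      simp only [map_mul]
      rfl
    have h2 := integral_mul_left_eq_self (μ := μ) (fun g => m (A g v) * (χ g : ℂ)) h
    have h3 : ((χ h : ℂ))⁻¹ * (χ h : ℂ) = 1 := inv_mul_cancel₀ (Circle.coe_ne_zero _)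
    rw [map_sub, map_smul, h1, hP, sub_eq_zero, ← h2, smul_eq_mul, ← integral_const_mul]
    refine integral_congr_ae (.of_forall fun g => ?_)
    have h4 : (((χ⁻¹ : PontryaginDual G) h : Circle) : ℂ) = ((χ h : ℂ))⁻¹ := Circle.coe_inv _
    simp only [map_mul, Circle.coe_mul, h4]
    linear_combination (-(m ((A h * A g) v) * (χ g : ℂ))) * h3⟩)
  have h0 := ContinuousMap.eq_zero_of_integral_character μ ⊤ (fun x y hxy => by
    obtain ⟨χ, hχ⟩ := PontryaginDual.exists_apply_ne_one (g := x * y⁻¹) fun h =>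
      hxy (mul_inv_eq_one.1 h)
    refine ⟨χ, trivial, fun h => hχ ?_⟩
    rw [map_mul, map_inv, mul_inv_eq_one, h]) ⟨_, hA v l⟩ fun χ _ => (hP χ l).symm.trans (hw χ)
  have := DFunLike.congr_fun h0 1
  change l (A 1 v) = 0 at this
  rwa [map_one] at this

/-- Take `g` where `|χ - ψ|` is maximal and compare with `g²`, where the difference is `(χ(g) -
ψ(g)) (χ(g) + ψ(g))`. If the maximum is not zero, then `|χ(g) + ψ(g)| ≤ 1`, whereas `2 ≤ |χ(g) -
ψ(g)| + |χ(g) + ψ(g)|`. -/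
theorem PontryaginDual.eq_of_norm_sub_lt_one {χ ψ : PontryaginDual G}
    (h : ∀ g, ‖(χ g : ℂ) - ψ g‖ < 1) : χ = ψ := by
  obtain ⟨g, -, hg⟩ := isCompact_univ.exists_isMaxOn Set.univ_nonempty
    (f := fun g : G => ‖(χ g : ℂ) - ψ g‖)
    (((toComplex χ).continuous.sub (toComplex ψ).continuous).norm.continuousOn)
  have h0 : ‖(χ g : ℂ) - ψ g‖ = 0 := by
    by_contra hne
    have hpos : 0 < ‖(χ g : ℂ) - ψ g‖ := lt_of_le_of_ne (norm_nonneg _) (Ne.symm hne)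
    have h1 : ‖(χ (g * g) : ℂ) - ψ (g * g)‖ ≤ ‖(χ g : ℂ) - ψ g‖ := hg (Set.mem_univ (g * g))
    have h2 : (χ (g * g) : ℂ) - ψ (g * g) = ((χ g : ℂ) - ψ g) * ((χ g : ℂ) + ψ g) := by
      rw [coe_apply_mul, coe_apply_mul]; ring
    rw [h2, norm_mul] at h1
    have h3 : ‖(χ g : ℂ) + ψ g‖ ≤ 1 := le_of_mul_le_mul_left (by simpa using h1) hpos
    have h4 : ‖(2 : ℂ) * χ g‖ ≤ ‖(χ g : ℂ) - ψ g‖ + ‖(χ g : ℂ) + ψ g‖ :=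
      (congrArg norm (by ring)).trans_le (norm_add_le _ _)
    rw [norm_mul, Circle.norm_coe] at h4
    norm_num at h4
    linarith [h g]
  refine PontryaginDual.ext fun x => Subtype.ext (sub_eq_zero.1 (norm_le_zero_iff.1 ?_))
  exact h0 ▸ hg (Set.mem_univ x)

/-- Characters which are close to `1` on a neighbourhood of the identity form a finite set. -/
theorem PontryaginDual.finite_of_nhds {O : Set G} (hO : O ∈ 𝓝 (1 : G)) :
    {χ : PontryaginDual G | ∀ g ∈ O, ‖(χ g : ℂ) - 1‖ ≤ 1 / 4}.Finite := by
  obtain ⟨t, ht⟩ : ∃ t : Finset G, ∀ g : G, ∃ k ∈ t, k⁻¹ * g ∈ O := by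
    obtain ⟨t, -, ht⟩ := isCompact_univ.elim_nhds_subcover (fun k : G => (fun g => k⁻¹ * g) ⁻¹' O)
      fun k _ => (continuous_const_mul k⁻¹).continuousAt.preimage_mem_nhds (by simpa using hO)
    refine ⟨t, fun g => ?_⟩
    obtain ⟨k, hk, hg⟩ := Set.mem_iUnion₂.1 (ht (Set.mem_univ g))
    exact ⟨k, hk, hg⟩
  let e : PontryaginDual G → (t → ℂ) := fun χ k => (χ k.1 : ℂ)
  -- The values at finitely many points, whose translates of `O` cover `G`, lie in a compact ball; a
  -- finite net there splits the characters into finitely many classes. Each class turns out to have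
  -- at most one element.
  have hb : TotallyBounded (Set.range e) := by
    refine (isCompact_closedBall (0 : t → ℂ) 1).totallyBounded.subset ?_
    rintro _ ⟨χ, rfl⟩
    rw [mem_closedBall_zero_iff, pi_norm_le_iff_of_nonneg zero_le_one]
    exact fun k => (Circle.norm_coe _).le
  obtain ⟨s, hs, hcov⟩ := Metric.totallyBounded_iff.1 hb (1 / 4) (by norm_num)
  refine Set.Finite.subset (hs.biUnion (t := fun c =>
    {χ : PontryaginDual G | (∀ g ∈ O, ‖(χ g : ℂ) - 1‖ ≤ 1 / 4) ∧ e χ ∈ Metric.ball c (1 / 4)})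
      fun c _ => Set.Subsingleton.finite ?_) ?_
  · rintro χ ⟨h1, h2⟩ ψ ⟨h3, h4⟩
    -- Two characters in one class differ by less than `1/4 + 1/4` at `k`, and each varies by at
    -- most `1/4` between `k` and `g`, so the total is below `1`.
    refine eq_of_norm_sub_lt_one fun g => ?_
    obtain ⟨k, hk, hg⟩ := ht g
    have h5 : ‖(χ k : ℂ) - ψ k‖ < 1 / 2 := by
      have := (dist_triangle_right (e χ) (e ψ) c).trans_lt
        (add_lt_add (Metric.mem_ball.1 h2) (Metric.mem_ball.1 h4))
      have h6 := (dist_le_pi_dist (e χ) (e ψ) ⟨k, hk⟩).trans_lt this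
      rw [dist_eq_norm] at h6
      exact h6.trans_eq (by norm_num)
    have key : ∀ φ : PontryaginDual G, (φ g : ℂ) = φ k * φ (k⁻¹ * g) := fun φ => by
      rw [← coe_apply_mul, mul_inv_cancel_left]
    have h7 : (χ g : ℂ) - ψ g = ((χ k : ℂ) - ψ k) + (χ k * ((χ (k⁻¹ * g) : ℂ) - 1) -
        ψ k * ((ψ (k⁻¹ * g) : ℂ) - 1)) := by rw [key χ, key ψ]; ring
    have h8 : ‖(χ k : ℂ) * ((χ (k⁻¹ * g) : ℂ) - 1)‖ ≤ 1 / 4 := by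
      rw [norm_mul, Circle.norm_coe, one_mul]; exact h1 _ hg
    have h9 : ‖(ψ k : ℂ) * ((ψ (k⁻¹ * g) : ℂ) - 1)‖ ≤ 1 / 4 := by
      rw [norm_mul, Circle.norm_coe, one_mul]; exact h3 _ hg
    rw [h7]
    refine (norm_add_le _ _).trans_lt ?_
    linarith [norm_sub_le ((χ k : ℂ) * ((χ (k⁻¹ * g) : ℂ) - 1)) (ψ k * ((ψ (k⁻¹ * g) : ℂ) - 1))]
  · intro χ hχ
    obtain ⟨c, hc, h⟩ := Set.mem_iUnion₂.1 (hcov ⟨χ, rfl⟩)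
    exact Set.mem_iUnion₂.2 ⟨c, hc, hχ, h⟩

end Characters

/-! ### Smoothness of integrals over a compact manifold depending on a parameter -/

section ParametricIntegral

open MeasureTheory

variable {Γ : Type*} [TopologicalSpace Γ] [CompactSpace Γ] [MeasurableSpace Γ]
  [OpensMeasurableSpace Γ] (μ : Measure Γ) [IsFiniteMeasure μ] {w : Γ → ℝ} (hw : Continuous w)
  {V : Type*} [NormedAddCommGroup V] [NormedSpace ℝ V]
  {E : Type} [NormedAddCommGroup E] [NormedSpace ℝ E] {S : Set E}

omit [CompactSpace Γ] [MeasurableSpace Γ] [OpensMeasurableSpace Γ] [NormedSpace ℝ E] in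
theorem continuous_slice {E' : Type*} [TopologicalSpace E'] {F : Γ → E → E'}
    (hF : ContinuousOn (Function.uncurry fun u g => F g u) (S ×ˢ Set.univ)) {u : E} (hu : u ∈ S) :
    Continuous fun g => F g u := by
  refine continuousOn_univ.1 (hF.comp (f := fun g => (u, g)) (by fun_prop) fun g _ => ⟨hu, trivial⟩)

include hw in
/-- Differentiation under the integral sign over a compact space, within a convex set. -/
theorem hasFDerivWithinAt_integral_of_compact {E' : Type*} [NormedAddCommGroup E']
    [NormedSpace ℝ E'] [CompleteSpace E'] (hS : Convex ℝ S) {F : Γ → E → E'}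
    {F' : Γ → E → E →L[ℝ] E'}
    (hF : ContinuousOn (Function.uncurry fun u g => F g u) (S ×ˢ Set.univ))
    (hF' : ContinuousOn (Function.uncurry fun u g => F' g u) (S ×ˢ Set.univ))
    (hd : ∀ g, ∀ u ∈ S, HasFDerivWithinAt (F g) (F' g u) S u) {u₀ : E} (hu₀ : u₀ ∈ S) :
    HasFDerivWithinAt (fun u => ∫ g, w g • F g u ∂μ) (∫ g, w g • F' g u₀ ∂μ) S u₀ := by
  have hi : ∀ u ∈ S, Integrable (fun g => w g • F g u) μ := fun u hu =>
    (hw.smul (continuous_slice hF hu)).integrable_of_compactSpace μ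
  have hi' : Integrable (fun g => w g • F' g u₀) μ :=
    (hw.smul (continuous_slice hF' hu₀)).integrable_of_compactSpace μ
  obtain ⟨C, hC⟩ := isCompact_univ.exists_bound_of_continuousOn hw.continuousOn
  have hC' : ∀ g, ‖w g‖ ≤ |C| := fun g => (hC g trivial).trans (le_abs_self C)
  rw [hasFDerivWithinAt_iff_isLittleO, Asymptotics.isLittleO_iff]
  intro c hc
  -- Chosen so that the weight and the total mass multiply `ε` to at most `c`; the summand `1` keeps
  -- the denominator positive when either of them vanishes.
  set ε : ℝ := c / (|C| * μ.real Set.univ + 1) with hε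
  have hpos : 0 < |C| * μ.real Set.univ + 1 := by positivity
  have hε0 : 0 < ε := by positivity
  -- By compactness of `Γ` the derivatives near `u₀` are close to those at `u₀` uniformly in `g`.
  -- The mean value inequality on a convex piece of `S` then gives a remainder estimate independent
  -- of `g`.
  obtain ⟨v, hv, hvs⟩ := isCompact_univ.mem_uniformity_of_prod hF' hu₀ (Metric.dist_mem_uniformity hε0)
  obtain ⟨δ, hδ, hball⟩ := Metric.mem_nhdsWithin_iff.1 hv
  filter_upwards [inter_mem_nhdsWithin S (Metric.ball_mem_nhds u₀ hδ)] with u hu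
  have hconv : Convex ℝ (S ∩ Metric.ball u₀ δ) := hS.inter (convex_ball u₀ δ)
  have hmv : ∀ g, ‖F g u - F g u₀ - F' g u₀ (u - u₀)‖ ≤ ε * ‖u - u₀‖ := fun g => by
    refine hconv.norm_image_sub_le_of_norm_hasFDerivWithin_le' (f' := F' g)
      (fun z hz => (hd g z hz.1).mono Set.inter_subset_left) (fun z hz => ?_)
      ⟨hu₀, Metric.mem_ball_self hδ⟩ hu
    rw [← dist_eq_norm]
    exact (hvs z (hball ⟨hz.2, hz.1⟩) g trivial).le
  have h1 : (∫ g, w g • F g u ∂μ) - (∫ g, w g • F g u₀ ∂μ) - (∫ g, w g • F' g u₀ ∂μ) (u - u₀) =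
      ∫ g, w g • (F g u - F g u₀ - F' g u₀ (u - u₀)) ∂μ := by
    have h2 : Integrable (fun g => w g • F g u - w g • F g u₀) μ := (hi u hu.1).sub (hi u₀ hu₀)
    rw [ContinuousLinearMap.integral_apply hi', ← integral_sub (hi u hu.1) (hi u₀ hu₀),
      ← integral_sub h2 (hi'.apply_continuousLinearMap _)]
    simp only [smul_sub, smul_apply]
  rw [h1]
  refine (norm_integral_le_of_norm_le_const (C := |C| * (ε * ‖u - u₀‖))
    (.of_forall fun g => ?_)).trans ?_
  · rw [norm_smul]
    exact mul_le_mul (hC' g) (hmv g) (norm_nonneg _) (abs_nonneg C)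
  · have : |C| * μ.real Set.univ * ε ≤ c := by
      rw [hε, mul_div_assoc', div_le_iff₀ hpos]
      nlinarith
    nlinarith [norm_nonneg (u - u₀)]

/-- A family of functions on `S` which depends smoothly on the parameter in suitable charts. -/
def SmoothFamily (V : Type*) [NormedAddCommGroup V] [NormedSpace ℝ V] (S : Set E) {E' : Type}
    [NormedAddCommGroup E'] [NormedSpace ℝ E'] (F : Γ → E → E') : Prop :=
  ∀ g₀ : Γ, ∃ (κ : Γ → V) (O : Set V) (Φ : V → E → E'), IsOpen O ∧
    (∀ᶠ g in 𝓝 g₀, ContinuousAt κ g ∧ κ g ∈ O ∧ ∀ u ∈ S, F g u = Φ (κ g) u) ∧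
    ContDiffOn ℝ ∞ (Function.uncurry Φ) (O ×ˢ S)

omit [CompactSpace Γ] [MeasurableSpace Γ] [OpensMeasurableSpace Γ] in
theorem SmoothFamily.continuousOn {E' : Type} [NormedAddCommGroup E'] [NormedSpace ℝ E']
    {F : Γ → E → E'} (hF : SmoothFamily V S F) :
    ContinuousOn (Function.uncurry fun u g => F g u) (S ×ˢ Set.univ) := by
  rintro ⟨u, g⟩ ⟨hu, -⟩
  obtain ⟨κ, O, Φ, hO, hev, hΦ⟩ := hF g
  have h1 : ContinuousWithinAt (fun z : E × Γ => Function.uncurry Φ (κ z.2, z.1))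
      (S ×ˢ {g | κ g ∈ O}) (u, g) := by
    refine ContinuousWithinAt.comp (t := O ×ˢ S) (g := Function.uncurry Φ)
      (f := fun z : E × Γ => (κ z.2, z.1)) (hΦ.continuousOn (κ g, u) ⟨hev.self_of_nhds.2.1, hu⟩) ?_ fun (z : E × Γ) hz => ⟨hz.2, hz.1⟩
    refine ContinuousAt.continuousWithinAt (ContinuousAt.prodMk ?_ continuousAt_fst)
    exact ContinuousAt.comp (g := κ) hev.self_of_nhds.1 continuousAt_snd
  have h2 : S ×ˢ {g | κ g ∈ O} ∈ 𝓝[S ×ˢ Set.univ] (u, g) := by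
    rw [nhdsWithin_prod_eq, nhdsWithin_univ]
    exact prod_mem_prod self_mem_nhdsWithin (hev.mono fun g hg => hg.2.1)
  refine (h1.mono_of_mem_nhdsWithin h2).congr_of_eventuallyEq ?_ (hev.self_of_nhds.2.2 u hu)
  rw [nhdsWithin_prod_eq, nhdsWithin_univ]
  filter_upwards [prod_mem_prod (self_mem_nhdsWithin (s := S) (a := u)) hev] with z hz
  exact hz.2.2.2 z.1 hz.1

omit [CompactSpace Γ] [MeasurableSpace Γ] [OpensMeasurableSpace Γ] in
-- The class is stable under differentiation in `u`, which is what the induction on the order of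
-- differentiability needs.
theorem SmoothFamily.fderivWithin {E' : Type} [NormedAddCommGroup E'] [NormedSpace ℝ E']
    (hS : UniqueDiffOn ℝ S) {F : Γ → E → E'} (hF : SmoothFamily V S F) :
    SmoothFamily V S fun g u => fderivWithin ℝ (F g) S u := by
  intro g₀
  obtain ⟨κ, O, Φ, hO, hev, hΦ⟩ := hF g₀
  refine ⟨κ, O, fun v u => _root_.fderivWithin ℝ (Φ v) S u, hO, ?_, ?_⟩
  · filter_upwards [hev] with g hg
    exact ⟨hg.1, hg.2.1, fun u hu => fderivWithin_congr (fun z hz => hg.2.2 z hz) (hg.2.2 u hu)⟩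
  · rintro ⟨v, u⟩ ⟨hv, hu⟩
    refine ContDiffWithinAt.fderivWithin (f := fun (z : V × E) u => Φ z.1 u) (g := Prod.snd)
      (t := S) (m := ∞) (n := ∞) ?_ contDiffWithinAt_snd hS le_rfl ⟨hv, hu⟩ fun z hz => hz.2
    refine ContDiffWithinAt.comp ((v, u), u) (t := O ×ˢ S) (hΦ (v, u) ⟨hv, hu⟩)
      (f := fun z : (V × E) × E => (z.1.1, z.2)) ?_ fun z hz => ⟨hz.1.1, hz.2⟩
    exact ContDiff.contDiffWithinAt (by fun_prop)

omit [CompactSpace Γ] [MeasurableSpace Γ] [OpensMeasurableSpace Γ] in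
theorem SmoothFamily.hasFDerivWithinAt {E' : Type} [NormedAddCommGroup E'] [NormedSpace ℝ E']
    {F : Γ → E → E'} (hF : SmoothFamily V S F) (g : Γ) {u : E} (hu : u ∈ S) :
    HasFDerivWithinAt (F g) (_root_.fderivWithin ℝ (F g) S u) S u := by
  refine DifferentiableWithinAt.hasFDerivWithinAt ?_
  obtain ⟨κ, O, Φ, hO, hev, hΦ⟩ := hF g
  obtain ⟨-, hg, he⟩ := hev.self_of_nhds
  refine DifferentiableWithinAt.congr (f := fun u => Function.uncurry Φ (κ g, u)) ?_ he (he u hu)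
  exact DifferentiableWithinAt.comp u
    ((hΦ.differentiableOn (by simp)) (κ g, u) ⟨hg, hu⟩)
    (by fun_prop) fun z hz => ⟨hg, hz⟩

include hw in
-- Induction on the order: the derivative of the integral is the integral of the derivative, which
-- is again a smooth family. Its values are linear maps from `E`, so the target must vary in the
-- induction; with `E` and `E'` in `Type`, the space of linear maps stays in the same universe.
theorem SmoothFamily.contDiffOn_integral (hS : UniqueDiffOn ℝ S) (hc : Convex ℝ S) (n : ℕ) :
    ∀ {E' : Type} [NormedAddCommGroup E'] [NormedSpace ℝ E'] [CompleteSpace E']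
      {F : Γ → E → E'}, SmoothFamily V S F →
      ContDiffOn ℝ n (fun u => ∫ g, w g • F g u ∂μ) S := by
  induction n with
  | zero =>
    intro E' _ _ _ F hF
    refine contDiffOn_zero.2 fun u hu => ?_
    exact (hasFDerivWithinAt_integral_of_compact μ hw hc hF.continuousOn
      (hF.fderivWithin hS).continuousOn (fun g _ => hF.hasFDerivWithinAt g) hu).continuousWithinAt
  | succ n ih =>
    intro E' _ _ _ F hF
    have hd : ∀ u ∈ S, HasFDerivWithinAt (fun u => ∫ g, w g • F g u ∂μ)
        (∫ g, w g • _root_.fderivWithin ℝ (F g) S u ∂μ) S u := fun u hu =>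
      hasFDerivWithinAt_integral_of_compact μ hw hc hF.continuousOn
        (hF.fderivWithin hS).continuousOn (fun g _ => hF.hasFDerivWithinAt g) hu
    push_cast
    refine contDiffOn_succ_of_fderivWithin (fun u hu => (hd u hu).differentiableWithinAt)
      (by simp) ?_
    exact (ih (hF.fderivWithin hS)).congr fun u hu => (hd u hu).fderivWithin (hS u hu)

/-- The integral over a compact manifold of a smooth function depending smoothly on a parameter in a
manifold with corners is smooth. -/
theorem contMDiffAt_integral_real {EG HG : Type*} [NormedAddCommGroup EG] [NormedSpace ℝ EG]
    [TopologicalSpace HG] {J : ModelWithCorners ℝ EG HG} [J.Boundaryless] {G : Type*}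
    [TopologicalSpace G] [ChartedSpace HG G] [IsManifold J ∞ G] [CompactSpace G]
    [MeasurableSpace G] [OpensMeasurableSpace G] (μ : Measure G) [IsFiniteMeasure μ]
    {HM : Type*} [TopologicalSpace HM] {I : ModelWithCorners ℝ E HM} {M : Type*}
    [TopologicalSpace M] [ChartedSpace HM M] [IsManifold I ∞ M]
    {w : G → ℝ} (hw : Continuous w) {F : G × M → ℂ} {x : M}
    (hF : ∀ᶠ y in 𝓝 x, ∀ g, ContMDiffAt (J.prod I) 𝓘(ℝ, ℂ) ∞ F (g, y)) :
    ContMDiffAt I 𝓘(ℝ, ℂ) ∞ (fun y => ∫ g, w g • F (g, y) ∂μ) x := by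
  set e := extChartAt I x with he
  have h1 : ∀ᶠ u in 𝓝[Set.range I] (e x), u ∈ e.target ∧
      ∀ g, ContMDiffAt (J.prod I) 𝓘(ℝ, ℂ) ∞ F (g, e.symm u) := by
    have h2 : e.target ∈ 𝓝[Set.range I] (e x) := extChartAt_target_mem_nhdsWithin x
    have h3 := (continuousAt_extChartAt_symm (I := I) x).tendsto
    rw [extChartAt_to_inv] at h3
    filter_upwards [h2, mem_nhdsWithin_of_mem_nhds (h3 hF)] with u hu hu'
    exact ⟨hu, hu'⟩
  obtain ⟨r, hr, hball⟩ := Metric.mem_nhdsWithin_iff.1 h1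
  -- A piece of the range of the model. It is convex and has unique derivatives even at corners, so
  -- no distinction between interior and boundary points is necessary.
  set S : Set E := Metric.ball (e x) r ∩ Set.range I with hS
  have hconv : Convex ℝ S := (convex_ball _ _).inter I.convex_range
  have huniq : UniqueDiffOn ℝ S := by
    rw [hS, Set.inter_comm]
    exact I.uniqueDiffOn.inter Metric.isOpen_ball
  have hfam : SmoothFamily EG S fun (g : G) u => F (g, e.symm u) := by
    intro g₀
    refine ⟨extChartAt J g₀, (extChartAt J g₀).target,
      fun v u => F ((extChartAt J g₀).symm v, e.symm u), isOpen_extChartAt_target g₀, ?_, ?_⟩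
    · filter_upwards [extChartAt_source_mem_nhds (I := J) g₀] with g hg
      refine ⟨(continuousOn_extChartAt g₀).continuousAt
        ((isOpen_extChartAt_source g₀).mem_nhds hg), (extChartAt J g₀).map_source hg, fun u _ => ?_⟩
      rw [(extChartAt J g₀).left_inv hg]
    · rw [← contMDiffOn_iff_contDiffOn]
      rintro ⟨v, u⟩ ⟨hv, hu⟩
      have h4 : ContMDiffWithinAt 𝓘(ℝ, EG × E) (J.prod I) ∞
          (fun z : EG × E => ((extChartAt J g₀).symm z.1, e.symm z.2))
          ((extChartAt J g₀).target ×ˢ S) (v, u) := by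
        refine ContMDiffWithinAt.prodMk ?_ ?_
        · exact ContMDiffWithinAt.comp (v, u) (t := (extChartAt J g₀).target)
            (contMDiffOn_extChartAt_symm g₀ v hv) contDiff_fst.contMDiff.contMDiffAt.contMDiffWithinAt fun z hz => hz.1
        · exact ContMDiffWithinAt.comp (v, u) (t := e.target)
            (contMDiffOn_extChartAt_symm x u (hball hu).1) contDiff_snd.contMDiff.contMDiffAt.contMDiffWithinAt
            fun z hz => (hball hz.2).1
      exact ContMDiffAt.comp_contMDiffWithinAt (v, u) ((hball hu).2 _) h4
  have hsm : ContDiffOn ℝ ∞ (fun u => ∫ g, w g • F (g, e.symm u) ∂μ) S :=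
    contDiffOn_infty.2 fun n => hfam.contDiffOn_integral μ hw huniq hconv n
  have hS' : S ∈ 𝓝[Set.range I] (e x) :=
    Filter.inter_mem (mem_nhdsWithin_of_mem_nhds (Metric.ball_mem_nhds _ hr)) self_mem_nhdsWithin
  have hpre : e ⁻¹' S ∈ 𝓝 x := by
    have h5 : Tendsto e (𝓝 x) (𝓝[Set.range I] (e x)) := by
      refine tendsto_nhdsWithin_iff.2 ⟨continuousAt_extChartAt x, ?_⟩
      exact .of_forall fun y => ⟨_, rfl⟩
    exact h5 hS'
  have h6 : ContMDiffWithinAt I 𝓘(ℝ, ℂ) ∞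
      ((fun u => ∫ g, w g • F (g, e.symm u) ∂μ) ∘ e) (e ⁻¹' S) x := by
    refine ContMDiffWithinAt.comp x (t := S) (I' := 𝓘(ℝ, E)) ?_
      contMDiffAt_extChartAt.contMDiffWithinAt fun y hy => hy
    exact (contMDiffOn_iff_contDiffOn.2 hsm) _ (mem_of_mem_nhds hpre : x ∈ e ⁻¹' S)
  refine (h6.contMDiffAt hpre).congr_of_eventuallyEq ?_
  filter_upwards [extChartAt_source_mem_nhds (I := I) x] with y hy
  simp only [Function.comp_apply, he, (extChartAt I x).left_inv hy]

theorem contMDiffAt_integral {EG HG : Type*} [NormedAddCommGroup EG] [NormedSpace ℝ EG]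
    [TopologicalSpace HG] {J : ModelWithCorners ℝ EG HG} [J.Boundaryless] {G : Type*}
    [TopologicalSpace G] [ChartedSpace HG G] [IsManifold J ∞ G] [CompactSpace G]
    [MeasurableSpace G] [OpensMeasurableSpace G] (μ : Measure G) [IsFiniteMeasure μ]
    {HM : Type*} [TopologicalSpace HM] {I : ModelWithCorners ℝ E HM} {M : Type*}
    [TopologicalSpace M] [ChartedSpace HM M] [IsManifold I ∞ M]
    {w : G → ℂ} (hw : Continuous w) {F : G × M → ℂ} {x : M}
    (hF : ∀ᶠ y in 𝓝 x, ∀ g, ContMDiffAt (J.prod I) 𝓘(ℝ, ℂ) ∞ F (g, y)) :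
    ContMDiffAt I 𝓘(ℝ, ℂ) ∞ (fun y => ∫ g, w g * F (g, y) ∂μ) x := by
  have h1 := contMDiffAt_integral_real μ (Complex.continuous_re.comp hw) hF
  have h2 := contMDiffAt_integral_real μ (Complex.continuous_im.comp hw) hF
  refine (h1.add ((contMDiffAt_const (c := Complex.I)).mul_complex h2)).congr_of_eventuallyEq ?_
  filter_upwards [hF] with y hy
  have hc : Continuous fun g => F (g, y) := continuous_iff_continuousAt.2 fun g =>
    ContinuousAt.comp (g := F) (f := fun g => (g, y)) (hy g).continuousAt (by fun_prop)
  change _ = (∫ g, (w g).re • F (g, y) ∂μ) + Complex.I * ∫ g, (w g).im • F (g, y) ∂μ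
  rw [← integral_const_mul, ← integral_add]
  · refine integral_congr_ae (.of_forall fun g => ?_)
    simp only [Complex.real_smul]
    linear_combination (-F (g, y)) * Complex.re_add_im (w g)
  · exact ((Complex.continuous_re.comp hw).smul hc).integrable_of_compactSpace μ
  · exact (((Complex.continuous_im.comp hw).smul hc).const_smul Complex.I).integrable_of_compactSpace μ

end ParametricIntegral

/-! ### Algebra of germs of smooth functions -/

section SmoothNear

variable {EM HM M : Type*} [NormedAddCommGroup EM] [NormedSpace ℝ EM] [TopologicalSpace HM]
  {I : ModelWithCorners ℝ EM HM} [TopologicalSpace M] [ChartedSpace HM M] {f g : M → ℂ} {x : M}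

theorem SmoothNear.contMDiffAt (hf : SmoothNear I f x) : ContMDiffAt I 𝓘(ℝ, ℂ) ∞ f x :=
  hf.self_of_nhds

theorem SmoothNear.continuousAt (hf : SmoothNear I f x) : ContinuousAt f x :=
  hf.contMDiffAt.continuousAt

theorem SmoothNear.const (c : ℂ) : SmoothNear I (fun _ => c) x :=
  .of_forall fun _ => contMDiffAt_const

theorem SmoothNear.congr (hf : SmoothNear I f x) (h : ∀ᶠ y in 𝓝 x, g y = f y) :
    SmoothNear I g x := by
  filter_upwards [hf, h.eventually_nhds] with y hy h' using hy.congr_of_eventuallyEq h'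

theorem SmoothNear.add (hf : SmoothNear I f x) (hg : SmoothNear I g x) :
    SmoothNear I (fun y => f y + g y) x := by
  filter_upwards [hf, hg] with y h1 h2 using h1.add h2

theorem SmoothNear.mul (hf : SmoothNear I f x) (hg : SmoothNear I g x) :
    SmoothNear I (fun y => f y * g y) x := by
  filter_upwards [hf, hg] with y h1 h2 using h1.mul_complex h2

theorem SmoothNear.sum {ι : Type*} (s : Finset ι) {f : ι → M → ℂ}
    (hf : ∀ i ∈ s, SmoothNear I (f i) x) : SmoothNear I (fun y => ∑ i ∈ s, f i y) x := by
  classical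
  induction s using Finset.induction_on with
  | empty => simpa using SmoothNear.const 0
  | insert a s ha ih =>
    simp only [Finset.sum_insert ha]
    exact (hf a (by simp)).add (ih fun i hi => hf i (by simp [hi]))

theorem SmoothNear.prod {ι : Type*} (s : Finset ι) {f : ι → M → ℂ}
    (hf : ∀ i ∈ s, SmoothNear I (f i) x) : SmoothNear I (fun y => ∏ i ∈ s, f i y) x := by
  classical
  induction s using Finset.induction_on with
  | empty => simpa using SmoothNear.const 1
  | insert a s ha ih =>
    simp only [Finset.prod_insert ha]
    exact (hf a (by simp)).mul (ih fun i hi => hf i (by simp [hi]))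

theorem SmoothNear.inv (hf : SmoothNear I f x) (h : f x ≠ 0) :
    SmoothNear I (fun y => (f y)⁻¹) x := by
  filter_upwards [hf, hf.continuousAt.eventually_ne h] with y h1 h2
  exact ((contDiffAt_inv ℝ h2).contMDiffAt).comp y h1

theorem SmoothNear.comp {EN HN N : Type*} [NormedAddCommGroup EN] [NormedSpace ℝ EN]
    [TopologicalSpace HN] {J : ModelWithCorners ℝ EN HN} [TopologicalSpace N] [ChartedSpace HN N]
    {φ : N → M} {y : N} (hf : SmoothNear I f (φ y)) (hφ : ∀ᶠ z in 𝓝 y, ContMDiffAt J I ∞ φ z) :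
    SmoothNear J (fun z => f (φ z)) y := by
  filter_upwards [hφ, hφ.self_of_nhds.continuousAt.eventually hf] with z h1 h2
  exact ContMDiffAt.comp z h2 h1

theorem SmoothNear.det {ι : Type*} [Fintype ι] [DecidableEq ι] {A : M → Matrix ι ι ℂ}
    (hA : ∀ i j, SmoothNear I (fun y => A y i j) x) : SmoothNear I (fun y => (A y).det) x := by
  simp only [Matrix.det_apply']
  exact .sum _ fun σ _ => (SmoothNear.const _).mul (.prod _ fun i _ => hA _ _)

/-- Cramer's rule: the entries of the inverse are determinants of smooth matrices divided by a
non-vanishing one. -/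
theorem SmoothNear.matrix_inv {ι : Type*} [Fintype ι] [DecidableEq ι] {A : M → Matrix ι ι ℂ}
    (hA : ∀ i j, SmoothNear I (fun y => A y i j) x) (h : (A x).det ≠ 0) (i j : ι) :
    SmoothNear I (fun y => (A y)⁻¹ i j) x := by
  simp only [Matrix.inv_def, Matrix.smul_apply, Ring.inverse_eq_inv', smul_eq_mul,
    Matrix.adjugate_apply]
  refine ((SmoothNear.det hA).inv h).mul (SmoothNear.det fun k l => ?_)
  simp only [Matrix.updateRow_apply]
  split_ifs
  · exact .const _
  · exact hA _ _

end SmoothNear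

/-! ### Frames, coordinates and constructions on vector bundles -/

namespace PreBundle

variable {EM HM : Type*} [NormedAddCommGroup EM] [NormedSpace ℝ EM] [TopologicalSpace HM]
  (I : ModelWithCorners ℝ EM HM) {M : Type u} [TopologicalSpace M] [ChartedSpace HM M]

/-- Near `y`, the section `s` is a combination of the sections `e` with smooth coefficients. -/
def Expands {Fib : M → Type*} [∀ x, AddCommGroup (Fib x)] [∀ x, Module ℂ (Fib x)]
    {ι : Type*} [Fintype ι] (e : ι → ∀ y, Fib y) (s : ∀ y, Fib y) (y : M) : Prop :=
  ∃ c : ι → M → ℂ, (∀ i, SmoothNear I (c i) y) ∧ ∀ᶠ z in 𝓝 y, s z = ∑ i, c i z • e i z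

section Expands

variable {I} {Fib : M → Type u} [∀ x, AddCommGroup (Fib x)] [∀ x, Module ℂ (Fib x)]
    {ι : Type*} [Fintype ι] {e : ι → ∀ y, Fib y} {s t : ∀ y, Fib y} {y : M}

theorem Expands.zero : Expands I e (fun _ => 0) y :=
  ⟨fun _ _ => 0, fun _ => .const 0, .of_forall fun z => by simp⟩

theorem Expands.add (hs : Expands I e s y) (ht : Expands I e t y) :
    Expands I e (fun z => s z + t z) y := by
  obtain ⟨c, hc, hs⟩ := hs
  obtain ⟨d, hd, ht⟩ := ht
  refine ⟨fun i z => c i z + d i z, fun i => (hc i).add (hd i), ?_⟩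
  filter_upwards [hs, ht] with z h1 h2
  simp only [add_smul, Finset.sum_add_distrib, h1, h2]

theorem Expands.smul {a : M → ℂ} (ha : SmoothNear I a y) (hs : Expands I e s y) :
    Expands I e (fun z => a z • s z) y := by
  obtain ⟨c, hc, hs⟩ := hs
  refine ⟨fun i z => a z * c i z, fun i => ha.mul (hc i), ?_⟩
  filter_upwards [hs] with z h1
  simp only [mul_smul, ← Finset.smul_sum, h1]

theorem Expands.congr (hst : ∀ᶠ z in 𝓝 y, s z = t z) (hs : Expands I e s y) :
    Expands I e t y := by
  obtain ⟨c, hc, hs⟩ := hs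
  refine ⟨c, hc, ?_⟩
  filter_upwards [hst, hs] with z h1 h2 using h1.symm.trans h2

theorem Expands.self (i : ι) : Expands I e (e i) y := by
  classical
  exact ⟨fun j _ => if j = i then 1 else 0, fun j => .const _, .of_forall fun z => by simp⟩

/-- Sections generated by sections which expand in a frame expand in this frame. -/
theorem Generated.expands {S : Set (∀ x, Fib x)} (h : ∀ s ∈ S, Expands I e s y)
    (hs : Generated I S y s) : Expands I e s y := by
  induction hs with
  | of s hs => exact h s hs
  | zero => exact .zero
  | add s t _ _ hs ht => exact hs.add ht
  | smul a s ha _ hs => exact hs.smul ha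
  | congr s t hst _ hs => exact hs.congr hst

theorem Expands.generated {S : Set (∀ x, Fib x)} (h : ∀ i, Generated I S y (e i))
    (hs : Expands I e s y) : Generated I S y s := by
  classical
  obtain ⟨c, hc, hs⟩ := hs
  refine Generated.congr _ _ (hs.mono fun z hz => hz.symm) ?_
  have key : ∀ F : Finset ι, Generated I S y fun z => ∑ i ∈ F, c i z • e i z := by
    intro F
    induction F using Finset.induction_on with
    | empty => simpa using Generated.zero
    | insert a F ha ih =>
      simp only [Finset.sum_insert ha]
      exact .add _ _ (.smul _ _ (hc a) (h a)) ih
  exact key Finset.univ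

theorem Expands.comp {EN HN : Type*} [NormedAddCommGroup EN] [NormedSpace ℝ EN]
    [TopologicalSpace HN] {J : ModelWithCorners ℝ EN HN} {N : Type*} [TopologicalSpace N]
    [ChartedSpace HN N] {φ : N → M} {x : N} (hs : Expands I e s (φ x))
    (hφ : ∀ᶠ z in 𝓝 x, ContMDiffAt J I ∞ φ z) :
    Expands J (Fib := fun z => Fib (φ z)) (fun i z => e i (φ z)) (fun z => s (φ z)) x := by
  obtain ⟨c, hc, hs⟩ := hs
  exact ⟨fun i z => c i (φ z), fun i => (hc i).comp hφ,
    hφ.self_of_nhds.continuousAt.eventually hs⟩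

end Expands

variable {E F : PreBundle M} {ι κ : Type*} [Fintype ι] [Fintype κ]

/-- The sections `e` form a frame of the family `E` at `y`. -/
def IsFrameAt (E : PreBundle M) (e : ι → ∀ y, E.Fib y) (y : M) : Prop :=
  LinearIndependent ℂ (fun i => e i y) ∧
    Submodule.span ℂ (Set.range fun i => e i y) = ⊤ ∧
    ∀ s, E.SmoothAt s y ↔ Expands I e s y

open Classical in
/-- The coordinates with respect to sections which form a basis of the fibre. -/
noncomputable def coord (E : PreBundle M) (e : ι → ∀ y, E.Fib y) (y : M) : E.Fib y →ₗ[ℂ] (ι → ℂ) :=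
  if h : LinearIndependent ℂ (fun i => e i y) ∧
      Submodule.span ℂ (Set.range fun i => e i y) = ⊤ then
    (Module.Basis.mk h.1 h.2.ge).equivFun.toLinearMap
  -- The value zero where the sections are no basis makes the coordinates of a section functions on
  -- all of `M`, so that one can speak of smoothness of their germs.
  else 0

variable {I} {e : ι → ∀ y, E.Fib y} {y : M}

/-- The basis of the fibre given by a frame. -/
noncomputable def IsFrameAt.basis (h : IsFrameAt I E e y) : Module.Basis ι ℂ (E.Fib y) :=
  Module.Basis.mk h.1 h.2.1.ge

theorem IsFrameAt.basis_apply (h : IsFrameAt I E e y) (i : ι) : h.basis i = e i y :=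
  Module.Basis.mk_apply _ _ _

theorem IsFrameAt.coord_eq (h : IsFrameAt I E e y) : coord E e y = h.basis.equivFun := by
  rw [coord, dif_pos ⟨h.1, h.2.1⟩]
  rfl

theorem IsFrameAt.sum_coord (h : IsFrameAt I E e y) (v : E.Fib y) :
    ∑ i, coord E e y v i • e i y = v := by
  rw [h.coord_eq]
  conv_rhs => rw [← h.basis.sum_equivFun v]
  simp only [h.basis_apply]
  rfl

theorem IsFrameAt.coord_sum (h : IsFrameAt I E e y) (c : ι → ℂ) :
    coord E e y (∑ i, c i • e i y) = c := by
  rw [h.coord_eq]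
  simp only [← h.basis_apply]
  rw [← h.basis.equivFun_symm_apply]
  exact h.basis.equivFun.apply_symm_apply c

theorem IsFrameAt.coord_injective (h : IsFrameAt I E e y) : Function.Injective (coord E e y) := by
  rw [h.coord_eq]
  exact h.basis.equivFun.injective

theorem IsFrameAt.coord_self [DecidableEq ι] (h : IsFrameAt I E e y) (i : ι) :
    coord E e y (e i y) = Pi.single i 1 := by
  conv_lhs => rw [show e i y = ∑ j, (Pi.single i 1 : ι → ℂ) j • e j y by simp [Pi.single_apply]]
  exact h.coord_sum _

theorem IsFrameAt.smoothAt (h : IsFrameAt I E e y) (i : ι) : E.SmoothAt (e i) y :=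
  (h.2.2 _).2 (.self i)

/-- The coefficients in a frame are unique, so the existential in `Expands` can be replaced by
definite functions. This turns questions on sections into questions on scalar functions. -/
theorem smoothAt_iff_coord (h : ∀ᶠ z in 𝓝 y, IsFrameAt I E e z) (s : ∀ x, E.Fib x) :
    E.SmoothAt s y ↔ ∀ i, SmoothNear I (fun z => coord E e z (s z) i) y := by
  rw [h.self_of_nhds.2.2]
  constructor
  · rintro ⟨c, hc, hs⟩ i
    refine (hc i).congr ?_
    filter_upwards [h, hs] with z hz hsz
    rw [hsz, hz.coord_sum fun i => c i z]
  · intro hs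
    refine ⟨_, hs, ?_⟩
    filter_upwards [h] with z hz using (hz.sum_coord _).symm

theorem isFrameAt_of_basis (b : Module.Basis ι ℂ (E.Fib y)) (hb : ∀ i, b i = e i y)
    (hs : ∀ s, E.SmoothAt s y ↔ Expands I e s y) : IsFrameAt I E e y := by
  have : (fun i => e i y) = b := funext fun i => (hb i).symm
  refine ⟨?_, ?_, hs⟩
  · rw [this]; exact b.linearIndependent
  · rw [this]; exact b.span_eq

theorem IsFrameAt.reindex (h : IsFrameAt I E e y) (σ : κ ≃ ι) :
    IsFrameAt I E (fun k => e (σ k)) y := by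
  refine isFrameAt_of_basis (h.basis.reindex σ.symm) (fun k => ?_) fun s => ?_
  · rw [Module.Basis.reindex_apply, h.basis_apply]
    rfl
  · rw [h.2.2]
    constructor
    · rintro ⟨c, hc, hs⟩
      refine ⟨fun k => c (σ k), fun k => hc _, hs.mono fun z hz => hz.trans ?_⟩
      exact (σ.sum_comp fun i => c i z • e i z).symm
    · rintro ⟨c, hc, hs⟩
      refine ⟨fun i => c (σ.symm i), fun k => hc _, hs.mono fun z hz => hz.trans ?_⟩
      rw [← σ.sum_comp]
      simp

/-- Allows frames indexed by products and sigma types, as they arise for tensor products and direct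
sums. -/
theorem isVectorBundle_of_frames
    (h : ∀ x, ∃ (ι : Type u) (_ : Fintype ι) (e : ι → ∀ y, E.Fib y),
      ∀ᶠ y in 𝓝 x, IsFrameAt I E e y) : E.IsVectorBundle I := by
  intro x
  obtain ⟨ι, _, e, he⟩ := h x
  exact ⟨Fintype.card ι, fun k => e ((Fintype.equivFin ι).symm k),
    he.mono fun y hy => hy.reindex (Fintype.equivFin ι).symm⟩

theorem IsVectorBundle.exists_frame (hE : E.IsVectorBundle I) (x : M) :
    ∃ (n : ℕ) (e : Fin n → ∀ y, E.Fib y), ∀ᶠ y in 𝓝 x, IsFrameAt I E e y := hE x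

theorem IsVectorBundle.finiteDimensional (hE : E.IsVectorBundle I) (x : M) :
    FiniteDimensional ℂ (E.Fib x) := by
  obtain ⟨n, e, he⟩ := hE x
  exact Module.Finite.of_basis (IsFrameAt.basis (I := I) he.self_of_nhds)

/-- The pull-back of a frame, along a map which is smooth nearby. -/
theorem IsFrameAt.pullback {EN HN : Type*} [NormedAddCommGroup EN] [NormedSpace ℝ EN]
    [TopologicalSpace HN] {J : ModelWithCorners ℝ EN HN} {N : Type u} [TopologicalSpace N]
    [ChartedSpace HN N] {φ : N → M} {x : N} (h : IsFrameAt I E e (φ x))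
    (hφ : ∀ᶠ z in 𝓝 x, ContMDiffAt J I ∞ φ z) :
    IsFrameAt J (PreBundle.pullback J φ E) (fun i z => e i (φ z)) x := by
  refine ⟨h.1, h.2.1, fun s => ⟨fun hs => ?_, fun hs => ?_⟩⟩
  · refine Generated.expands (Fib := fun z => E.Fib (φ z)) ?_ hs
    rintro _ ⟨t, ht, rfl⟩
    exact ((h.2.2 t).1 ht).comp hφ
  · exact Expands.generated (Fib := fun z => E.Fib (φ z))
      (fun i => .of _ ⟨e i, h.smoothAt i, rfl⟩) hs

/-- The tensor product of two sections. -/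
def tmulSection (s : ∀ y, E.Fib y) (t : ∀ y, F.Fib y) (y : M) : E.Fib y ⊗[ℂ] F.Fib y :=
  s y ⊗ₜ[ℂ] t y

theorem IsFrameAt.tensor {f : κ → ∀ y, F.Fib y} (h : IsFrameAt I E e y) (h' : IsFrameAt I F f y) :
    IsFrameAt I (PreBundle.tensor I E F)
      (fun k : ι × κ => tmulSection (e k.1) (f k.2)) y := by
  have hb : ∀ k : ι × κ, h.basis.tensorProduct h'.basis k = e k.1 y ⊗ₜ[ℂ] f k.2 y := fun k => by
    rw [Module.Basis.tensorProduct_apply', h.basis_apply, h'.basis_apply]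
  refine isFrameAt_of_basis (E := PreBundle.tensor I E F)
    (e := fun k : ι × κ => tmulSection (e k.1) (f k.2))
    (h.basis.tensorProduct h'.basis) hb fun s => ⟨fun hs => ?_, fun hs => ?_⟩
  · refine Generated.expands (Fib := fun z => E.Fib z ⊗[ℂ] F.Fib z) ?_ hs
    rintro _ ⟨t, t', ht, ht', rfl⟩
    obtain ⟨c, hc, ht⟩ := (h.2.2 t).1 ht
    obtain ⟨d, hd, ht'⟩ := (h'.2.2 t').1 ht'
    refine ⟨fun k z => c k.1 z * d k.2 z, fun k => (hc _).mul (hd _), ?_⟩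
    filter_upwards [ht, ht'] with z h1 h2
    rw [h1, h2, TensorProduct.sum_tmul, Fintype.sum_prod_type]
    simp only [TensorProduct.tmul_sum, TensorProduct.smul_tmul_smul]
    rfl
  · exact Expands.generated (Fib := fun z => E.Fib z ⊗[ℂ] F.Fib z)
      (e := fun k : ι × κ => tmulSection (e k.1) (f k.2))
      (fun k => .of _ ⟨e k.1, f k.2, h.smoothAt k.1, h'.smoothAt k.2, rfl⟩) hs

theorem IsVectorBundle.tensor (hE : E.IsVectorBundle I) (hF : F.IsVectorBundle I) :
    (PreBundle.tensor I E F).IsVectorBundle I := by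
  refine isVectorBundle_of_frames fun x => ?_
  obtain ⟨n, e, he⟩ := hE.exists_frame x
  obtain ⟨m, f, hf⟩ := hF.exists_frame x
  refine ⟨ULift (Fin n × Fin m), inferInstance, fun k =>
    tmulSection (e k.down.1) (f k.down.2), ?_⟩
  filter_upwards [he, hf] with y h1 h2
  exact (h1.tensor h2).reindex Equiv.ulift

/-- A direct sum of vector bundles, all but finitely many of which vanish. -/
theorem IsVectorBundle.directSum {ι : Type u} {F : ι → PreBundle M}
    (hF : ∀ i, (F i).IsVectorBundle I) {T : Set ι} (hT : T.Finite)
    (h0 : ∀ i ∉ T, ∀ x, Subsingleton ((F i).Fib x)) :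
    (PreBundle.directSum F).IsVectorBundle I := by
  classical
  refine isVectorBundle_of_frames fun x => ?_
  have := hT.fintype
  choose n e he using fun i => (hF i).exists_frame x
  let E : (Σ i : T, ULift.{u} (Fin (n i))) → ∀ z, ⨁ i, (F i).Fib z := fun k z =>
    DirectSum.lof ℂ ι (fun i => (F i).Fib z) k.1 (e k.1 k.2.down z)
  refine ⟨_, inferInstance, E, ?_⟩
  filter_upwards [hT.eventually_all.2 fun i _ => he i] with y hy
  have hE0 : ∀ (z : M) (i j : T) (a : ULift.{u} (Fin (n i))), i ≠ j → E ⟨i, a⟩ z j.1 = 0 :=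
    fun z i j a hij => DirectSum.of_eq_of_ne _ _ _ fun h => hij (Subtype.ext h.symm)
  have hE1 : ∀ (z : M) (i : T) (a : ULift.{u} (Fin (n i))), E ⟨i, a⟩ z i.1 = e i a.down z :=
    fun z i a => DirectSum.of_eq_same _ _
  have hcomp : ∀ (c : (Σ i : T, ULift.{u} (Fin (n i))) → ℂ) (z : M) (j : T),
      (∑ k, c k • E k z) j.1 = ∑ a, c ⟨j, ⟨a⟩⟩ • e j a z := by
    intro c z j
    have h1 : (∑ k, c k • E k z) j.1 = ∑ k, c k • E k z j.1 := by
      rw [DFinsupp.finsetSum_apply]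
      rfl
    rw [h1, Fintype.sum_sigma, Finset.sum_eq_single j]
    · simp only [hE1]
      exact (Equiv.ulift.sum_comp fun a => c ⟨j, ⟨a⟩⟩ • e j a z)
    · intro i _ hij
      exact Finset.sum_eq_zero fun a _ => by rw [hE0 z i j a hij, smul_zero]
    · simp
  have hext : ∀ (z : M) (v w : ⨁ i, (F i).Fib z), (∀ j : T, v j.1 = w j.1) → v = w :=
    fun z v w h => DFinsupp.ext fun i => by
      by_cases hi : i ∈ T
      · exact h ⟨i, hi⟩
      · have := h0 i hi z
        exact Subsingleton.elim _ _
  have hli : LinearIndependent ℂ fun k => E k y := by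
    rw [Fintype.linearIndependent_iff]
    rintro c hc ⟨j, a⟩
    have h1 := (hcomp c y j).symm.trans (DFunLike.congr_fun hc j.1)
    exact Fintype.linearIndependent_iff.1 (hy j.1 j.2).1 _ h1 a.down
  have hsp : Submodule.span ℂ (Set.range fun k => E k y) = ⊤ := by
    refine eq_top_iff.2 fun v _ => ?_
    have h1 : v = ∑ k, coord (F k.1) (e k.1) y (v k.1.1) k.2.down • E k y := by
      refine hext y _ _ fun j => ?_
      rw [hcomp]
      exact (IsFrameAt.sum_coord (I := I) (hy j.1 j.2) (v j.1)).symm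
    rw [h1]
    exact Submodule.sum_mem _ fun k _ => Submodule.smul_mem _ _ (Submodule.subset_span ⟨k, rfl⟩)
  refine ⟨hli, hsp, fun s => ⟨fun hs => ?_, fun hs => ?_⟩⟩
  · choose c hc hcs using fun j : T => ((hy j.1 j.2).2.2 _).1 (hs j.1)
    refine ⟨fun k => c k.1 k.2.down, fun k => hc _ _, ?_⟩
    filter_upwards [eventually_all.2 hcs] with z hz
    refine hext z _ _ fun j => ?_
    exact (hz j).trans (hcomp (fun k => c k.1 k.2.down z) z j).symm
  · obtain ⟨c, hc, hcs⟩ := hs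
    intro i
    by_cases hi : i ∈ T
    · refine ((hy i hi).2.2 _).2 ⟨fun a => c ⟨⟨i, hi⟩, ⟨a⟩⟩, fun a => hc _, ?_⟩
      filter_upwards [hcs] with z hz
      rw [hz]
      exact hcomp (fun k => c k z) z ⟨i, hi⟩
    · obtain ⟨n', e', he'⟩ := hF i y
      refine (he'.self_of_nhds.2.2 _).2 ⟨fun _ _ => 0, fun _ => .const _, .of_forall fun z => ?_⟩
      have := h0 i hi z
      exact Subsingleton.elim _ _

/-- A bundle map which is bijective on each fibre is an isomorphism. -/
theorem isIso_of_bijective (hE : E.IsVectorBundle I) (hF : F.IsVectorBundle I) (φ : E ⟶ F)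
    (hφ : ∀ x, Function.Bijective (φ.map x)) : IsIso φ := by
  classical
  let eqv : ∀ x, E.Fib x ≃ₗ[ℂ] F.Fib x := fun x => LinearEquiv.ofBijective (φ.map x) (hφ x)
  have heqv : ∀ x v, eqv x v = φ.map x v := fun _ _ => rfl
  refine ⟨⟨⟨fun x => (eqv x).symm.toLinearMap, fun s x hs => ?_⟩, ?_, ?_⟩⟩
  · obtain ⟨n, e, he⟩ := hE.exists_frame x
    obtain ⟨m, f, hf⟩ := hF.exists_frame x
    obtain rfl : n = m := by
      have h1 := Module.finrank_eq_card_basis he.self_of_nhds.basis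
      have h2 := Module.finrank_eq_card_basis hf.self_of_nhds.basis
      rw [(eqv x).finrank_eq, h2] at h1
      simpa using h1.symm
    -- The matrix of `φ` in the two frames. It is smooth, and invertible near `x` because `φ` is
    -- injective on fibres, so its inverse is smooth; this is the matrix of the inverse map.
    let A : M → Matrix (Fin n) (Fin n) ℂ := fun z i j => coord F f z (φ.map z (e j z)) i
    have hA : ∀ i j, SmoothNear I (fun z => A z i j) x := fun i j =>
      (smoothAt_iff_coord hf _).1 (φ.smooth _ _ (he.self_of_nhds.smoothAt j)) i
    have hmul : ∀ᶠ z in 𝓝 x, ∀ v, (A z).mulVec (coord E e z v) = coord F f z (φ.map z v) := by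
      filter_upwards [he] with z hz v
      conv_rhs => rw [← hz.sum_coord v, map_sum, map_sum]
      ext i
      simp only [map_smul, Finset.sum_apply, Pi.smul_apply, smul_eq_mul, Matrix.mulVec, dotProduct]
      exact Finset.sum_congr rfl fun j _ => mul_comm _ _
    have hdet : ∀ᶠ z in 𝓝 x, (A z).det ≠ 0 := by
      filter_upwards [he, hf, hmul] with z h1 h2 h3 h4
      obtain ⟨w, hw, hw0⟩ := Matrix.exists_mulVec_eq_zero_iff.2 h4
      have h5 := h3 (∑ i, w i • e i z)
      rw [h1.coord_sum, hw0] at h5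
      have h6 := (hφ z).1 ((h2.coord_injective (h5.symm.trans (map_zero _).symm)).trans
        (map_zero _).symm)
      exact hw (by rw [← h1.coord_sum w, h6, map_zero])
    rw [smoothAt_iff_coord he]
    intro i
    have hs' := (smoothAt_iff_coord hf s).1 hs
    refine (SmoothNear.sum (f := fun j z => (A z)⁻¹ i j * coord F f z (s z) j) Finset.univ
      fun j _ => (SmoothNear.matrix_inv hA hdet.self_of_nhds i j).mul (hs' j)).congr ?_
    filter_upwards [hmul, hdet] with z h1 h2
    have h3 := h1 ((eqv z).symm (s z))
    rw [← heqv, LinearEquiv.apply_symm_apply] at h3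
    have h4 : coord E e z ((eqv z).symm (s z)) = (A z)⁻¹.mulVec (coord F f z (s z)) := by
      rw [← h3, Matrix.mulVec_mulVec, Matrix.nonsing_inv_mul _ (isUnit_iff_ne_zero.2 h2),
        Matrix.one_mulVec]
    exact congrFun h4 i
  · exact Hom.ext (funext fun x => LinearMap.ext fun v => (eqv x).symm_apply_apply v)
  · exact Hom.ext (funext fun x => LinearMap.ext fun v => (eqv x).apply_symm_apply v)

/-- A family isomorphic to a vector bundle is a vector bundle. -/
theorem IsVectorBundle.of_linearEquiv (hE : E.IsVectorBundle I) (φ : ∀ x, E.Fib x ≃ₗ[ℂ] F.Fib x)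
    (hφ : ∀ s x, E.SmoothAt s x ↔ F.SmoothAt (fun y => φ y (s y)) x) : F.IsVectorBundle I := by
  intro x
  obtain ⟨n, e, he⟩ := hE.exists_frame x
  refine ⟨n, fun i z => φ z (e i z), he.mono fun y hy => ?_⟩
  refine isFrameAt_of_basis (e := fun i z => φ z (e i z)) (hy.basis.map (φ y))
    (fun i => by simp [hy.basis_apply]) fun s => ?_
  have h1 : s = fun z => φ z ((φ z).symm (s z)) := funext fun z => by simp
  rw [h1, ← hφ, hy.2.2]
  refine exists_congr fun c => and_congr_right fun _ => eventually_congr (.of_forall fun z => ?_)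
  simp only [← map_smul, ← map_sum, LinearEquiv.apply_symm_apply]
  rw [LinearEquiv.symm_apply_eq]

end PreBundle

/-! ### Finite intersections of subspaces and openness of injectivity -/

section MatrixLemmas

/-- Descending chain condition: a minimal finite intersection lies below every member. It is used to
cut out the invariants of an isotropy group by finitely many group elements. -/
theorem Submodule.exists_finset_iInf_le {V ι : Type*} [AddCommGroup V] [Module ℂ V]
    [FiniteDimensional ℂ V] (f : ι → Submodule ℂ V) :
    ∃ s : Finset ι, ∀ i, ⨅ j ∈ s, f j ≤ f i := by
  classical
  obtain ⟨W, ⟨s, rfl⟩, hmin⟩ := IsArtinian.set_has_minimal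
    (Set.range fun s : Finset ι => ⨅ j ∈ s, f j) ⟨_, ∅, rfl⟩
  refine ⟨s, fun i => ?_⟩
  have h1 : ⨅ j ∈ insert i s, f j ≤ ⨅ j ∈ s, f j := by
    rw [Finset.iInf_insert]; exact inf_le_right
  have h2 := eq_of_le_of_not_lt h1 (hmin _ ⟨_, rfl⟩)
  rw [← h2, Finset.iInf_insert]
  exact inf_le_left

theorem Matrix.exists_leftInverse_of_injective {ρ κ : Type*} [Fintype ρ] [Fintype κ]
    [DecidableEq ρ] [DecidableEq κ] {A : Matrix ρ κ ℂ} (hA : Function.Injective A.mulVec) :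
    ∃ B : Matrix κ ρ ℂ, B * A = 1 := by
  obtain ⟨g, hg⟩ := LinearMap.exists_leftInverse_of_injective (Matrix.toLin' A)
    (LinearMap.ker_eq_bot.2 hA)
  refine ⟨LinearMap.toMatrix' g, ?_⟩
  have h := congrArg LinearMap.toMatrix' hg
  rwa [LinearMap.toMatrix'_comp, LinearMap.toMatrix'_toLin', LinearMap.toMatrix'_id] at h

/-- With a left inverse `B` of `A x`, the determinant of `B * A y` is `1` at `x` and remains
non-zero nearby. -/
theorem Matrix.eventually_injective_mulVec {X ρ κ : Type*} [TopologicalSpace X] [Fintype ρ]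
    [Fintype κ] {A : X → Matrix ρ κ ℂ} {x : X} (hA : ContinuousAt A x)
    (h : Function.Injective (A x).mulVec) : ∀ᶠ y in 𝓝 x, Function.Injective (A y).mulVec := by
  classical
  obtain ⟨B, hB⟩ := Matrix.exists_leftInverse_of_injective h
  have h1 : ContinuousAt (fun y => (B * A y).det) x := by
    have h2 : Continuous fun C : Matrix ρ κ ℂ => (B * C).det := by fun_prop
    exact ContinuousAt.comp (g := fun C : Matrix ρ κ ℂ => (B * C).det) h2.continuousAt hA
  have h2 : ∀ᶠ y in 𝓝 x, (B * A y).det ≠ 0 := h1.eventually_ne (by rw [hB]; simp)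
  filter_upwards [h2] with y hy v w hvw
  refine Matrix.mulVec_injective_iff_isUnit.2 ((Matrix.isUnit_iff_isUnit_det _).2
    (isUnit_iff_ne_zero.2 hy)) ?_
  rw [← Matrix.mulVec_mulVec, ← Matrix.mulVec_mulVec, hvw]

end MatrixLemmas

/-! ### Averaging a local frame over the group -/

section Cocycle

open MeasureTheory

variable {EG HG : Type*} [NormedAddCommGroup EG] [NormedSpace ℝ EG]
  [TopologicalSpace HG] {J : ModelWithCorners ℝ EG HG} [J.Boundaryless]
  {E : Type} {HM : Type*} [NormedAddCommGroup E] [NormedSpace ℝ E] [FiniteDimensional ℝ E]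
  [TopologicalSpace HM] {I : ModelWithCorners ℝ E HM}
  {G X : Type*} [CommGroup G] [TopologicalSpace G] [ChartedSpace HG G] [LieGroup J ∞ G]
  [CompactSpace G] [T2Space G] [MeasurableSpace G] [BorelSpace G]
  [TopologicalSpace X] [ChartedSpace HM X] [IsManifold I ∞ X] [T2Space X] [MulAction G X]

/-- The matrices of the action of `G` on a vector bundle over `X` with respect to a frame over an
open subset `N`. -/
structure IsActionCocycle (J : ModelWithCorners ℝ EG HG) (I : ModelWithCorners ℝ E HM) {n : ℕ}
    (N : Set X) (H : G → X → Matrix (Fin n) (Fin n) ℂ) : Prop where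
  isOpen : IsOpen N
  one : ∀ x ∈ N, H 1 x = 1
  mul : ∀ g h x, x ∈ N → h • x ∈ N → g • h • x ∈ N → H (g * h) x = H g (h • x) * H h x
  smooth : ∀ g x, x ∈ N → g • x ∈ N → ∀ i j,
    ContMDiffAt (J.prod I) 𝓘(ℝ, ℂ) ∞ (fun z : G × X => H z.1 z.2 i j) (g, x)

/-- The average over `G` of the translates of the frame, cut off by `β` and twisted by `χ`. -/
noncomputable def averagedMatrix (μ : Measure G) (χ : PontryaginDual G) (β : X → ℝ) {n : ℕ}
    (H : G → X → Matrix (Fin n) (Fin n) ℂ) (x : X) : Matrix (Fin n) (Fin n) ℂ :=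
  .of fun i j => ∫ g, (χ⁻¹ g : ℂ) * ((β (g • x) : ℂ) * H g⁻¹ (g • x) i j) ∂μ

variable {n : ℕ} {N : Set X} {H : G → X → Matrix (Fin n) (Fin n) ℂ}
  (hact : ContMDiff (J.prod I) I ∞ (fun z : G × X => z.1 • z.2))

include hact in
omit [J.Boundaryless] [FiniteDimensional ℝ E] [CompactSpace G] [T2Space G] [MeasurableSpace G]
  [BorelSpace G] [IsManifold I ∞ X] [T2Space X] in
-- Either `g • x` lies in the support of `β`, hence in `N`, where the cocycle is smooth, or the
-- product vanishes near `(g, x)`. Thus the integrand of the average is smooth for all `g`, although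
-- the cocycle is controlled only over `N`.
theorem IsActionCocycle.contMDiffAt_cutoff (hH : IsActionCocycle J I N H) {β : X → ℝ}
    (hβ : ContMDiff I 𝓘(ℝ, ℝ) ∞ β) (hβN : tsupport β ⊆ N) {x : X} (hx : x ∈ N) (g : G)
    (i j : Fin n) : ContMDiffAt (J.prod I) 𝓘(ℝ, ℂ) ∞
      (fun z : G × X => (β (z.1 • z.2) : ℂ) * H z.1⁻¹ (z.1 • z.2) i j) (g, x) := by
  by_cases hg : g • x ∈ tsupport β
  · have h1 : ContMDiffAt (J.prod I) 𝓘(ℝ, ℂ) ∞ (fun z : G × X => (β (z.1 • z.2) : ℂ)) (g, x) := by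
      have h2 : ContMDiff 𝓘(ℝ, ℝ) 𝓘(ℝ, ℂ) ∞ (fun r : ℝ => (r : ℂ)) :=
        Complex.ofRealCLM.contDiff.contMDiff
      exact (h2.comp (hβ.comp hact)).contMDiffAt
    refine h1.mul_complex ?_
    have h3 : ContMDiffAt (J.prod I) (J.prod I) ∞ (fun z : G × X => (z.1⁻¹, z.1 • z.2)) (g, x) :=
      ContMDiffAt.prodMk (((contMDiff_inv J ∞).comp contMDiff_fst).contMDiffAt) hact.contMDiffAt
    exact ContMDiffAt.comp (g, x) (hH.smooth g⁻¹ (g • x) (hβN hg) (by rwa [inv_smul_smul]) i j) h3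
  · have h1 : ∀ᶠ z : G × X in 𝓝 (g, x), z.1 • z.2 ∉ tsupport β :=
      (hact.continuous.continuousAt (x := ((g, x) : G × X))).eventually
        (p := fun y => y ∉ tsupport β) ((isClosed_tsupport β).isOpen_compl.mem_nhds hg)
    refine (contMDiffAt_const (c := (0 : ℂ))).congr_of_eventuallyEq ?_
    filter_upwards [h1] with z hz
    rw [image_eq_zero_of_notMem_tsupport hz, Complex.ofReal_zero, zero_mul]

variable (μ : Measure G) [μ.IsHaarMeasure]

include hact in
omit [T2Space X] [T2Space G] [FiniteDimensional ℝ E] in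
theorem IsActionCocycle.smoothNear_averagedMatrix (hH : IsActionCocycle J I N H) {β : X → ℝ}
    (hβ : ContMDiff I 𝓘(ℝ, ℝ) ∞ β) (hβN : tsupport β ⊆ N) (χ : PontryaginDual G) {x : X}
    (hx : x ∈ N) (i j : Fin n) :
    SmoothNear I (fun y => averagedMatrix μ χ β H y i j) x := by
  have := topologicalGroup_of_lieGroup (G := G) J ∞
  filter_upwards [hH.isOpen.eventually_mem hx] with y hy
  refine contMDiffAt_integral (J := J) μ (PontryaginDual.toComplex χ⁻¹).continuous
    (F := fun z : G × X => (β (z.1 • z.2) : ℂ) * H z.1⁻¹ (z.1 • z.2) i j) ?_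
  filter_upwards [hH.isOpen.eventually_mem hy] with z hz g
  exact hH.contMDiffAt_cutoff hact hβ hβN hz g i j

include hact in
omit [J.Boundaryless] [T2Space X] [T2Space G] [FiniteDimensional ℝ E] [IsManifold I ∞ X] in
theorem IsActionCocycle.integrable_cutoff (hH : IsActionCocycle J I N H) {β : X → ℝ}
    (hβ : ContMDiff I 𝓘(ℝ, ℝ) ∞ β) (hβN : tsupport β ⊆ N) (χ : PontryaginDual G) {x : X}
    (hx : x ∈ N) (i j : Fin n) :
    Integrable (fun g => (χ g : ℂ) * ((β (g • x) : ℂ) * H g⁻¹ (g • x) i j)) μ := by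
  have := topologicalGroup_of_lieGroup (G := G) J ∞
  refine Continuous.integrable_of_compactSpace μ ?_
  refine (PontryaginDual.toComplex χ).continuous.mul (continuous_iff_continuousAt.2 fun g => ?_)
  exact ContinuousAt.comp (f := fun g : G => (g, x))
    (g := fun z : G × X => (β (z.1 • z.2) : ℂ) * H z.1⁻¹ (z.1 • z.2) i j)
    (hH.contMDiffAt_cutoff hact hβ hβN hx g i j).continuousAt (by fun_prop)

include hact in
omit [J.Boundaryless] [T2Space X] [T2Space G] [FiniteDimensional ℝ E] [IsManifold I ∞ X] in
-- On the support of `β` the cocycle identity moves `H h x` under the integral, where it merges with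
-- `H g⁻¹ (g • x)`. Replacing `g` by `h * g` then produces the factor `χ h`; commutativity is used
-- to identify `(h * g) • x` with `g • h • x`.
theorem IsActionCocycle.averagedMatrix_smul (hH : IsActionCocycle J I N H) {β : X → ℝ}
    (hβ : ContMDiff I 𝓘(ℝ, ℝ) ∞ β) (hβN : tsupport β ⊆ N) (χ : PontryaginDual G) {x : X} {h : G}
    (hx : x ∈ N) (hhx : h • x ∈ N) :
    averagedMatrix μ χ β H (h • x) = (χ h : ℂ) • (H h x * averagedMatrix μ χ β H x) := by
  have := topologicalGroup_of_lieGroup (G := G) J ∞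
  ext i j
  have h1 : (H h x * averagedMatrix μ χ β H x) i j =
      ∫ g, (χ⁻¹ g : ℂ) * ((β (g • x) : ℂ) * H (h * g⁻¹) (g • x) i j) ∂μ := by
    rw [Matrix.mul_apply]
    simp only [averagedMatrix, Matrix.of_apply]
    simp_rw [← integral_const_mul]
    rw [← integral_finsetSum _ fun k _ =>
      (hH.integrable_cutoff hact μ hβ hβN χ⁻¹ hx k j).const_mul _]
    refine integral_congr_ae (.of_forall fun g => ?_)
    change ∑ k, H h x i k * ((χ⁻¹ g : ℂ) * ((β (g • x) : ℂ) * H g⁻¹ (g • x) k j)) =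
      (χ⁻¹ g : ℂ) * ((β (g • x) : ℂ) * H (h * g⁻¹) (g • x) i j)
    by_cases hg : g • x ∈ tsupport β
    · rw [hH.mul h g⁻¹ (g • x) (hβN hg) (by rwa [inv_smul_smul]) (by rwa [inv_smul_smul]),
        inv_smul_smul, Matrix.mul_apply, Finset.mul_sum, Finset.mul_sum]
      exact Finset.sum_congr rfl fun k _ => by ring
    · simp [image_eq_zero_of_notMem_tsupport hg]
  rw [Matrix.smul_apply, h1, ← integral_mul_left_eq_self _ h, smul_eq_mul, ← integral_const_mul,
    averagedMatrix, Matrix.of_apply]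
  refine integral_congr_ae (.of_forall fun g => ?_)
  have h2 : (χ h : ℂ) * (χ⁻¹ (h * g) : ℂ) = (χ⁻¹ g : ℂ) := by
    rw [PontryaginDual.coe_apply_mul, PontryaginDual.coe_inv_apply, PontryaginDual.coe_inv_apply,
      ← mul_assoc, mul_inv_cancel₀ (Circle.coe_ne_zero _), one_mul]
  have h3 : h * (h * g)⁻¹ = g⁻¹ := by rw [mul_inv, mul_inv_cancel_left]
  change _ = (χ h : ℂ) * ((χ⁻¹ (h * g) : ℂ) * ((β ((h * g) • x) : ℂ) *
    H (h * (h * g)⁻¹) ((h * g) • x) i j))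
  rw [← mul_assoc, h2, h3, mul_comm h g, mul_smul]

end Cocycle

/-! ### Equivariant frames of the invariant vectors -/

section InvariantFrame

open MeasureTheory

variable {EG HG : Type*} [NormedAddCommGroup EG] [NormedSpace ℝ EG]
  [TopologicalSpace HG] {J : ModelWithCorners ℝ EG HG} [J.Boundaryless]
  {E : Type} {HM : Type*} [NormedAddCommGroup E] [NormedSpace ℝ E] [FiniteDimensional ℝ E]
  [TopologicalSpace HM] {I : ModelWithCorners ℝ E HM}
  {G X : Type*} [CommGroup G] [TopologicalSpace G] [ChartedSpace HG G] [LieGroup J ∞ G]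
  [CompactSpace G] [T2Space G] [MeasurableSpace G] [BorelSpace G]
  [TopologicalSpace X] [ChartedSpace HM X] [IsManifold I ∞ X] [T2Space X] [MulAction G X]

/-- The vectors at `x` on which the stabilizer of `x` acts through `χ⁻¹`. -/
noncomputable def invariantVectors (χ : PontryaginDual G) {n : ℕ} (H : G → X → Matrix (Fin n) (Fin n) ℂ)
    (x : X) : Submodule ℂ (Fin n → ℂ) :=
  ⨅ k : MulAction.stabilizer G x,
    LinearMap.ker (Matrix.mulVecLin ((χ k : ℂ) • H k x - 1))

omit [TopologicalSpace X] [CompactSpace G] [T2Space G] [MeasurableSpace G] [BorelSpace G]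
  [ChartedSpace HG G] in
theorem mem_invariantVectors {χ : PontryaginDual G} {n : ℕ} {H : G → X → Matrix (Fin n) (Fin n) ℂ}
    {x : X} {v : Fin n → ℂ} : v ∈ invariantVectors χ H x ↔
      ∀ k : G, k • x = x → (χ k : ℂ) • (H k x).mulVec v = v := by
  simp only [invariantVectors, Submodule.mem_iInf, LinearMap.mem_ker, Matrix.mulVecLin_apply,
    Matrix.sub_mulVec, Matrix.one_mulVec, Matrix.smul_mulVec, sub_eq_zero]
  exact ⟨fun h k hk => h ⟨k, hk⟩, fun h k => h k.1 k.2⟩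

variable {n : ℕ} {N : Set X} {H : G → X → Matrix (Fin n) (Fin n) ℂ}
  (hact : ContMDiff (J.prod I) I ∞ (fun z : G × X => z.1 • z.2))
  (μ : Measure G) [μ.IsHaarMeasure]

include hact in
omit [J.Boundaryless] [T2Space G] in
/-- For a cut-off function with sufficiently small support near `x₀`, the average is invertible on
the invariant vectors at `x₀`. -/
theorem IsActionCocycle.exists_cutoff (hH : IsActionCocycle J I N H) (χ : PontryaginDual G)
    {x₀ : X} (hx₀ : x₀ ∈ N) {m : ℕ} {W : Matrix (Fin n) (Fin m) ℂ} {L : Matrix (Fin m) (Fin n) ℂ}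
    (hLW : L * W = 1)
    (hW : ∀ k : G, k • x₀ = x₀ → (χ k : ℂ) • (H k x₀ * W) = W) :
    ∃ β : X → ℝ, ContMDiff I 𝓘(ℝ, ℝ) ∞ β ∧ tsupport β ⊆ N ∧
      (L * averagedMatrix μ χ β H x₀ * W).det ≠ 0 := by
  have := topologicalGroup_of_lieGroup (G := G) J ∞
  have hcont : Continuous fun g : G => g • x₀ :=
    hact.continuous.comp (f := fun g : G => (g, x₀)) (by fun_prop)
  -- The deviation of the integrand, compressed to the invariant vectors at `x₀`, from the identity.
  -- It vanishes on the stabilizer of `x₀`, by invariance of the columns of `W`.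
  let R : G → Matrix (Fin m) (Fin m) ℂ := fun g =>
    (χ⁻¹ g : ℂ) • (L * H g⁻¹ (g • x₀) * W) - 1
  have hR0 : ∀ k : G, k • x₀ = x₀ → R k = 0 := fun k hk => by
    have hk' : k⁻¹ • x₀ = x₀ := inv_smul_eq_iff.2 hk.symm
    have h2 := hW k⁻¹ hk'
    have h3 : ((χ k⁻¹ : Circle) : ℂ) = (χ⁻¹ k : ℂ) := by
      rw [PontryaginDual.coe_inv_apply, map_inv, Circle.coe_inv]
    simp only [R]
    rw [hk, Matrix.mul_assoc, ← Matrix.mul_smul, ← h3, h2, hLW, sub_self]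
  have hRc : ∀ g : G, g • x₀ ∈ N → ∀ i j, ContinuousAt (fun g => R g i j) g := fun g hg i j => by
    have hc : ∀ k l, ContinuousAt (fun g => H g⁻¹ (g • x₀) k l) g := fun k l => by
      refine ContinuousAt.comp (f := fun g : G => (g⁻¹, g • x₀))
        (g := fun z : G × X => H z.1 z.2 k l)
        (hH.smooth g⁻¹ (g • x₀) hg (by rwa [inv_smul_smul]) k l).continuousAt ?_
      exact (continuous_inv.prodMk hcont).continuousAt
    have hχ : ContinuousAt (fun g => (χ⁻¹ g : ℂ)) g :=
      (PontryaginDual.toComplex χ⁻¹).continuous.continuousAt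
    simp only [R, Matrix.sub_apply, Matrix.smul_apply, Matrix.mul_apply, smul_eq_mul]
    refine (hχ.mul ?_).sub continuousAt_const
    refine tendsto_finsetSum _ fun k _ => ?_
    refine Tendsto.mul ?_ tendsto_const_nhds
    refine tendsto_finsetSum _ fun l _ => ?_
    exact tendsto_const_nhds.mul (hc l k)
  -- The bound is such that `m` off-diagonal errors together with one diagonal error amount to at
  -- most one half, relative to the mass `c`; the averaged matrix is then strictly diagonally
  -- dominant.
  let O : Set G := {g | ∀ i j, ‖R g i j‖ < 1 / (2 * (m + 1))}
  have hO : ∀ k : G, k • x₀ = x₀ → O ∈ 𝓝 k := fun k hk => by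
    refine eventually_all.2 fun i => eventually_all.2 fun j => ?_
    have h1 := (hRc k (by rwa [hk]) i j).norm
    refine h1.eventually (gt_mem_nhds ?_)
    simp only [hR0 k hk, Matrix.zero_apply, norm_zero]
    positivity
  -- The set `O` is a neighbourhood of the stabilizer, and `G` is compact, so the group elements
  -- outside its interior move `x₀` into a compact set not containing `x₀`. For a cut-off supported
  -- in the complement only elements of `O` contribute to the integral.
  let N' : Set X := ((fun g : G => g • x₀) '' (interior O)ᶜ)ᶜ
  have hN' : N' ∈ 𝓝 x₀ := by
    refine IsOpen.mem_nhds ?_ ?_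
    · exact ((isOpen_interior.isClosed_compl.isCompact).image hcont).isClosed.isOpen_compl
    · rintro ⟨k, hk, hk'⟩
      exact hk (mem_interior_iff_mem_nhds.2 (hO k hk'))
  obtain ⟨f, -, hf⟩ := (SmoothBumpFunction.nhds_basis_tsupport (I := I) x₀).mem_iff.1
    (Filter.inter_mem hN' (hH.isOpen.mem_nhds hx₀))
  have hfN : tsupport f ⊆ N := fun z hz => (hf hz).2
  refine ⟨f, f.contMDiff, hfN, ?_⟩
  have hfO : ∀ g : G, f (g • x₀) ≠ 0 → g ∈ O := fun g hg => by
    by_contra h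
    exact (hf (subset_tsupport _ hg)).1 ⟨g, fun h' => h (interior_subset h'), rfl⟩
  have hfc : Continuous fun g : G => f (g • x₀) := f.contMDiff.continuous.comp hcont
  have hfi : Integrable (fun g : G => f (g • x₀)) μ := hfc.integrable_of_compactSpace μ
  set c : ℝ := ∫ g, f (g • x₀) ∂μ with hc
  have hc0 : 0 < c := by
    refine hfc.integral_pos_of_hasCompactSupport_nonneg_nonzero
      (HasCompactSupport.of_compactSpace _) (fun g => f.nonneg) (x := 1) ?_
    rw [one_smul, f.eq_one]
    exact one_ne_zero
  have hint : ∀ i j, Integrable (fun g => (f (g • x₀) : ℂ) * R g i j) μ := fun i j => by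
    refine Continuous.integrable_of_compactSpace μ (continuous_iff_continuousAt.2 fun g => ?_)
    by_cases hg : g • x₀ ∈ tsupport f
    · exact (Complex.continuous_ofReal.comp hfc).continuousAt.mul (hRc g (hfN hg) i j)
    · have h1 : ∀ᶠ g' : G in 𝓝 g, g' • x₀ ∉ tsupport f :=
        hcont.continuousAt.eventually ((isClosed_tsupport f).isOpen_compl.mem_nhds hg)
      refine (continuousAt_const (y := (0 : ℂ))).congr ?_
      filter_upwards [h1] with g' hg'
      rw [image_eq_zero_of_notMem_tsupport hg', Complex.ofReal_zero, zero_mul]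
  have hD : ∀ i j, (L * averagedMatrix μ χ f H x₀ * W) i j =
      (if i = j then (c : ℂ) else 0) + ∫ g, (f (g • x₀) : ℂ) * R g i j ∂μ := by
    intro i j
    have h1 : (L * averagedMatrix μ χ f H x₀ * W) i j =
        ∫ g, (f (g • x₀) : ℂ) * ((χ⁻¹ g : ℂ) • (L * H g⁻¹ (g • x₀) * W)) i j ∂μ := by
      simp only [Matrix.mul_apply, averagedMatrix, Matrix.of_apply, Matrix.smul_apply]
      simp_rw [← integral_const_mul]
      have hi := fun k l => hH.integrable_cutoff hact μ f.contMDiff hfN χ⁻¹ hx₀ k l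
      simp_rw [← integral_finsetSum Finset.univ fun k _ => (hi k _).const_mul (L i k)]
      simp_rw [← integral_mul_const]
      rw [← integral_finsetSum Finset.univ fun l _ =>
        (integrable_finsetSum Finset.univ fun k _ => (hi k l).const_mul (L i k)).mul_const (W l j)]
      refine integral_congr_ae (.of_forall fun g => ?_)
      simp only [Finset.mul_sum, Finset.sum_mul, smul_eq_mul]
      refine Finset.sum_congr rfl fun l _ => Finset.sum_congr rfl fun k _ => by ring
    rw [h1]
    have h2 : (if i = j then (c : ℂ) else 0) = ∫ g, (f (g • x₀) : ℂ) * (1 : Matrix _ _ ℂ) i j ∂μ := by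
      rw [integral_mul_const, Matrix.one_apply, mul_ite, mul_one, mul_zero]
      congr 1
      exact integral_ofReal.symm
    have h3 : Integrable (fun g => (f (g • x₀) : ℂ) * (1 : Matrix (Fin m) (Fin m) ℂ) i j) μ :=
      (hfi.ofReal (𝕜 := ℂ)).mul_const _
    rw [h2, ← integral_add h3 (hint i j)]
    refine integral_congr_ae (.of_forall fun g => ?_)
    simp only [R, Matrix.sub_apply]
    ring
  have hr : ∀ i j, ‖∫ g, (f (g • x₀) : ℂ) * R g i j ∂μ‖ ≤ c * (1 / (2 * (m + 1))) := by
    intro i j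
    rw [hc, ← integral_mul_const]
    refine norm_integral_le_of_norm_le (hfi.mul_const _) (.of_forall fun g => ?_)
    rw [norm_mul, Complex.norm_real, Real.norm_of_nonneg f.nonneg]
    by_cases hg : f (g • x₀) = 0
    · simp [hg]
    · exact mul_le_mul_of_nonneg_left (hfO g hg i j).le f.nonneg
  refine det_ne_zero_of_sum_row_lt_diag fun i => ?_
  have hm : 0 < (m : ℝ) + 1 := by positivity
  calc ∑ j ∈ Finset.univ.erase i, ‖(L * averagedMatrix μ χ f H x₀ * W) i j‖
      ≤ ∑ j ∈ Finset.univ.erase i, c * (1 / (2 * (m + 1))) := by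
        refine Finset.sum_le_sum fun j hj => ?_
        rw [hD, if_neg (Finset.ne_of_mem_erase hj).symm, zero_add]
        exact hr i j
    _ ≤ m * (c * (1 / (2 * (m + 1)))) := by
        rw [Finset.sum_const, nsmul_eq_mul]
        refine mul_le_mul_of_nonneg_right ?_ (by positivity)
        refine (Nat.cast_le.2 (Finset.card_le_univ _)).trans ?_
        simp
    _ < c - c * (1 / (2 * (m + 1))) := by
        have : c - c * (1 / (2 * (m + 1))) - m * (c * (1 / (2 * (m + 1)))) = c / 2 := by
          field_simp
          ring
        linarith
    _ ≤ ‖(L * averagedMatrix μ χ f H x₀ * W) i i‖ := by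
        rw [hD, if_pos rfl]
        have h1 := norm_sub_norm_le (c : ℂ) (-∫ g, (f (g • x₀) : ℂ) * R g i i ∂μ)
        rw [sub_neg_eq_add, norm_neg, Complex.norm_real, Real.norm_of_nonneg hc0.le] at h1
        linarith [hr i i]

include hact in
/-- Equivariant smooth vector functions which, near `x₀`, form a basis of the invariant vectors. -/
theorem IsActionCocycle.exists_invariantFrame (hH : IsActionCocycle J I N H)
    (χ : PontryaginDual G) {x₀ : X} (hx₀ : x₀ ∈ N)
    (hstab : ∀ k : G, k • x₀ = x₀ → ∀ x ∈ N, k • x = x) :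
    ∃ (m : ℕ) (a : X → Matrix (Fin n) (Fin m) ℂ) (L : X → Matrix (Fin m) (Fin n) ℂ) (N' : Set X),
      N' ⊆ N ∧ IsOpen N' ∧ x₀ ∈ N' ∧ ∀ x ∈ N',
        (∀ i j, SmoothNear I (fun y => a y i j) x) ∧ (∀ i j, SmoothNear I (fun y => L y i j) x) ∧
        L x * a x = 1 ∧
        (∀ h : G, h • x ∈ N' → a (h • x) = (χ h : ℂ) • (H h x * a x)) ∧
        ∀ v ∈ invariantVectors χ H x, (a x).mulVec ((L x).mulVec v) = v := by
  classical
  have := topologicalGroup_of_lieGroup (G := G) J ∞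
  let μ : Measure G := Measure.haar
  let V := invariantVectors χ H x₀
  let m := Module.finrank ℂ V
  let b : Module.Basis (Fin m) ℂ V := Module.finBasis ℂ V
  let W : Matrix (Fin n) (Fin m) ℂ := .of fun i j => (b j : Fin n → ℂ) i
  have hWv : ∀ v, W.mulVec v = (b.equivFun.symm v : V) := fun v => by
    rw [b.equivFun_symm_apply]
    ext i
    simp [Matrix.mulVec, dotProduct, W, mul_comm]
  obtain ⟨L₀, hL₀⟩ := Matrix.exists_leftInverse_of_injective (A := W) fun v w h => by
    simp only [hWv] at h
    exact b.equivFun.symm.injective (Subtype.ext h)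
  have hW : ∀ k : G, k • x₀ = x₀ → (χ k : ℂ) • (H k x₀ * W) = W := fun k hk => by
    ext i j
    exact congrFun (mem_invariantVectors.1 (b j).2 k hk) i
  obtain ⟨β, hβ, hβN, hdet⟩ := hH.exists_cutoff hact μ χ hx₀ hL₀ hW
  let A := averagedMatrix μ χ β H
  have hAs : ∀ x ∈ N, ∀ i j, SmoothNear I (fun y => A y i j) x := fun x hx i j =>
    hH.smoothNear_averagedMatrix hact μ hβ hβN χ hx i j
  -- The averages of the sections whose coordinates are the constant columns of `W`, a basis of the
  -- invariant vectors at `x₀`. The choice of the cut-off makes `L₀ * a x₀` invertible, which gives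
  -- a smooth left inverse `L` of `a` near `x₀`.
  let a : X → Matrix (Fin n) (Fin m) ℂ := fun x => A x * W
  have has : ∀ x ∈ N, ∀ i j, SmoothNear I (fun y => a y i j) x := fun x hx i j => by
    simp only [a, Matrix.mul_apply]
    exact .sum _ fun k _ => (hAs x hx i k).mul (.const _)
  have hDs : ∀ x ∈ N, ∀ i j, SmoothNear I (fun y => (L₀ * a y) i j) x := fun x hx i j => by
    simp only [Matrix.mul_apply (M := L₀)]
    exact .sum _ fun k _ => (SmoothNear.const _).mul (has x hx k j)
  let L : X → Matrix (Fin m) (Fin n) ℂ := fun x => (L₀ * a x)⁻¹ * L₀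
  have hdet' : ∀ᶠ x in 𝓝 x₀, (L₀ * a x).det ≠ 0 := by
    refine (SmoothNear.det (hDs x₀ hx₀)).continuousAt.eventually_ne ?_
    rwa [← Matrix.mul_assoc]
  have hLs : ∀ x ∈ N, (L₀ * a x).det ≠ 0 → ∀ i j, SmoothNear I (fun y => L y i j) x :=
    fun x hx hd i j => by
      simp only [L, Matrix.mul_apply (N := L₀)]
      exact .sum _ fun k _ => (SmoothNear.matrix_inv (hDs x hx) hd i k).mul (.const _)
  have hLa : ∀ x, (L₀ * a x).det ≠ 0 → L x * a x = 1 := fun x hd => by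
    simp only [L]
    rw [Matrix.mul_assoc, Matrix.nonsing_inv_mul _ (isUnit_iff_ne_zero.2 hd)]
  have hequiv : ∀ x ∈ N, ∀ h : G, h • x ∈ N → a (h • x) = (χ h : ℂ) • (H h x * a x) := by
    intro x hx h hhx
    simp only [a, A]
    rw [hH.averagedMatrix_smul hact μ hβ hβN χ hx hhx, Matrix.smul_mul, Matrix.mul_assoc]
  have hmem : ∀ x ∈ N, ∀ v, (a x).mulVec v ∈ invariantVectors χ H x := by
    intro x hx v
    refine mem_invariantVectors.2 fun k hk => ?_
    have h1 := hequiv x hx k (by rwa [hk])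
    rw [hk] at h1
    rw [Matrix.mulVec_mulVec, ← Matrix.smul_mulVec, ← h1]
  -- finitely many elements of the stabilizer cut out the invariant vectors at `x₀`
  obtain ⟨s, hs⟩ := Submodule.exists_finset_iInf_le fun k : MulAction.stabilizer G x₀ =>
    LinearMap.ker (Matrix.mulVecLin ((χ k : ℂ) • H k x₀ - 1))
  -- The finitely many invariance equations stacked on top of `L`. At `x₀` its kernel is trivial: an
  -- invariant vector is a combination of the columns of `W`, and the left inverse `L₀` of `W`
  -- detects it. Injectivity persists nearby, so there the invariant vectors cannot exceed the span
  -- of the columns of `a`.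
  let T : X → Matrix ((s × Fin n) ⊕ Fin m) (Fin n) ℂ := fun x => .of fun r j =>
    r.elim (fun r => ((χ r.1.1 : ℂ) • H r.1.1 x - 1) r.2 j) fun l => L x l j
  have hTv : ∀ x v, (T x).mulVec v = 0 ↔
      (∀ k : s, (χ k.1 : ℂ) • (H k.1 x).mulVec v = v) ∧ (L x).mulVec v = 0 := by
    intro x v
    have h1 : ∀ (k : s) (i : Fin n), (T x).mulVec v (.inl (k, i)) =
        ((χ k.1 : ℂ) • (H k.1 x).mulVec v - v) i := fun k i => by
      have h0 : ((χ k.1 : ℂ) • H k.1 x - 1).mulVec v = (χ k.1 : ℂ) • (H k.1 x).mulVec v - v := by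
        rw [Matrix.sub_mulVec, Matrix.one_mulVec, Matrix.smul_mulVec]
      exact congrFun h0 i
    have h2 : ∀ l : Fin m, (T x).mulVec v (.inr l) = (L x).mulVec v l := fun l => rfl
    refine ⟨fun h => ⟨fun k => sub_eq_zero.1 (funext fun i => ?_), funext fun l => ?_⟩,
      fun h => funext fun r => ?_⟩
    · rw [← h1, h]
      rfl
    · rw [← h2, h]
      rfl
    · rcases r with ⟨k, i⟩ | l
      · rw [h1, h.1 k, sub_self]
        rfl
      · rw [h2, h.2]
        rfl
  have hTc : ContinuousAt T x₀ := by
    refine continuousAt_pi.2 fun r => continuousAt_pi.2 fun j => ?_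
    rcases r with ⟨k, i⟩ | l
    · have h1 : ContinuousAt (fun x => H k.1 x i j) x₀ :=
        ContinuousAt.comp (f := fun x : X => (k.1.1, x)) (g := fun z : G × X => H z.1 z.2 i j)
          (hH.smooth k.1 x₀ hx₀ (by rwa [k.1.2]) i j).continuousAt (by fun_prop)
      exact (continuousAt_const.mul h1).sub continuousAt_const
    · exact (hLs x₀ hx₀ hdet'.self_of_nhds l j).continuousAt
  have key : ∀ x ∈ N, (L₀ * a x).det ≠ 0 → ∀ v, (L x).mulVec (v - (a x).mulVec ((L x).mulVec v)) = 0 :=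
    fun x _ hd v => by
      rw [Matrix.mulVec_sub, Matrix.mulVec_mulVec, hLa x hd, Matrix.one_mulVec, sub_self]
  have hT0 : Function.Injective (T x₀).mulVec := by
    refine (injective_iff_map_eq_zero (Matrix.mulVecLin (T x₀))).2 fun v hv => ?_
    obtain ⟨h1, h2⟩ := (hTv x₀ v).1 hv
    have hvV : v ∈ V := by
      refine (Submodule.mem_iInf _).2 fun k => hs k ?_
      simp only [Submodule.mem_iInf, LinearMap.mem_ker, Matrix.mulVecLin_apply, Matrix.sub_mulVec,
        Matrix.one_mulVec, Matrix.smul_mulVec, sub_eq_zero]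
      exact fun k hk => h1 ⟨k, hk⟩
    have h3 : L₀.mulVec v = 0 := by
      have h4 : (L₀ * a x₀).mulVec ((L x₀).mulVec v) = L₀.mulVec v := by
        rw [Matrix.mulVec_mulVec, ← Matrix.mul_assoc, Matrix.mul_nonsing_inv _
          (isUnit_iff_ne_zero.2 hdet'.self_of_nhds), Matrix.one_mul]
      rw [← h4, h2, Matrix.mulVec_zero]
    have h5 : W.mulVec (b.equivFun ⟨v, hvV⟩) = v := by
      rw [hWv, LinearEquiv.symm_apply_apply]
    rw [← h5, Matrix.mulVec_mulVec, hL₀, Matrix.one_mulVec] at h3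
    rw [← h5, h3, Matrix.mulVec_zero]
  have hTi := Matrix.eventually_injective_mulVec hTc hT0
  obtain ⟨N', hN', hN'o, hx₀'⟩ := eventually_nhds_iff.1
    ((hdet'.and hTi).and (hH.isOpen.eventually_mem hx₀))
  refine ⟨m, a, L, N', fun x hx => (hN' x hx).2, hN'o, hx₀', fun x hx => ?_⟩
  obtain ⟨⟨hd, hi⟩, hxN⟩ := hN' x hx
  refine ⟨has x hxN, hLs x hxN hd, hLa x hd, fun h hh => hequiv x hxN h (hN' _ hh).2,
    fun v hv => ?_⟩
  symm
  rw [← sub_eq_zero]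
  -- For invariant `v` the difference `v - a L v` is invariant and killed by `L`. The chosen
  -- elements of the stabilizer of `x₀` also fix `x`, so the difference satisfies all equations in
  -- `T x` and is zero.
  refine hi (Eq.trans ((hTv x _).2 ⟨fun k => ?_, key x hxN hd v⟩) (Matrix.mulVec_zero _).symm)
  have h1 := Submodule.sub_mem _ hv (hmem x hxN ((L x).mulVec v))
  exact mem_invariantVectors.1 h1 k.1 (hstab k.1 k.1.2 x hxN)

end InvariantFrame

/-! ### Local sections of the quotient map -/

section LocalSections

variable {EX HX : Type*} [NormedAddCommGroup EX] [NormedSpace ℝ EX] [TopologicalSpace HX]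
  (I : ModelWithCorners ℝ EX HX)
  {EY HY : Type*} [NormedAddCommGroup EY] [NormedSpace ℝ EY] [TopologicalSpace HY]
  (I' : ModelWithCorners ℝ EY HY)
  (G : Type*) {X Y : Type u} [Group G] [MulAction G X]
  [TopologicalSpace X] [ChartedSpace HX X] [TopologicalSpace Y] [ChartedSpace HY Y]

/-- A smooth map onto the space of orbits which has smooth local sections through each point. -/
structure IsQuotientWithSections (p : X → Y) : Prop where
  smooth : ContMDiff I I' ∞ p
  surjective : Function.Surjective p
  fibres : ∀ x x' : X, p x = p x' ↔ ∃ g : G, g • x = x'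
  exists_section : ∀ x : X, ∃ σ : Y → X, σ (p x) = x ∧
    ∀ᶠ y in 𝓝 (p x), ContMDiffAt I' I ∞ σ y ∧ p (σ y) = y

variable {I I' G}

theorem IsQuotientWithSections.apply_smul {p : X → Y} (hp : IsQuotientWithSections I I' G p)
    (g : G) (x : X) : p (g • x) = p x :=
  ((hp.fibres x (g • x)).2 ⟨g, rfl⟩).symm

end LocalSections

/-- In a local trivialization, keep the fibre coordinate of `x` constant. -/
theorem IsFibration.exists_section {m n : ℕ} {M N : Type u}
    [TopologicalSpace M] [ChartedSpace (EuclideanQuadrant m) M]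
    [TopologicalSpace N] [ChartedSpace (EuclideanQuadrant n) N] {f : M → N}
    (hf : IsFibration (m := m) (n := n) f) (x : M) :
    ∃ σ : N → M, σ (f x) = x ∧
      ∀ᶠ y in 𝓝 (f x), ContMDiffAt (cornersModel n) (cornersModel m) ∞ σ y ∧ f (σ y) = y := by
  obtain ⟨U, hU, hxU, k, Z, _, _, φ, ψ, _, _, _, -, hψ, h1, h2⟩ := hf.locally_trivial (f x)
  refine ⟨fun y => ψ (y, φ x), h1 x hxU, ?_⟩
  filter_upwards [hU.eventually_mem hxU] with y hy
  refine ⟨?_, (h2 y hy _).1⟩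
  have h3 : ContMDiffAt ((cornersModel n).prod (cornersModel k)) (cornersModel m) ∞ ψ (y, φ x) :=
    (hψ _ ⟨hy, trivial⟩).contMDiffAt ((hU.prod isOpen_univ).mem_nhds ⟨hy, trivial⟩)
  exact h3.comp y (contMDiffAt_id.prodMk contMDiffAt_const)

theorem IsSmoothQuotient.isQuotientWithSections {G : Type u} [Group G] {m n : ℕ} {X Y : Type u}
    [MulAction G X] [TopologicalSpace X] [ChartedSpace (EuclideanQuadrant m) X]
    [TopologicalSpace Y] [ChartedSpace (EuclideanQuadrant n) Y] {p : X → Y}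
    (hp : IsSmoothQuotient G (m := m) (n := n) p) :
    IsQuotientWithSections (cornersModel m) (cornersModel n) G p :=
  ⟨hp.fibration.smooth, hp.fibration.surjective, hp.fibres, hp.fibration.exists_section⟩

/-! ### The action on a bundle in a local frame -/

section ActionMatrix

open PreBundle

variable {EG HG : Type*} [NormedAddCommGroup EG] [NormedSpace ℝ EG]
  [TopologicalSpace HG] {J : ModelWithCorners ℝ EG HG}
  {EX : Type} {HX : Type*} [NormedAddCommGroup EX] [NormedSpace ℝ EX] [TopologicalSpace HX]
  {I : ModelWithCorners ℝ EX HX}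
  {G X : Type u} [CommGroup G] [TopologicalSpace G] [ChartedSpace HG G]
  [TopologicalSpace X] [ChartedSpace HX X] [MulAction G X]

omit [TopologicalSpace X] in
-- Vectors over points which are only provably equal are compared as elements of the total space;
-- their coordinates are vectors of numbers, so no transport remains.
theorem PreBundle.coord_congr {E : PreBundle X} {ι : Type*} [Fintype ι] {e : ι → ∀ y, E.Fib y}
    {x y : X} {v : E.Fib x} {w : E.Fib y} (h : (⟨x, v⟩ : Σ x, E.Fib x) = ⟨y, w⟩) :
    coord E e x v = coord E e y w := by
  cases h
  rfl

theorem PreBundle.IsFrameAt.sigma_ext {E : PreBundle X} {ι : Type*} [Fintype ι]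
    {e : ι → ∀ y, E.Fib y} {x y : X} {v : E.Fib x} {w : E.Fib y} (h : IsFrameAt I E e x)
    (hxy : x = y) (hvw : coord E e x v = coord E e y w) :
    (⟨x, v⟩ : Σ x, E.Fib x) = ⟨y, w⟩ := by
  subst hxy
  rw [h.coord_injective hvw]

namespace EquivPreBundle

variable (U : EquivPreBundle J I G X) {n : ℕ} (e : Fin n → ∀ x, U.Fib x)

/-- The matrices of the action with respect to a frame. -/
noncomputable def actionMatrix (g : G) (x : X) : Matrix (Fin n) (Fin n) ℂ :=
  .of fun i j => coord U.toPreBundle e (g • x) (U.act g x (e j x)) i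

variable {U e} {N : Set X} (he : ∀ x ∈ N, IsFrameAt I U.toPreBundle e x)

include he in
theorem coord_act (g : G) {x : X} (hx : x ∈ N) (v : U.Fib x) :
    coord U.toPreBundle e (g • x) (U.act g x v) =
      (actionMatrix U e g x).mulVec (coord U.toPreBundle e x v) := by
  conv_lhs => rw [← (he x hx).sum_coord v, map_sum, map_sum]
  ext i
  simp only [map_smul, Finset.sum_apply, Pi.smul_apply, smul_eq_mul, Matrix.mulVec, dotProduct]
  exact Finset.sum_congr rfl fun j _ => mul_comm _ _

include he in
-- The entries are the coordinates, in the frame pulled back along the action map, of the image of a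
-- frame section pulled back along the projection. Smoothness of the action over `G × X` says
-- exactly that these are smooth.
theorem isActionCocycle_actionMatrix (hN : IsOpen N)
    (hact : ContMDiff (J.prod I) I ∞ (fun z : G × X => z.1 • z.2)) :
    IsActionCocycle J I N (actionMatrix U e) where
  isOpen := hN
  one x hx := by
    ext i j
    change coord U.toPreBundle e _ (U.act 1 x (e j x)) i = _
    rw [coord_congr (U.one_act x (e j x)), (he x hx).coord_self, Matrix.one_apply, Pi.single_apply]
  mul g h x hx hhx _ := by
    ext i j
    change coord U.toPreBundle e _ (U.act (g * h) x (e j x)) i = _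
    rw [coord_congr (U.mul_act g h x (e j x)), coord_act he g hhx]
    rfl
  smooth g x hx hgx i j := by
    have h1 := U.act_smooth (fun z => e j z.2) (g, x)
      (.of _ ⟨e j, (he x hx).smoothAt j, rfl⟩)
    have h2 : ∀ᶠ z : G × X in 𝓝 (g, x), z.1 • z.2 ∈ N :=
      (hact.continuous.continuousAt (x := ((g, x) : G × X))).eventually
        (p := fun y => y ∈ N) (hN.mem_nhds hgx)
    have h3 : ∀ᶠ z : G × X in 𝓝 (g, x), IsFrameAt (J.prod I)
        (PreBundle.pullback (J.prod I) (fun z : G × X => z.1 • z.2) U.toPreBundle)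
        (fun i z => e i (z.1 • z.2)) z := by
      filter_upwards [h2] with z hz
      exact IsFrameAt.pullback (φ := fun z : G × X => z.1 • z.2) (he _ hz)
        (.of_forall fun z => hact z)
    exact ((smoothAt_iff_coord h3 _).1 h1 i).contMDiffAt

/-- A section which is equivariant up to scalars is smooth at all points of an orbit if it is
smooth at one of them. -/
theorem smoothAt_of_equivariant (hU : U.toPreBundle.IsVectorBundle I)
    (hact : ContMDiff (J.prod I) I ∞ (fun z : G × X => z.1 • z.2)) (c : G → ℂ)
    {q : ∀ x, U.Fib x} (hq : ∀ g x, q (g • x) = c g • U.act g x (q x)) {g : G} {x : X}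
    (h : U.SmoothAt q x) : U.SmoothAt q (g • x) := by
  -- Near `w` the section equals `c(g)` times the translate by `g` of its values near `g⁻¹ • w`. The
  -- translate is smooth as the restriction of the action along `y ↦ (g, g⁻¹ • y)`.
  have key : ∀ w, U.SmoothAt q (g⁻¹ • w) → U.SmoothAt q w := by
    intro w hw
    have h1 := U.act_smooth (fun z => q z.2) (g, g⁻¹ • w) (.of _ ⟨q, hw, rfl⟩)
    have hf : ContMDiff I (J.prod I) ∞ fun y : X => (g, g⁻¹ • y) :=
      contMDiff_const.prodMk (hact.comp (contMDiff_const.prodMk contMDiff_id))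
    have h2 := Generated.comp (I := I) (I' := J.prod I) (x := w) (f := fun y : X => (g, g⁻¹ • y)) hf
      (S' := {s' | ∃ u, U.SmoothAt u (g • g⁻¹ • w) ∧ s' = fun y : X => u (g • g⁻¹ • y)})
      (by rintro _ ⟨u, hu, rfl⟩; exact .of _ ⟨u, hu, rfl⟩) h1
    have h3 := Generated.map (S' := {t | U.SmoothAt t w})
      (φ := fun y : X => cast U.toPreBundle (smul_inv_smul g y)) (by
        rintro _ ⟨u, hu, rfl⟩
        refine .of _ ?_
        rw [smul_inv_smul] at hu
        simp only [cast_section U.toPreBundle u]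
        exact hu) h2
    refine hU.generated (.congr _ _ (.of_forall fun y => ?_) (.smul (fun _ => c g) _ (.const _) h3))
    have h4 := hq g (g⁻¹ • y)
    simp only
    rw [← map_smul, ← h4, cast_section]
  exact key _ (by rwa [inv_smul_smul])

end EquivPreBundle

end ActionMatrix

/-! ### Invariant sections over a single orbit -/

section Descent

open PreBundle

variable {EG HG : Type*} [NormedAddCommGroup EG] [NormedSpace ℝ EG]
  [TopologicalSpace HG] {J : ModelWithCorners ℝ EG HG}
  {EX HX : Type*} [NormedAddCommGroup EX] [NormedSpace ℝ EX] [TopologicalSpace HX]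
  {I : ModelWithCorners ℝ EX HX}
  {EY HY : Type*} [NormedAddCommGroup EY] [NormedSpace ℝ EY] [TopologicalSpace HY]
  {I' : ModelWithCorners ℝ EY HY}
  {G X Y : Type u} [CommGroup G] [TopologicalSpace G] [ChartedSpace HG G]
  [TopologicalSpace X] [ChartedSpace HX X] [MulAction G X]
  [TopologicalSpace Y] [ChartedSpace HY Y]

/-- The action of `G` on the total space of `χ ⊗ U`. -/
noncomputable def twistedAct (χ : PontryaginDual G) (U : EquivPreBundle J I G X) (a : G)
    (w : Σ x, U.Fib x) : Σ x, U.Fib x :=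
  ⟨a • w.1, (χ a : ℂ) • U.act a w.1 w.2⟩

theorem twistedAct_mul (χ : PontryaginDual G) (U : EquivPreBundle J I G X) (a b : G)
    (w : Σ x, U.Fib x) : twistedAct χ U (a * b) w = twistedAct χ U a (twistedAct χ U b w) := by
  have h1 := U.mul_act a b w.1 w.2
  have h2 : ∀ {x y : X} {v : U.Fib x} {w : U.Fib y} (c : ℂ),
      (⟨x, v⟩ : Σ x, U.Fib x) = ⟨y, w⟩ → (⟨x, c • v⟩ : Σ x, U.Fib x) = ⟨y, c • w⟩ := by
    intro x y v w c h
    cases h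
    rfl
  refine (h2 _ h1).trans ?_
  change _ = (⟨a • b • w.1, (χ a : ℂ) • U.act a (b • w.1) ((χ b : ℂ) • U.act b w.1 w.2)⟩ :
    Σ x, U.Fib x)
  refine congrArg (Sigma.mk _) ?_
  rw [(U.act a (b • w.1)).map_smul, smul_smul (χ a : ℂ), PontryaginDual.coe_apply_mul]

variable {p : X → Y} {χ : PontryaginDual G} {U : EquivPreBundle J I G X}

theorem descend_apply_smul {y : Y} (s : (descend I p χ U).Fib y) {a : G} {x x' : X} (hx : p x = y)
    (hx' : p x' = y) (h : a • x = x') :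
    (⟨x', s.1 ⟨x', hx'⟩⟩ : Σ x, U.Fib x) = twistedAct χ U a ⟨x, s.1 ⟨x, hx⟩⟩ := by
  subst h
  rw [s.2 a x hx hx']
  rfl

/-- The value of an invariant section over an orbit at a point. -/
def descendEval (χ : PontryaginDual G) (U : EquivPreBundle J I G X) {x : X} {y : Y} (hx : p x = y) :
    (descend I p χ U).Fib y →ₗ[ℂ] U.Fib x where
  toFun s := s.1 ⟨x, hx⟩
  map_add' _ _ := rfl
  map_smul' _ _ := rfl

/-- Invariant sections over an orbit are determined by their value at one point. -/
theorem descend_ext (hp : ∀ x x' : X, p x = p x' → ∃ g : G, g • x = x') {y : Y}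
    {s t : (descend I p χ U).Fib y} {x : X} (hx : p x = y) (h : s.1 ⟨x, hx⟩ = t.1 ⟨x, hx⟩) :
    s = t := by
  refine Subtype.ext (funext fun ⟨x', hx'⟩ => ?_)
  obtain ⟨g, hg⟩ := hp x x' (hx.trans hx'.symm)
  have h1 := descend_apply_smul s hx hx' hg
  rw [h, ← descend_apply_smul t hx hx' hg] at h1
  exact eq_of_heq (Sigma.mk.inj_iff.1 h1).2

/-- Each vector at `x` which is invariant under the stabilizer of `x` extends to an invariant
section over the orbit. -/
theorem exists_descend_apply_eq (hp : ∀ x x' : X, p x = p x' → ∃ g : G, g • x = x') {x : X} {y : Y}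
    (hx : p x = y) (v : U.Fib x)
    (hv : ∀ k : G, k • x = x → twistedAct χ U k ⟨x, v⟩ = ⟨x, v⟩) :
    ∃ s : (descend I p χ U).Fib y, s.1 ⟨x, hx⟩ = v := by
  have hex : ∀ x' : {x' // p x' = y}, ∃ g : G, g • x = x'.1 := fun x' =>
    hp x x'.1 (hx.trans x'.2.symm)
  choose g hg using hex
  -- Two group elements with the same effect on `x` differ by one fixing `x`, and these fix `v` for
  -- the twisted action; the translate of `v` is therefore well defined at each point of the orbit.
  have hind : ∀ a b : G, a • x = b • x → twistedAct χ U a ⟨x, v⟩ = twistedAct χ U b ⟨x, v⟩ := by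
    intro a b hab
    have h1 : (b⁻¹ * a) • x = x := by rw [mul_smul, hab, inv_smul_smul]
    have h2 := twistedAct_mul χ U b (b⁻¹ * a) ⟨x, v⟩
    rwa [mul_inv_cancel_left, hv _ h1] at h2
  let s : ∀ x' : {x' // p x' = y}, U.Fib x'.1 := fun x' =>
    cast U.toPreBundle (hg x') (twistedAct χ U (g x') ⟨x, v⟩).2
  have hs : ∀ x', (⟨x'.1, s x'⟩ : Σ x, U.Fib x) = twistedAct χ U (g x') ⟨x, v⟩ := fun x' =>
    Sigma.ext (hg x').symm (cast_heq U.toPreBundle (hg x') _)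
  refine ⟨⟨s, fun a x' hx' hax' => ?_⟩, ?_⟩
  · have h1 : (⟨a • x', s ⟨a • x', hax'⟩⟩ : Σ x, U.Fib x) =
        twistedAct χ U a ⟨x', s ⟨x', hx'⟩⟩ := by
      rw [hs ⟨a • x', hax'⟩, hs ⟨x', hx'⟩, ← twistedAct_mul]
      refine hind _ _ ?_
      rw [hg, mul_smul, hg]
    exact eq_of_heq (Sigma.mk.inj_iff.1 h1).2
  · have h1 := hs ⟨x, hx⟩
    rw [hv _ (hg ⟨x, hx⟩)] at h1
    exact eq_of_heq (Sigma.mk.inj_iff.1 h1).2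

theorem descend_apply_congr (s : ∀ y, (descend I p χ U).Fib y) {x : X} {y : Y} (h : p x = y) :
    (s y).1 ⟨x, h⟩ = (s (p x)).1 ⟨x, rfl⟩ := by
  subst h
  rfl

end Descent

/-! ### Descent of an equivariant bundle is a vector bundle -/

section DescentBundle

open PreBundle

variable {EG HG : Type*} [NormedAddCommGroup EG] [NormedSpace ℝ EG]
  [TopologicalSpace HG] {J : ModelWithCorners ℝ EG HG} [J.Boundaryless]
  {EX : Type} {HX : Type*} [NormedAddCommGroup EX] [NormedSpace ℝ EX] [FiniteDimensional ℝ EX]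
  [TopologicalSpace HX] {I : ModelWithCorners ℝ EX HX}
  {EY HY : Type*} [NormedAddCommGroup EY] [NormedSpace ℝ EY] [TopologicalSpace HY]
  {I' : ModelWithCorners ℝ EY HY}
  {G X Y : Type u} [CommGroup G] [TopologicalSpace G] [ChartedSpace HG G] [LieGroup J ∞ G]
  [CompactSpace G] [T2Space G]
  [TopologicalSpace X] [ChartedSpace HX X] [IsManifold I ∞ X] [T2Space X] [MulAction G X]
  [TopologicalSpace Y] [ChartedSpace HY Y]

theorem PreBundle.IsVectorBundle.exists_open_frame {EM HM : Type*}
    [NormedAddCommGroup EM] [NormedSpace ℝ EM] [TopologicalSpace HM] {I : ModelWithCorners ℝ EM HM}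
    {M : Type u} [TopologicalSpace M] [ChartedSpace HM M] {E : PreBundle M}
    (hE : E.IsVectorBundle I) (x : M) : ∃ (n : ℕ) (e : Fin n → ∀ y, E.Fib y) (N : Set M),
      IsOpen N ∧ x ∈ N ∧ ∀ y ∈ N, IsFrameAt I E e y := by
  obtain ⟨n, e, he⟩ := hE.exists_frame x
  obtain ⟨N, h1, h2, h3⟩ := eventually_nhds_iff.1 he
  exact ⟨n, e, N, h2, h3, h1⟩

/-- Near each point there are sections `r` and vector valued functions `f` with the following
properties: the sections are equivariant and smooth, `f` gives the coordinates of any invariant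
vector with respect to them, and takes smooth sections to smooth functions. -/
theorem exists_equivariantFrame (hact : ContMDiff (J.prod I) I ∞ (fun z : G × X => z.1 • z.2))
    {K : Subgroup G} (hK : ∀ x : X, MulAction.stabilizer G x = K)
    {U : EquivPreBundle J I G X} (hU : U.toPreBundle.IsVectorBundle I) (χ : PontryaginDual G)
    (x₀ : X) : ∃ (m : ℕ) (r : Fin m → ∀ x, U.Fib x) (f : ∀ x, U.Fib x →ₗ[ℂ] (Fin m → ℂ))
      (N : Set X), IsOpen N ∧ x₀ ∈ N ∧ ∀ x ∈ N,
        (∀ l, U.SmoothAt (r l) x) ∧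
        (∀ s, U.SmoothAt s x → ∀ l, SmoothNear I (fun y => f y (s y) l) x) ∧
        (∀ c : Fin m → ℂ, f x (∑ l, c l • r l x) = c) ∧
        (∀ (h : G) (l : Fin m), h • x ∈ N →
          (⟨h • x, r l (h • x)⟩ : Σ x, U.Fib x) = twistedAct χ U h ⟨x, r l x⟩) ∧
        ∀ v : U.Fib x, (∀ k : G, k • x = x → twistedAct χ U k ⟨x, v⟩ = ⟨x, v⟩) →
          ∑ l, f x v l • r l x = v := by
  obtain ⟨n, e, N, hNo, hx₀, he⟩ := hU.exists_open_frame x₀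
  have hH := EquivPreBundle.isActionCocycle_actionMatrix (J := J) he hNo hact
  borelize G
  obtain ⟨m, a, L, N', hN', hN'o, hx₀', h⟩ := hH.exists_invariantFrame hact χ hx₀
    -- The isotropy group is the same at all points, so an element fixing `x₀` fixes every point
    -- near it.
    fun k hk x _ => by
      have h1 : k ∈ MulAction.stabilizer G x₀ := hk
      rw [hK x₀, ← hK x] at h1
      exact h1
  have hr : ∀ x (c : Fin m → ℂ), ∑ l, c l • ∑ i, a x i l • e i x =
      ∑ i, (a x).mulVec c i • e i x := by
    intro x c
    simp only [Finset.smul_sum, Matrix.mulVec, dotProduct, Finset.sum_smul, smul_smul]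
    rw [Finset.sum_comm]
    exact Finset.sum_congr rfl fun i _ => Finset.sum_congr rfl fun l _ => by rw [mul_comm]
  refine ⟨m, fun l x => ∑ i, a x i l • e i x,
    fun x => (Matrix.mulVecLin (L x)).comp (coord U.toPreBundle e x), N', hN'o, hx₀', ?_⟩
  intro x hx
  obtain ⟨ha, hL, hLa, hae, hinv⟩ := h x hx
  have hex := he x (hN' hx)
  have hnear : ∀ᶠ z in 𝓝 x, IsFrameAt I U.toPreBundle e z :=
    (hNo.eventually_mem (hN' hx)).mono he
  refine ⟨fun l => (hex.2.2 _).2 ⟨fun i z => a z i l, fun i => ha i l, .of_forall fun _ => rfl⟩,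
    fun s hs l => ?_, fun c => ?_, fun g l hg => ?_, fun v hv => ?_⟩
  · have h1 := (smoothAt_iff_coord hnear s).1 hs
    exact SmoothNear.sum Finset.univ (f := fun i y => L y l i * coord U.toPreBundle e y (s y) i)
      fun i _ => (hL l i).mul (h1 i)
  · rw [hr]
    change (L x).mulVec (coord _ _ _ _) = c
    rw [hex.coord_sum, Matrix.mulVec_mulVec, hLa, Matrix.one_mulVec]
  · refine (he _ (hN' hg)).sigma_ext (y := g • x) rfl ?_
    change _ = coord _ _ _ ((χ g : ℂ) • U.act g x (∑ i, a x i l • e i x))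
    rw [(he _ (hN' hg)).coord_sum fun i => a (g • x) i l, map_smul,
      EquivPreBundle.coord_act he g (hN' hx), hex.coord_sum fun i => a x i l]
    ext i
    rw [hae g hg]
    rfl
  · rw [hr]
    refine hex.coord_injective ?_
    rw [hex.coord_sum]
    refine hinv _ (mem_invariantVectors.2 fun k hk => ?_)
    have h1 : coord U.toPreBundle e (k • x) ((χ k : ℂ) • U.act k x v) =
        coord U.toPreBundle e x v := coord_congr (hv k hk)
    rwa [map_smul, EquivPreBundle.coord_act he k (hN' hx)] at h1

/-- The descent of an equivariant bundle is a vector bundle. -/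
theorem IsQuotientWithSections.isVectorBundle_descend {p : X → Y}
    (hp : IsQuotientWithSections I I' G p)
    (hact : ContMDiff (J.prod I) I ∞ (fun z : G × X => z.1 • z.2))
    {K : Subgroup G} (hK : ∀ x : X, MulAction.stabilizer G x = K)
    {U : EquivPreBundle J I G X} (hU : U.toPreBundle.IsVectorBundle I) (χ : PontryaginDual G) :
    (descend I p χ U).IsVectorBundle I' := by
  have horb : ∀ x x' : X, p x = p x' → ∃ g : G, g • x = x' := fun x x' => (hp.fibres x x').1
  refine isVectorBundle_of_frames fun y₀ => ?_
  obtain ⟨x₀, rfl⟩ := hp.surjective y₀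
  obtain ⟨m, r, f, N, hNo, hx₀, h⟩ := exists_equivariantFrame hact hK hU χ x₀
  have hinv : ∀ x ∈ N, ∀ l, ∀ k : G, k • x = x →
      twistedAct χ U k ⟨x, r l x⟩ = ⟨x, r l x⟩ := by
    intro x hx l k hk
    rw [← (h x hx).2.2.2.1 k l (by rwa [hk]), hk]
  -- The local sections `r l` determine invariant sections over the orbits meeting `N`: the value at
  -- one point of the orbit in `N` suffices, and equivariance makes the values at other points in
  -- `N` agree. On other orbits zero is taken.
  have hex : ∀ l y, ∃ s : (descend I p χ U).Fib y, ∀ x (hx : p x = y), x ∈ N →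
      s.1 ⟨x, hx⟩ = r l x := by
    intro l y
    by_cases hy : ∃ x ∈ N, p x = y
    · obtain ⟨x, hxN, hx⟩ := hy
      obtain ⟨s, hs⟩ := exists_descend_apply_eq horb hx (r l x) (hinv x hxN l)
      refine ⟨s, fun x' hx' hxN' => ?_⟩
      obtain ⟨g, rfl⟩ := horb x x' (hx.trans hx'.symm)
      have h1 := descend_apply_smul s hx hx' rfl
      rw [hs, ← (h x hxN).2.2.2.1 g l hxN'] at h1
      exact eq_of_heq (Sigma.mk.inj_iff.1 h1).2
    · exact ⟨0, fun x hx hxN => (hy ⟨x, hxN, hx⟩).elim⟩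
  choose t ht using hex
  obtain ⟨σ, hσ0, hσ⟩ := hp.exists_section x₀
  have hσN : ∀ᶠ y in 𝓝 (p x₀), σ y ∈ N :=
    hσ.self_of_nhds.1.continuousAt.eventually (by rw [hσ0]; exact hNo.mem_nhds hx₀)
  -- An invariant section is determined by its value at `σ y`, and this value expands in the
  -- sections `r l`. As `σ` is smooth, the coefficients depend smoothly on `y`.
  have hexp : ∀ y (hy : p (σ y) = y), σ y ∈ N → ∀ s : (descend I p χ U).Fib y,
      s = ∑ l, f (σ y) (s.1 ⟨σ y, hy⟩) l • t l y := by
    intro y hy hyN s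
    refine descend_ext horb hy ?_
    have h1 := (h _ hyN).2.2.2.2 (s.1 ⟨σ y, hy⟩) fun k hk =>
      (descend_apply_smul s hy hy hk).symm
    conv_lhs => rw [← h1]
    refine Eq.trans (Finset.sum_congr rfl fun l _ => ?_) (map_sum (descendEval χ U hy) _ _).symm
    rw [map_smul, ← ht l y (σ y) hy hyN]
    rfl
  refine ⟨ULift.{u} (Fin m), inferInstance, fun l => t l.down, ?_⟩
  filter_upwards [hσ.eventually_nhds, hσN.eventually_nhds] with y hy hyN
  -- Smoothness is known only at points of `N`, but the definition requires it along the whole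
  -- orbit; equivariance carries it there.
  have hty : ∀ l, (descend I p χ U).SmoothAt (t l) y := by
    intro l
    filter_upwards [hy, hyN] with y' h1 h2 x hx
    obtain ⟨g, rfl⟩ := horb (σ y') x (h1.2.trans hx.symm)
    refine EquivPreBundle.smoothAt_of_equivariant hU hact (fun g => (χ g : ℂ)) (fun g x => ?_) ?_
    · have h3 := (t l (p x)).2 g x rfl (hp.apply_smul g x)
      rw [← h3]
      exact (descend_apply_congr (t l) (hp.apply_smul g x)).symm
    · refine hU.generated (.congr (r l) _ ?_ (.of _ ((h _ h2).1 l)))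
      filter_upwards [hNo.eventually_mem h2] with x hx
      exact (ht l (p x) x rfl hx).symm
  have hy0 := hy.self_of_nhds.2
  have hev : ∀ c : Fin m → ℂ, f (σ y) ((∑ l, c l • t l y : (descend I p χ U).Fib y).1 ⟨σ y, hy0⟩) = c := by
    intro c
    refine Eq.trans (congrArg _ (Eq.trans (map_sum (descendEval χ U hy0) _ _)
      (Finset.sum_congr rfl fun l _ => ?_))) ((h _ hyN.self_of_nhds).2.2.1 c)
    rw [map_smul, ← ht l y (σ y) hy0 hyN.self_of_nhds]
    rfl
  refine IsFrameAt.reindex (e := t) ⟨?_, ?_, fun s => ⟨fun hs => ?_, fun hs => ?_⟩⟩ Equiv.ulift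
  · rw [Fintype.linearIndependent_iff]
    intro c hc l
    rw [← hev c, hc]
    have : f (σ y) ((0 : (descend I p χ U).Fib y).1 ⟨σ y, hy0⟩) = 0 := map_zero _
    rw [this]
    rfl
  · refine eq_top_iff.2 fun s _ => ?_
    rw [hexp y hy0 hyN.self_of_nhds s]
    exact Submodule.sum_mem _ fun l _ => Submodule.smul_mem _ _ (Submodule.subset_span ⟨l, rfl⟩)
  · have h1 := hs.self_of_nhds (σ y) hy0
    refine ⟨fun l y' => f (σ y') ((s (p (σ y'))).1 ⟨σ y', rfl⟩) l, fun l => ?_, ?_⟩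
    · exact SmoothNear.comp ((h _ hyN.self_of_nhds).2.1 _ h1 l) (hy.mono fun y' h => h.1)
    · filter_upwards [hy, hyN] with y' h2 h3
      conv_lhs => rw [hexp y' h2.2 h3 (s y')]
      rw [descend_apply_congr s]
  · exact descend_generated hp.smooth χ ⟨U, hU⟩ (hs.generated fun l => .of _ (hty l))

end DescentBundle

/-! ### The fibres of the line bundles `shf` -/

section ShiftFibre

variable {EX HX : Type*} [NormedAddCommGroup EX] [NormedSpace ℝ EX] [TopologicalSpace HX]
  {I : ModelWithCorners ℝ EX HX}
  {G X Y : Type u} [CommGroup G] [TopologicalSpace G]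
  [TopologicalSpace X] [ChartedSpace HX X] [MulAction G X]
  [TopologicalSpace Y] {p : X → Y} {χ : PontryaginDual G}

theorem shift_apply_smul {y : Y} (f : (shift I p χ).Fib y) {a : G} {x x' : X} (hx : p x = y)
    (hx' : p x' = y) (h : a • x = x') : f.1 ⟨x', hx'⟩ = (χ a : ℂ) * f.1 ⟨x, hx⟩ := by
  subst h
  exact f.2 a x hx hx'

theorem shift_ext (hp : ∀ x x' : X, p x = p x' → ∃ g : G, g • x = x') {y : Y}
    {s t : (shift I p χ).Fib y} {x : X} (hx : p x = y) (h : s.1 ⟨x, hx⟩ = t.1 ⟨x, hx⟩) :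
    s = t := by
  refine Subtype.ext (funext fun ⟨x', hx'⟩ => ?_)
  obtain ⟨g, hg⟩ := hp x x' (hx.trans hx'.symm)
  rw [shift_apply_smul s hx hx' hg, shift_apply_smul t hx hx' hg, h]

theorem shift_ne_zero (hp : ∀ x x' : X, p x = p x' → ∃ g : G, g • x = x') {y : Y}
    {s : (shift I p χ).Fib y} {x : X} (hx : p x = y) (h : s.1 ⟨x, hx⟩ ≠ 0)
    (x' : {x // p x = y}) : s.1 x' ≠ 0 := by
  obtain ⟨g, hg⟩ := hp x x'.1 (hx.trans x'.2.symm)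
  rw [shift_apply_smul s hx x'.2 hg]
  exact mul_ne_zero (Circle.coe_ne_zero _) h

/-- The value `χ g` at `g • x` depends only on the point, because `χ` is trivial on the stabilizer.
-/
theorem exists_shift_apply_eq_one (hp : ∀ x x' : X, p x = p x' → ∃ g : G, g • x = x')
    {K : Subgroup G} (hK : ∀ x : X, MulAction.stabilizer G x = K) (hχ : χ ∈ quotientDual K)
    {x : X} {y : Y} (hx : p x = y) : ∃ f : (shift I p χ).Fib y, f.1 ⟨x, hx⟩ = 1 := by
  have hex : ∀ x' : {x' // p x' = y}, ∃ g : G, g • x = x'.1 := fun x' =>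
    hp x x'.1 (hx.trans x'.2.symm)
  choose g hg using hex
  have hind : ∀ a b : G, a • x = b • x → χ a = χ b := by
    intro a b hab
    have h1 : b⁻¹ * a ∈ MulAction.stabilizer G x := by
      rw [MulAction.mem_stabilizer_iff, mul_smul, hab, inv_smul_smul]
    rw [hK] at h1
    have h2 := hχ _ h1
    rwa [map_mul, map_inv, inv_mul_eq_one, eq_comm] at h2
  refine ⟨⟨fun x' => (χ (g x') : ℂ), fun a x' hx' hax' => ?_⟩, ?_⟩
  · rw [← PontryaginDual.coe_apply_mul]
    refine congrArg _ (hind _ _ ?_)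
    rw [hg, mul_smul, hg]
  · have h1 := hind (g ⟨x, hx⟩) 1 (by rw [hg, one_smul])
    change (χ (g ⟨x, hx⟩) : ℂ) = 1
    rw [h1, map_one, Circle.coe_one]

/-- The inverse of a nowhere vanishing invariant function. -/
noncomputable def shiftInv {y : Y} (f : (shift I p χ).Fib y) : (shift I p χ⁻¹).Fib y :=
  ⟨fun x => (f.1 x)⁻¹, fun a x hx hax => by
    change (f.1 ⟨a • x, hax⟩)⁻¹ = _ * (f.1 ⟨x, hx⟩)⁻¹
    rw [f.2 a x hx hax, mul_inv, PontryaginDual.coe_inv_apply]⟩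

theorem shift_eq_smul (hp : ∀ x x' : X, p x = p x' → ∃ g : G, g • x = x') {y : Y}
    {f : (shift I p χ).Fib y} {x : X} (hx : p x = y) (hf : f.1 ⟨x, hx⟩ = 1)
    (s : (shift I p χ).Fib y) : s = s.1 ⟨x, hx⟩ • f := by
  refine shift_ext hp hx ?_
  change _ = s.1 ⟨x, hx⟩ * f.1 ⟨x, hx⟩
  rw [hf, mul_one]

/-- The fibre of `shf` is spanned by `f`, so the first factor of every tensor can be normalized to
`f`. -/
theorem shift_tmul_eq (hp : ∀ x x' : X, p x = p x' → ∃ g : G, g • x = x') {y : Y}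
    {f : (shift I p χ).Fib y} {x : X} (hx : p x = y) (hf : f.1 ⟨x, hx⟩ = 1)
    {V : Type*} [AddCommGroup V] [Module ℂ V] (t : (shift I p χ).Fib y ⊗[ℂ] V) :
    ∃ v : V, t = f ⊗ₜ v := by
  induction t with
  | zero => exact ⟨0, (TensorProduct.tmul_zero _ _).symm⟩
  | tmul s v => exact ⟨s.1 ⟨x, hx⟩ • v,
      (congrArg (· ⊗ₜ[ℂ] v) (shift_eq_smul hp hx hf s)).trans (TensorProduct.smul_tmul _ _ _)⟩
  | add s t hs ht =>
    obtain ⟨v, rfl⟩ := hs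
    obtain ⟨w, rfl⟩ := ht
    exact ⟨v + w, (TensorProduct.tmul_add _ _ _).symm⟩

end ShiftFibre

/-! ### The trivial equivariant line bundle -/

section TrivialLine

variable {EG HG : Type*} [NormedAddCommGroup EG] [NormedSpace ℝ EG]
  [TopologicalSpace HG] (J : ModelWithCorners ℝ EG HG)
  {EX HX : Type*} [NormedAddCommGroup EX] [NormedSpace ℝ EX] [TopologicalSpace HX]
  (I : ModelWithCorners ℝ EX HX)
  (G X : Type u) [CommGroup G] [TopologicalSpace G] [ChartedSpace HG G]
  [TopologicalSpace X] [ChartedSpace HX X] [MulAction G X]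

/-- The trivial line bundle with the trivial action. -/
def trivialLine : EquivPreBundle J I G X where
  Fib _ := ULift.{u} ℂ
  SmoothAt s x := SmoothNear I (fun y => (s y).down) x
  act _ _ := LinearMap.id
  one_act x v := Sigma.ext (one_smul G x) HEq.rfl
  mul_act g h x v := Sigma.ext (mul_smul g h x) HEq.rfl
  act_smooth s z hs := by
    refine PreBundle.Generated.map (φ := fun _ => LinearMap.id) ?_ hs
    rintro _ ⟨t, ht, rfl⟩
    have h1 : SmoothNear (J.prod I) (fun y : G × X => (t y.2).down) z :=
      SmoothNear.comp (φ := fun y : G × X => y.2) ht (.of_forall fun _ => contMDiffAt_snd)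
    refine PreBundle.Generated.congr _ _ (.of_forall fun y => ?_)
      (.smul _ _ h1 (.of _ ⟨fun _ => ULift.up 1, .const 1, rfl⟩))
    refine ULift.ext _ _ ?_
    change (t y.2).down * 1 = _
    rw [mul_one]
    rfl

theorem isVectorBundle_trivialLine : (trivialLine J I G X).toPreBundle.IsVectorBundle I := by
  refine PreBundle.isVectorBundle_of_frames fun x => ⟨ULift.{u} Unit, inferInstance,
    fun _ _ => ULift.up 1, .of_forall fun y => ?_⟩
  refine PreBundle.isFrameAt_of_basis
    (((Module.Basis.singleton (ULift.{u} Unit) ℂ).map ULift.moduleEquiv.symm))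
    (fun i => ?_) fun s => ⟨fun hs => ⟨fun _ z => (s z).down, fun _ => hs, .of_forall fun z => ?_⟩, ?_⟩
  · exact congrArg ULift.up (Module.Basis.singleton_apply (ULift.{u} Unit) ℂ i)
  · rw [Fintype.sum_unique]
    refine ULift.ext _ _ ?_
    exact (mul_one _).symm
  · rintro ⟨c, hc, hs⟩
    refine SmoothNear.congr (hc default) (hs.mono fun z hz => ?_)
    rw [hz, Fintype.sum_unique]
    exact mul_one _

end TrivialLine

/-! ### The line bundles `shf` as descents -/

section ShiftBundle

open PreBundle

variable {EG HG : Type*} [NormedAddCommGroup EG] [NormedSpace ℝ EG]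
  [TopologicalSpace HG] {J : ModelWithCorners ℝ EG HG} [J.Boundaryless]
  {EX : Type} {HX : Type*} [NormedAddCommGroup EX] [NormedSpace ℝ EX] [FiniteDimensional ℝ EX]
  [TopologicalSpace HX] {I : ModelWithCorners ℝ EX HX}
  {EY HY : Type*} [NormedAddCommGroup EY] [NormedSpace ℝ EY] [TopologicalSpace HY]
  {I' : ModelWithCorners ℝ EY HY}
  {G X Y : Type u} [CommGroup G] [TopologicalSpace G] [ChartedSpace HG G] [LieGroup J ∞ G]
  [CompactSpace G] [T2Space G]
  [TopologicalSpace X] [ChartedSpace HX X] [IsManifold I ∞ X] [T2Space X] [MulAction G X]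
  [TopologicalSpace Y] [ChartedSpace HY Y] {p : X → Y}

/-- This is the descent of `χ` tensored with the trivial line. No condition on `χ` is required: if
it is not trivial on `K`, the fibres are zero. -/
theorem IsQuotientWithSections.isVectorBundle_shift (hp : IsQuotientWithSections I I' G p)
    (hact : ContMDiff (J.prod I) I ∞ (fun z : G × X => z.1 • z.2))
    {K : Subgroup G} (hK : ∀ x : X, MulAction.stabilizer G x = K) (χ : PontryaginDual G) :
    (shift I p χ).IsVectorBundle I' := by
  let φ : ∀ y, (descend I p χ (trivialLine J I G X)).Fib y ≃ₗ[ℂ] (shift I p χ).Fib y := fun y =>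
    { toFun := fun s => ⟨fun x => (s.1 x).down, fun a x hx hax =>
        congrArg ULift.down (s.2 a x hx hax)⟩
      invFun := fun f => ⟨fun x => ULift.up (f.1 x), fun a x hx hax =>
        congrArg ULift.up (f.2 a x hx hax)⟩
      map_add' := fun _ _ => rfl
      map_smul' := fun _ _ => rfl
      left_inv := fun _ => rfl
      right_inv := fun _ => rfl }
  exact (hp.isVectorBundle_descend hact hK (isVectorBundle_trivialLine J I G X) χ).of_linearEquiv φ
    fun s y => Iff.rfl

/-- Near each point, the line bundle has a smooth section without zeros. -/
theorem IsQuotientWithSections.exists_shift_section (hp : IsQuotientWithSections I I' G p)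
    (hact : ContMDiff (J.prod I) I ∞ (fun z : G × X => z.1 • z.2))
    {K : Subgroup G} (hK : ∀ x : X, MulAction.stabilizer G x = K) {χ : PontryaginDual G}
    (hχ : χ ∈ quotientDual K) (y₀ : Y) : ∃ φ : ∀ y, (shift I p χ).Fib y,
      ∀ᶠ y in 𝓝 y₀, (shift I p χ).SmoothAt φ y ∧ ∀ x, (φ y).1 x ≠ 0 := by
  have horb : ∀ x x' : X, p x = p x' → ∃ g : G, g • x = x' := fun x x' => (hp.fibres x x').1
  obtain ⟨x₀, rfl⟩ := hp.surjective y₀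
  obtain ⟨n, e, he⟩ := (hp.isVectorBundle_shift hact hK χ).exists_frame (p x₀)
  obtain ⟨f, hf⟩ := exists_shift_apply_eq_one (I := I) (y := p x₀) horb hK hχ rfl
  let c := coord (shift I p χ) e (p x₀) f
  -- A non-zero vector over `p x₀` is extended with constant coefficients in a frame. Its value at
  -- `σ y` remains non-zero by continuity, and invariance excludes zeros elsewhere on the orbit.
  let φ : ∀ y, (shift I p χ).Fib y := fun y => ∑ i, c i • e i y
  have hφ0 : φ (p x₀) = f := he.self_of_nhds.sum_coord f
  have hφs : ∀ᶠ y in 𝓝 (p x₀), (shift I p χ).SmoothAt φ y := by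
    filter_upwards [he] with y hy
    exact (hy.2.2 _).2 ⟨fun i _ => c i, fun i => .const _, .of_forall fun _ => rfl⟩
  refine ⟨φ, ?_⟩
  have h1 : ContinuousAt (fun x => (φ (p x)).1 ⟨x, rfl⟩) x₀ :=
    (SmoothNear.contMDiffAt (hφs.self_of_nhds.self_of_nhds x₀ rfl)).continuousAt
  have h2 : ∀ᶠ x in 𝓝 x₀, (φ (p x)).1 ⟨x, rfl⟩ ≠ 0 := by
    refine h1.eventually_ne ?_
    rw [hφ0, hf]
    exact one_ne_zero
  obtain ⟨σ, hσ0, hσ⟩ := hp.exists_section x₀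
  have h3 : Tendsto σ (𝓝 (p x₀)) (𝓝 x₀) := by
    have h4 := hσ.self_of_nhds.1.continuousAt
    rwa [ContinuousAt, hσ0] at h4
  filter_upwards [hφs, h3.eventually h2, hσ] with y h4 h5 h6
  refine ⟨h4, fun x => shift_ne_zero horb h6.2 ?_ x⟩
  have h7 : ∀ {y y' : Y} (h : y' = y) (x : X) (hx : p x = y) (hx' : p x = y'),
      (φ y').1 ⟨x, hx'⟩ = (φ y).1 ⟨x, hx⟩ := by
    rintro y _ rfl x _ _
    rfl
  rwa [← h7 h6.2 (σ y) h6.2 rfl]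

end ShiftBundle

/-! ### Weight decomposition of representations -/

section WeightVectors

variable {G : Type*} [CommGroup G] [TopologicalSpace G] {V : Type*} [AddCommGroup V] [Module ℂ V]
  {A : G →* Module.End ℂ V}

theorem PontryaginDual.linearIndependent :
    LinearIndependent ℂ fun (χ : PontryaginDual G) (g : G) => (χ g : ℂ) := by
  let φ : PontryaginDual G → (G →* ℂ) := fun χ => Circle.coeHom.comp (χ : G →* Circle)
  have hφ : Function.Injective φ := fun χ χ' h => by
    refine DFunLike.ext _ _ fun g => Circle.ext ?_
    exact DFunLike.congr_fun h g
  exact (linearIndependent_monoidHom G ℂ).comp φ hφ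

/-- Weight vectors of different weights are independent. -/
theorem eq_zero_of_sum_weightVectors (F : Finset (PontryaginDual G)) (w : PontryaginDual G → V)
    (hw : ∀ χ ∈ F, ∀ g, A g (w χ) = (χ g : ℂ) • w χ) (h : ∑ χ ∈ F, w χ = 0) :
    ∀ χ ∈ F, w χ = 0 := by
  intro χ hχ
  refine (Module.forall_dual_apply_eq_zero_iff ℂ _).1 fun l => ?_
  refine linearIndependent_iff'.1 PontryaginDual.linearIndependent F (fun χ => l (w χ)) ?_ χ hχ
  ext g
  have h1 := congrArg l (congrArg (A g) h)
  rw [map_sum, map_sum, map_zero, map_zero] at h1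
  rw [Pi.zero_apply, ← h1, Finset.sum_apply]
  refine Finset.sum_congr rfl fun χ hχ => ?_
  rw [hw χ hχ, map_smul, smul_eq_mul, mul_comm]
  rfl

/-- Each vector of a representation of a compact abelian group is a sum of weight vectors. -/
theorem exists_sum_weightVectors [IsTopologicalGroup G] [CompactSpace G] [T2Space G]
    [FiniteDimensional ℂ V]
    (hA : ∀ (v : V) (l : Module.Dual ℂ V), Continuous fun g => l (A g v)) (v : V) :
    ∃ w : PontryaginDual G →₀ V, (∀ χ g, A g (w χ) = (χ g : ℂ) • w χ) ∧
      w.sum (fun _ v => v) = v := by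
  classical
  have hv : v ∈ (⊤ : Submodule ℂ V) := trivial
  rw [← span_weightVectors_eq_top A hA] at hv
  induction hv using Submodule.span_induction with
  | mem v hv =>
    obtain ⟨χ, hχ⟩ := hv
    refine ⟨Finsupp.single χ v, fun χ' g => ?_, Finsupp.sum_single_index rfl⟩
    rw [Finsupp.single_apply]
    split_ifs with h
    · rw [← h, hχ]
    · rw [map_zero, smul_zero]
  | zero => exact ⟨0, fun χ g => by simp, Finsupp.sum_zero_index⟩
  | add v v' _ _ h h' =>
    obtain ⟨w, hw, rfl⟩ := h
    obtain ⟨w', hw', rfl⟩ := h'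
    refine ⟨w + w', fun χ g => ?_, Finsupp.sum_add_index' (fun _ => rfl) fun _ _ _ => rfl⟩
    rw [Finsupp.add_apply, map_add, hw, hw', smul_add]
  | smul c v _ h =>
    obtain ⟨w, hw, rfl⟩ := h
    refine ⟨c • w, fun χ g => ?_, ?_⟩
    · rw [Finsupp.smul_apply, map_smul, hw, smul_comm]
    · rw [Finsupp.sum_smul_index' (fun _ => rfl), Finsupp.smul_sum]

end WeightVectors

/-! ### The isotropy representation on fibres and finiteness of its weights -/

section StabilizerRep

open PreBundle

variable {EG HG : Type*} [NormedAddCommGroup EG] [NormedSpace ℝ EG]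
  [TopologicalSpace HG] {J : ModelWithCorners ℝ EG HG}
  {EX : Type} {HX : Type*} [NormedAddCommGroup EX] [NormedSpace ℝ EX]
  [TopologicalSpace HX] {I : ModelWithCorners ℝ EX HX}
  {G X : Type u} [CommGroup G] [TopologicalSpace G] [ChartedSpace HG G]
  [TopologicalSpace X] [ChartedSpace HX X] [MulAction G X]

/-- The representation on the fibre at `x` of a group fixing `x`. -/
noncomputable def stabilizerRep (U : EquivPreBundle J I G X) {B : Subgroup G} {x : X}
    (hB : ∀ k ∈ B, k • x = x) : B →* Module.End ℂ (U.Fib x) where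
  toFun k := cast U.toPreBundle (hB k k.2) ∘ₗ U.act k x
  map_one' := LinearMap.ext fun v => eq_of_heq ((cast_heq U.toPreBundle _ _).trans
    (Sigma.mk.inj_iff.1 (U.one_act x v)).2)
  map_mul' g h := LinearMap.ext fun v => by
    refine eq_of_heq ((cast_heq U.toPreBundle _ _).trans ?_)
    refine ((Sigma.mk.inj_iff.1 (U.mul_act g h x v)).2).trans ?_
    refine HEq.trans ?_ (cast_heq U.toPreBundle _ _).symm
    have key : ∀ (y : X) (hy : (h : G) • x = y), HEq (U.act g ((h : G) • x) (U.act h x v))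
        (U.act g y (cast U.toPreBundle hy (U.act h x v))) := by
      rintro y rfl; rfl
    exact key _ (hB h h.2)

theorem sigma_stabilizerRep (U : EquivPreBundle J I G X) {B : Subgroup G} {x : X}
    (hB : ∀ k ∈ B, k • x = x) (k : B) (v : U.Fib x) :
    (⟨x, stabilizerRep U hB k v⟩ : Σ x, U.Fib x) = ⟨(k : G) • x, U.act k x v⟩ :=
  Sigma.ext (hB k k.2).symm (cast_heq U.toPreBundle _ _)

/-- Connects the two descriptions of a fibre of the descent: invariance in `χ⁻¹ ⊗ U` under the
isotropy group is the weight equation for the restriction of `χ`. -/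
theorem twistedAct_eq_iff (U : EquivPreBundle J I G X) {B : Subgroup G} {x : X}
    (hB : ∀ k ∈ B, k • x = x) (χ : PontryaginDual G) (k : B) (v : U.Fib x) :
    twistedAct χ⁻¹ U k ⟨x, v⟩ = ⟨x, v⟩ ↔ stabilizerRep U hB k v = (χ k : ℂ) • v := by
  have h1 : twistedAct χ⁻¹ U k ⟨x, v⟩ = ⟨x, (χ⁻¹ k : ℂ) • stabilizerRep U hB k v⟩ := by
    have h2 : ∀ {x y : X} {v : U.Fib x} {w : U.Fib y} (c : ℂ),
        (⟨x, v⟩ : Σ x, U.Fib x) = ⟨y, w⟩ → (⟨x, c • v⟩ : Σ x, U.Fib x) = ⟨y, c • w⟩ := by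
      intro x y v w c h
      cases h
      rfl
    exact (h2 _ (sigma_stabilizerRep U hB k v)).symm
  rw [h1, PontryaginDual.coe_inv_apply]
  constructor
  · intro h
    have h2 := eq_of_heq (Sigma.mk.inj_iff.1 h).2
    rwa [inv_smul_eq_iff₀ (Circle.coe_ne_zero _)] at h2
  · intro h
    rw [h, inv_smul_smul₀ (Circle.coe_ne_zero _)]

theorem coord_stabilizerRep {U : EquivPreBundle J I G X} {B : Subgroup G} {x : X}
    (hB : ∀ k ∈ B, k • x = x) {n : ℕ} {e : Fin n → ∀ x, U.Fib x} {N : Set X}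
    (he : ∀ x ∈ N, IsFrameAt I U.toPreBundle e x) (hx : x ∈ N) (k : B) (v : U.Fib x) :
    coord U.toPreBundle e x (stabilizerRep U hB k v) =
      (EquivPreBundle.actionMatrix U e k x).mulVec (coord U.toPreBundle e x v) := by
  rw [coord_congr (sigma_stabilizerRep U hB k v), EquivPreBundle.coord_act he k hx]

theorem continuous_stabilizerRep (hact : ContMDiff (J.prod I) I ∞ (fun z : G × X => z.1 • z.2))
    {U : EquivPreBundle J I G X} (hU : U.toPreBundle.IsVectorBundle I) {B : Subgroup G} {x : X}
    (hB : ∀ k ∈ B, k • x = x) (v : U.Fib x) (l : Module.Dual ℂ (U.Fib x)) :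
    Continuous fun k => l (stabilizerRep U hB k v) := by
  obtain ⟨n, e, N, hNo, hx, he⟩ := hU.exists_open_frame x
  have hH := EquivPreBundle.isActionCocycle_actionMatrix (J := J) he hNo hact
  have h1 : ∀ i j, Continuous fun k : B => EquivPreBundle.actionMatrix U e k x i j := fun i j => by
    refine continuous_iff_continuousAt.2 fun k => ?_
    exact ContinuousAt.comp (f := fun k : B => ((k : G), x))
      (g := fun z : G × X => EquivPreBundle.actionMatrix U e z.1 z.2 i j)
      (hH.smooth k x hx (by rwa [hB k k.2]) i j).continuousAt (by fun_prop)
  have h2 : ∀ k, l (stabilizerRep U hB k v) =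
      ∑ i, (∑ j, EquivPreBundle.actionMatrix U e k x i j * coord U.toPreBundle e x v j) *
        l (e i x) := by
    intro k
    rw [← (he x hx).sum_coord (stabilizerRep U hB k v), map_sum, coord_stabilizerRep hB he hx]
    simp only [map_smul, smul_eq_mul]
    rfl
  simp only [h2]
  fun_prop

/-- The weights near a point have uniformly bounded variation. -/
theorem exists_nhds_finite_weights [IsTopologicalGroup G] [CompactSpace G] [T2Space G]
    (hact : ContMDiff (J.prod I) I ∞ (fun z : G × X => z.1 • z.2))
    {U : EquivPreBundle J I G X} (hU : U.toPreBundle.IsVectorBundle I) {B : Subgroup G}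
    (hBc : IsClosed (B : Set G)) (hB : ∀ x : X, ∀ k ∈ B, k • x = x) (x₀ : X) :
    ∃ N ∈ 𝓝 x₀, {χ : PontryaginDual B | ∃ x ∈ N, ∃ v : U.Fib x, v ≠ 0 ∧
      ∀ k, stabilizerRep U (hB x) k v = (χ k : ℂ) • v}.Finite := by
  obtain ⟨n, e, N, hNo, hx, he⟩ := hU.exists_open_frame x₀
  have hH := EquivPreBundle.isActionCocycle_actionMatrix (J := J) he hNo hact
  let H := EquivPreBundle.actionMatrix U e
  -- With `n` entries per row, `H - 1` then has norm at most `1/4` for the maximum norm. Applied to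
  -- a weight vector this bounds `|χ(k) - 1|` by `1/4` for all weights at nearby points and all `k`
  -- in one neighbourhood of `1`, as `PontryaginDual.finite_of_nhds` demands.
  have h1 : ∀ᶠ z : G × X in 𝓝 (1, x₀), ∀ i j, ‖(H z.1 z.2 - 1) i j‖ < 1 / (4 * (n + 1)) := by
    refine eventually_all.2 fun i => eventually_all.2 fun j => ?_
    have h2 : ContinuousAt (fun z : G × X => ‖(H z.1 z.2 - 1) i j‖) (1, x₀) :=
      ((hH.smooth 1 x₀ hx (by rwa [one_smul]) i j).continuousAt.sub continuousAt_const).norm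
    refine h2.eventually (gt_mem_nhds ?_)
    simp only [H, hH.one x₀ hx, sub_self, Matrix.zero_apply, norm_zero]
    positivity
  rw [nhds_prod_eq] at h1
  obtain ⟨O, hO, N', hN', h2⟩ := mem_prod_iff.1 h1
  have : CompactSpace B := isCompact_iff_compactSpace.1 hBc.isCompact
  have hOB : (Subtype.val ⁻¹' O : Set B) ∈ 𝓝 (1 : B) :=
    continuous_subtype_val.continuousAt.preimage_mem_nhds hO
  refine ⟨N ∩ N', inter_mem (hNo.mem_nhds hx) hN', (PontryaginDual.finite_of_nhds hOB).subset ?_⟩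
  rintro χ ⟨x, ⟨hxN, hxN'⟩, v, hv, hχ⟩ k hk
  let c := coord U.toPreBundle e x v
  have hc : 0 < ‖c‖ := norm_pos_iff.2 fun h => hv ((he x hxN).coord_injective (h.trans (map_zero _).symm))
  have h3 : ((χ k : ℂ) - 1) • c = (H k x - 1).mulVec c := by
    rw [Matrix.sub_mulVec, Matrix.one_mulVec, sub_smul, one_smul,
      ← coord_stabilizerRep (hB x) he hxN, hχ, map_smul]
  have h4 : ‖(H k x - 1).mulVec c‖ ≤ 1 / 4 * ‖c‖ := by
    refine (pi_norm_le_iff_of_nonneg (by positivity)).2 fun i => ?_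
    have h5 : ∀ j, ‖(H k x - 1) i j * c j‖ ≤ 1 / (4 * (n + 1)) * ‖c‖ := fun j => by
      rw [norm_mul]
      exact mul_le_mul (h2 (Set.mk_mem_prod hk hxN') i j).le (norm_le_pi_norm c j)
        (norm_nonneg _) (by positivity)
    refine (norm_sum_le_of_le _ fun j _ => h5 j).trans ?_
    rw [Finset.sum_const, Finset.card_univ, Fintype.card_fin, nsmul_eq_mul, ← mul_assoc]
    refine mul_le_mul_of_nonneg_right ?_ hc.le
    rw [mul_one_div, div_le_div_iff₀ (by positivity) (by norm_num)]
    linarith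
  rw [← h3, norm_smul] at h4
  exact le_of_mul_le_mul_right h4 hc

theorem finite_weights [IsTopologicalGroup G] [CompactSpace G] [T2Space G] [CompactSpace X]
    (hact : ContMDiff (J.prod I) I ∞ (fun z : G × X => z.1 • z.2))
    {U : EquivPreBundle J I G X} (hU : U.toPreBundle.IsVectorBundle I) {B : Subgroup G}
    (hBc : IsClosed (B : Set G)) (hB : ∀ x : X, ∀ k ∈ B, k • x = x) :
    {χ : PontryaginDual B | ∃ x, ∃ v : U.Fib x, v ≠ 0 ∧
      ∀ k, stabilizerRep U (hB x) k v = (χ k : ℂ) • v}.Finite := by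
  choose N hN hfin using exists_nhds_finite_weights hact hU hBc hB
  obtain ⟨t, -, ht⟩ := isCompact_univ.elim_nhds_subcover N fun x _ => hN x
  refine (t.finite_toSet.biUnion fun x _ => hfin x).subset ?_
  rintro χ ⟨x, v, hv, hχ⟩
  obtain ⟨x₀, hx₀, hx⟩ := Set.mem_iUnion₂.1 (ht (Set.mem_univ x))
  exact Set.mem_biUnion (x := x₀) hx₀ ⟨x, hx, v, hv, hχ⟩

end StabilizerRep

/-! ### Invertibility of the twisting maps -/

section Twist

open PreBundle

variable {EX HX : Type*} [NormedAddCommGroup EX] [NormedSpace ℝ EX] [TopologicalSpace HX]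
  {I : ModelWithCorners ℝ EX HX}
  {EY HY : Type*} [NormedAddCommGroup EY] [NormedSpace ℝ EY] [TopologicalSpace HY]
  {I' : ModelWithCorners ℝ EY HY}
  {G X Y : Type u} [CommGroup G] [TopologicalSpace G]
  [TopologicalSpace X] [ChartedSpace HX X] [MulAction G X]
  [TopologicalSpace Y] [ChartedSpace HY Y] {p : X → Y} {B : Subgroup G}

namespace TwistedFamily

variable (V : TwistedFamily I I' p B) {h h' g g' : PontryaginDual G}

/-- Associativity combines the two twists into one by the product of the functions, which is the
unit. -/
theorem twist_twist_eq (hm : h ∈ quotientDual B) (hm' : h' ∈ quotientDual B) (e : g' = h * g)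
    (e' : g = h' * g') {y : Y} {f : (shift I p h).Fib y} {f' : (shift I p h').Fib y}
    (hff' : ∀ x, f.1 x * f'.1 x = 1) (w : (V.W g).Fib y) :
    (V.twist h g g' hm e).map y (f ⊗ₜ (V.twist h' g' g hm' e').map y (f' ⊗ₜ w)) = w := by
  have e1 : 1 = h * h' := by
    have h1 : h' * h * g = 1 * g := by rw [mul_assoc, ← e, ← e', one_mul]
    rw [mul_comm]
    exact (mul_right_cancel h1).symm
  have h1 := V.twist_mul h h' 1 g g' g hm hm' (one_mem _) e e' (one_mul g).symm e1 y f f' w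
  exact h1.trans (V.twist_one g _ _ y _ w hff')

theorem inv_twist_eq (e : g' = h * g) : g = h⁻¹ * g' := by rw [e, inv_mul_cancel_left]

/-- The twisting with a fixed invariant function. -/
noncomputable def twistBy (hm : h ∈ quotientDual B) (e : g' = h * g) {y : Y}
    (f : (shift I p h).Fib y) : (V.W g').Fib y →ₗ[ℂ] (V.W g).Fib y where
  toFun w := (V.twist h g g' hm e).map y (f ⊗ₜ w)
  map_add' w w' := (congrArg _ (TensorProduct.tmul_add f w w')).trans
    (map_add ((V.twist h g g' hm e).map y) (f ⊗ₜ w) (f ⊗ₜ w'))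
  map_smul' c w := (congrArg _ (TensorProduct.tmul_smul c f w)).trans
    (map_smul ((V.twist h g g' hm e).map y) c (f ⊗ₜ w))

theorem twistBy_smul (hm : h ∈ quotientDual B) (e : g' = h * g) {y : Y}
    (c : ℂ) (f : (shift I p h).Fib y) : V.twistBy hm e (c • f) = c • V.twistBy hm e f :=
  LinearMap.ext fun w => map_smul ((V.twist h g g' hm e).map y) c (f ⊗ₜ w)

theorem bijective_twist_tmul (hm : h ∈ quotientDual B) (e : g' = h * g) {y : Y}
    {f : (shift I p h).Fib y} (hf : ∀ x, f.1 x ≠ 0) :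
    Function.Bijective (V.twistBy hm e f) := by
  refine Function.bijective_iff_has_inverse.2
    ⟨fun w => (V.twist h⁻¹ g' g (inv_mem hm) (inv_twist_eq e)).map y (shiftInv f ⊗ₜ w),
      fun w => ?_, fun w => ?_⟩
  · exact V.twist_twist_eq _ _ _ _ (fun x => inv_mul_cancel₀ (hf x)) w
  · exact V.twist_twist_eq _ _ _ _ (fun x => mul_inv_cancel₀ (hf x)) w

/-- Twisting by a nowhere vanishing `f` is inverted by twisting with its inverse, and every tensor
over `y` has the form `f ⊗ w`. So bijectivity on fibres is a consequence of the unit and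
associativity laws. -/
theorem bijective_twist (hsurj : Function.Surjective p)
    (hp : ∀ x x' : X, p x = p x' → ∃ g : G, g • x = x')
    (hB : ∀ x : X, MulAction.stabilizer G x = B) (hm : h ∈ quotientDual B) (e : g' = h * g)
    (y : Y) : Function.Bijective ((V.twist h g g' hm e).map y) := by
  obtain ⟨x, hx⟩ := hsurj y
  obtain ⟨f, hf⟩ := exists_shift_apply_eq_one (I := I) hp hB hm hx
  have hb := V.bijective_twist_tmul hm e (f := f)
    (shift_ne_zero hp hx (by rw [hf]; exact one_ne_zero))
  constructor
  · intro t t' htt'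
    obtain ⟨v, rfl⟩ := shift_tmul_eq hp hx hf t
    obtain ⟨v', rfl⟩ := shift_tmul_eq hp hx hf t'
    rw [hb.1 htt']
  · intro w
    obtain ⟨v, hv⟩ := hb.2 w
    exact ⟨_, hv⟩

end TwistedFamily

end Twist

/-! ### Reductions of equivariant bundles are reduced bundles -/

section ReducedBundles

open PreBundle

variable {EG HG : Type*} [NormedAddCommGroup EG] [NormedSpace ℝ EG]
  [TopologicalSpace HG] {J : ModelWithCorners ℝ EG HG} [J.Boundaryless]
  {EX : Type} {HX : Type*} [NormedAddCommGroup EX] [NormedSpace ℝ EX] [FiniteDimensional ℝ EX]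
  [TopologicalSpace HX] {I : ModelWithCorners ℝ EX HX}
  {EY HY : Type*} [NormedAddCommGroup EY] [NormedSpace ℝ EY] [TopologicalSpace HY]
  {I' : ModelWithCorners ℝ EY HY}
  {G X Y : Type u} [CommGroup G] [TopologicalSpace G] [ChartedSpace HG G] [LieGroup J ∞ G]
  [CompactSpace G] [T2Space G]
  [TopologicalSpace X] [ChartedSpace HX X] [IsManifold I ∞ X] [T2Space X] [MulAction G X]
  [TopologicalSpace Y] [ChartedSpace HY Y] {p : X → Y}

/-- The third condition for a reduced bundle is automatic: the twisting maps are bijective on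
fibres, and source and target are vector bundles. -/
theorem IsQuotientWithSections.isReducedBundle (hp : IsQuotientWithSections I I' G p)
    (hact : ContMDiff (J.prod I) I ∞ (fun z : G × X => z.1 • z.2))
    {B : Subgroup G} (hB : ∀ x : X, MulAction.stabilizer G x = B) {V : TwistedFamily I I' p B}
    (hV : ∀ g, (V.W g).IsVectorBundle I')
    (hfin : {b : PontryaginDual B | ∃ g : PontryaginDual G, (∀ x : B, g x = b x) ∧
      ∃ y, Nontrivial ((V.W g).Fib y)}.Finite) : IsReducedBundle I I' p B V :=
  ⟨hV, hfin, fun h g g' hm e => isIso_of_bijective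
    ((hp.isVectorBundle_shift hact hB h).tensor (hV g')) (hV g) _
    (V.bijective_twist hp.surjective (fun x x' => (hp.fibres x x').1) hB hm e)⟩

/-- A non-zero element of a fibre of the descent of `g⁻¹ ⊗ U` takes as its value at a point a
non-zero vector on which `B` acts through the restriction of `g`. Finiteness of the support is
therefore finiteness of the set of weights. -/
theorem IsQuotientWithSections.isReducedBundle_reduction [CompactSpace X]
    (hp : IsQuotientWithSections I I' G p)
    (hact : ContMDiff (J.prod I) I ∞ (fun z : G × X => z.1 • z.2))
    {B : Subgroup G} (hBc : IsClosed (B : Set G)) (hB : ∀ x : X, MulAction.stabilizer G x = B)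
    (U : BunG J I G X) :
    IsReducedBundle I I' p B ((reduction p hp.smooth B).obj U) := by
  have := topologicalGroup_of_lieGroup (G := G) J ∞
  have hU : U.obj.toPreBundle.IsVectorBundle I := U.property
  have hB' : ∀ x : X, ∀ k ∈ B, k • x = x := fun x k hk => by
    rw [← hB x] at hk
    exact hk
  refine hp.isReducedBundle hact hB (fun g => hp.isVectorBundle_descend hact hB hU g⁻¹)
    ((finite_weights hact hU hBc hB').subset ?_)
  rintro b ⟨g, hgb, y, hy⟩
  have hy : Nontrivial ((descend I p g⁻¹ U.obj).Fib y) := hy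
  obtain ⟨s, hs⟩ := exists_ne (0 : (descend I p g⁻¹ U.obj).Fib y)
  obtain ⟨x, hx⟩ := hp.surjective y
  refine ⟨x, s.1 ⟨x, hx⟩, fun h => hs ?_, fun k => ?_⟩
  · exact descend_ext (fun x x' => (hp.fibres x x').1) hx h
  · rw [← hgb, ← twistedAct_eq_iff U.obj (hB' x) g k]
    exact (descend_apply_smul s hx hx (hB' x k k.2)).symm

end ReducedBundles

/-! ### Isomorphisms of sums, tensor products and twisted families -/

section CategoryLemmas

theorem PreBundle.isIso_directSumMap {M ι : Type u} {F F' : ι → PreBundle M} (φ : ∀ i, F i ⟶ F' i)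
    [∀ i, IsIso (φ i)] : IsIso (PreBundle.directSumMap φ) := by
  have h1 : ∀ (i : ι) (y : M) (v : (F i).Fib y), (inv (φ i)).map y ((φ i).map y v) = v :=
    fun i y v => LinearMap.congr_fun (congrFun (congrArg Hom.map (IsIso.hom_inv_id (φ i))) y) v
  have h2 : ∀ (i : ι) (y : M) (v : (F' i).Fib y), (φ i).map y ((inv (φ i)).map y v) = v :=
    fun i y v => LinearMap.congr_fun (congrFun (congrArg Hom.map (IsIso.inv_hom_id (φ i))) y) v
  refine ⟨⟨PreBundle.directSumMap fun i => inv (φ i), ?_, ?_⟩⟩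
  · exact Hom.ext (funext fun y => LinearMap.ext fun w => DFinsupp.ext fun i => h1 i y _)
  · exact Hom.ext (funext fun y => LinearMap.ext fun w => DFinsupp.ext fun i => h2 i y _)

theorem TensorProduct.subsingleton_of_right {V W : Type*} [AddCommGroup V] [Module ℂ V]
    [AddCommGroup W] [Module ℂ W] [Subsingleton W] : Subsingleton (V ⊗[ℂ] W) := by
  have h : ∀ t : V ⊗[ℂ] W, t = 0 := fun t => by
    induction t with
    | zero => rfl
    | tmul v w => rw [Subsingleton.elim w 0, TensorProduct.tmul_zero]
    | add s t hs ht => rw [hs, ht, add_zero]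
  exact ⟨fun s t => (h s).trans (h t).symm⟩

theorem TensorProduct.map_bijective_of_bijective {V V' W W' : Type*} [AddCommGroup V] [Module ℂ V]
    [AddCommGroup V'] [Module ℂ V'] [AddCommGroup W] [Module ℂ W] [AddCommGroup W'] [Module ℂ W']
    {f : V →ₗ[ℂ] V'} {g : W →ₗ[ℂ] W'} (hf : Function.Bijective f) (hg : Function.Bijective g) :
    Function.Bijective (TensorProduct.map f g) :=
  (TensorProduct.congr (LinearEquiv.ofBijective f hf) (LinearEquiv.ofBijective g hg)).bijective

variable {EX HX : Type*} [NormedAddCommGroup EX] [NormedSpace ℝ EX] [TopologicalSpace HX]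
  {I : ModelWithCorners ℝ EX HX}
  {EY HY : Type*} [NormedAddCommGroup EY] [NormedSpace ℝ EY] [TopologicalSpace HY]
  {I' : ModelWithCorners ℝ EY HY}
  {G X Y : Type u} [CommGroup G] [TopologicalSpace G]
  [TopologicalSpace X] [ChartedSpace HX X] [MulAction G X]
  [TopologicalSpace Y] [ChartedSpace HY Y] {p : X → Y} {B : Subgroup G}

theorem TwistedFamily.isIso_of_isIso_app {V W : TwistedFamily I I' p B} (φ : V ⟶ W)
    (h : ∀ g, IsIso (φ.app g)) : IsIso φ := by
  refine ⟨⟨⟨fun g => inv (φ.app g), fun h g g' hm e => ?_⟩, ?_, ?_⟩⟩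
  · rw [IsIso.comp_inv_eq, Category.assoc, φ.natural, ← Category.assoc,
      ← TwistedFamily.tensorMap_comp, IsIso.inv_hom_id, TwistedFamily.tensorMap_id,
      Category.id_comp]
  · exact TwistedFamily.Hom.ext (funext fun g => IsIso.hom_inv_id (φ.app g))
  · exact TwistedFamily.Hom.ext (funext fun g => IsIso.inv_hom_id (φ.app g))

end CategoryLemmas

/-! ### The augmented pull-back preserves reduced bundles -/

section AugPullback

open PreBundle

variable {EG HG : Type*} [NormedAddCommGroup EG] [NormedSpace ℝ EG]
  [TopologicalSpace HG] {J : ModelWithCorners ℝ EG HG} [J.Boundaryless]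
  {EX : Type} {HX : Type*} [NormedAddCommGroup EX] [NormedSpace ℝ EX] [FiniteDimensional ℝ EX]
  [TopologicalSpace HX] {I : ModelWithCorners ℝ EX HX}
  {EY HY : Type*} [NormedAddCommGroup EY] [NormedSpace ℝ EY] [TopologicalSpace HY]
  {I' : ModelWithCorners ℝ EY HY}
  {EX₁ : Type} {HX₁ : Type*} [NormedAddCommGroup EX₁] [NormedSpace ℝ EX₁] [FiniteDimensional ℝ EX₁]
  [TopologicalSpace HX₁] {I₁ : ModelWithCorners ℝ EX₁ HX₁}
  {EY₁ HY₁ : Type*} [NormedAddCommGroup EY₁] [NormedSpace ℝ EY₁] [TopologicalSpace HY₁]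
  {I₁' : ModelWithCorners ℝ EY₁ HY₁}
  {G X Y X₁ Y₁ : Type u} [CommGroup G] [TopologicalSpace G] [ChartedSpace HG G] [LieGroup J ∞ G]
  [CompactSpace G] [T2Space G]
  [TopologicalSpace X] [ChartedSpace HX X] [IsManifold I ∞ X] [T2Space X] [MulAction G X]
  [TopologicalSpace Y] [ChartedSpace HY Y]
  [TopologicalSpace X₁] [ChartedSpace HX₁ X₁] [IsManifold I₁ ∞ X₁] [T2Space X₁] [MulAction G X₁]
  [TopologicalSpace Y₁] [ChartedSpace HY₁ Y₁]
  {p : X → Y} {p₁ : X₁ → Y₁} {π₁ : Y → Y₁} {K B : Subgroup G}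
  (hact : ContMDiff (J.prod I) I ∞ (fun z : G × X => z.1 • z.2))
  (hp : IsQuotientWithSections I I' G p) (hK : ∀ x : X, MulAction.stabilizer G x = K)
  (hact₁ : ContMDiff (J.prod I₁) I₁ ∞ (fun z : G × X₁ => z.1 • z.2))
  (hp₁ : IsQuotientWithSections I₁ I₁' G p₁) (hB : ∀ x : X₁, MulAction.stabilizer G x = B)
  (hKB : K ≤ B) (hπ₁ : ContMDiff I' I₁' ∞ π₁)

include hact hp hK hπ₁ in
theorem isVectorBundle_augSummand (τ : PontryaginDual B → PontryaginDual G)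
    {V : PontryaginDual G → PreBundle Y₁} (hV : ∀ g, (V g).IsVectorBundle I₁')
    (g : PontryaginDual G) (b : PontryaginDual B) :
    (augSummand I I' p π₁ τ V g b).IsVectorBundle I' :=
  (hp.isVectorBundle_shift hact hK _).tensor ((hV _).pullback hπ₁)

theorem augSummand_subsingleton {τ : PontryaginDual B → PontryaginDual G} (hτ : IsLift B τ)
    {V : PontryaginDual G → PreBundle Y₁} {b : PontryaginDual B}
    (hb : b ∉ {b : PontryaginDual B | ∃ g : PontryaginDual G, (∀ x : B, g x = b x) ∧
      ∃ y, Nontrivial ((V g).Fib y)}) (g : PontryaginDual G) (y : Y) :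
    Subsingleton ((augSummand I I' p π₁ τ V g b).Fib y) := by
  have : Subsingleton ((V (τ b)).Fib (π₁ y)) := by
    by_contra h
    exact hb ⟨τ b, hτ b, π₁ y, not_subsingleton_iff_nontrivial.1 h⟩
  exact TensorProduct.subsingleton_of_right (V := (shift I p (τ b * g⁻¹)).Fib y)
    (W := (V (τ b)).Fib (π₁ y))

include hact hp hK hπ₁ in
-- Only the finitely many `b` in the support of `V` give non-zero summands. The sum is thus finite,
-- and the characters of `K` in the support of the result are restrictions of these `b`.
theorem isReducedBundle_augPullback {τ : PontryaginDual B → PontryaginDual G} (hτ : IsLift B τ)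
    {V : TwistedFamily I₁ I₁' p₁ B} (hV : IsReducedBundle I₁ I₁' p₁ B V) :
    IsReducedBundle I I' p K ((augPullback p p₁ π₁ hKB τ).obj V) := by
  have hsub := fun b hb => augSummand_subsingleton (I := I) (I' := I') (p := p) (π₁ := π₁)
    (V := V.W) (b := b) hτ hb
  refine hp.isReducedBundle hact hK (fun g => ?_) ?_
  · exact IsVectorBundle.directSum
      (fun b => isVectorBundle_augSummand hact hp hK hπ₁ τ hV.1 g b.1)
      (hV.2.1.preimage Subtype.val_injective.injOn) fun b hb y => hsub b.1 hb g y
  · refine (hV.2.1.biUnion (t := fun b => {k : PontryaginDual K | ∀ x : K, k x = b ⟨x, hKB x.2⟩})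
      fun b _ => Set.Subsingleton.finite fun k hk k' hk' =>
        DFunLike.ext _ _ fun x => (hk x).trans (hk' x).symm).subset ?_
    rintro k ⟨g, hg, y, hy⟩
    by_contra hk
    refine not_subsingleton_iff_nontrivial.2 hy ⟨fun v w => DFinsupp.ext fun b => ?_⟩
    have := hsub b.1 (fun hb => hk (Set.mem_biUnion hb fun x => by rw [b.2 x x.2, hg])) g y
    exact Subsingleton.elim (α := (augSummand I I' p π₁ τ V.W g b.1).Fib y) _ _

end AugPullback

/-! ### Pull-back and inversion of invariant functions -/

section ShiftPull

open PreBundle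

variable {EX HX : Type*} [NormedAddCommGroup EX] [NormedSpace ℝ EX]
  [TopologicalSpace HX] {I : ModelWithCorners ℝ EX HX}
  {EY HY : Type*} [NormedAddCommGroup EY] [NormedSpace ℝ EY] [TopologicalSpace HY]
  {I' : ModelWithCorners ℝ EY HY}
  {EX₁ HX₁ : Type*} [NormedAddCommGroup EX₁] [NormedSpace ℝ EX₁]
  [TopologicalSpace HX₁] {I₁ : ModelWithCorners ℝ EX₁ HX₁}
  {EY₁ HY₁ : Type*} [NormedAddCommGroup EY₁] [NormedSpace ℝ EY₁] [TopologicalSpace HY₁]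
  {I₁' : ModelWithCorners ℝ EY₁ HY₁}
  {G X Y X₁ Y₁ : Type u} [CommGroup G] [TopologicalSpace G]
  [TopologicalSpace X] [ChartedSpace HX X] [MulAction G X]
  [TopologicalSpace Y] [ChartedSpace HY Y]
  [TopologicalSpace X₁] [ChartedSpace HX₁ X₁] [MulAction G X₁]
  [TopologicalSpace Y₁] [ChartedSpace HY₁ Y₁]
  {p : X → Y} {p₁ : X₁ → Y₁} {π₁ : Y → Y₁} {π : X → X₁}
  (hπG : ∀ (g : G) (x : X), π (g • x) = g • π x) (hππ₁ : ∀ x : X, π₁ (p x) = p₁ (π x))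

/-- The pull-back of an invariant function to an orbit in `X`. -/
def shiftPull (I : ModelWithCorners ℝ EX HX) (χ : PontryaginDual G) {y : Y}
    (f : (shift I₁ p₁ χ).Fib (π₁ y)) : (shift I p χ).Fib y :=
  ⟨fun x => f.1 ⟨π x.1, by rw [← hππ₁, x.2]⟩, fun a x hx hax =>
    shift_apply_smul f (by rw [← hππ₁, hx]) (by rw [← hππ₁, hax]) (hπG a x).symm⟩

theorem shiftPull_smoothAt (hπ : ContMDiff I I₁ ∞ π) (hπ₁ : ContMDiff I' I₁' ∞ π₁)
    {χ : PontryaginDual G} {φ : ∀ y, (shift I₁ p₁ χ).Fib y} {y : Y}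
    (h : (shift I₁ p₁ χ).SmoothAt φ (π₁ y)) :
    (shift I p χ).SmoothAt (fun y => shiftPull hπG hππ₁ I χ (φ (π₁ y))) y := by
  filter_upwards [hπ₁.continuous.continuousAt.eventually h] with y' h1 x hx
  subst hx
  have h2 := SmoothNear.comp (φ := π) (y := x) (h1 (π x) (hππ₁ x).symm) (.of_forall fun z => hπ z)
  refine h2.congr (.of_forall fun z => ?_)
  have h3 : ∀ {y y' : Y₁} (h : y' = y) (hx : p₁ (π z) = y) (hx' : p₁ (π z) = y'),
      (φ y').1 ⟨π z, hx'⟩ = (φ y).1 ⟨π z, hx⟩ := by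
    rintro y _ rfl _ _
    rfl
  exact h3 (hππ₁ z) rfl (hππ₁ z).symm

theorem shiftInv_smoothAt {χ : PontryaginDual G} {φ : ∀ y, (shift I p χ).Fib y} {y : Y}
    (h : ∀ᶠ y in 𝓝 y, (shift I p χ).SmoothAt φ y ∧ ∀ x, (φ y).1 x ≠ 0) :
    (shift I p χ⁻¹).SmoothAt (fun y => shiftInv (φ y)) y := by
  filter_upwards [h] with y' h1 x hx
  subst hx
  exact SmoothNear.inv (h1.1.self_of_nhds x rfl) (h1.2 _)

end ShiftPull


/-! ### Independence of the choice of lifts -/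

theorem IsLift.mul_inv_mem {G : Type u} [CommGroup G] [TopologicalSpace G] {B : Subgroup G}
    {τ τ' : PontryaginDual B → PontryaginDual G} (hτ : IsLift B τ) (hτ' : IsLift B τ')
    (b : PontryaginDual B) : τ b * (τ' b)⁻¹ ∈ quotientDual B := by
  intro x hx
  change τ b x * (τ' b x)⁻¹ = 1
  rw [hτ b ⟨x, hx⟩, hτ' b ⟨x, hx⟩, mul_inv_cancel]

section LiftChange

open PreBundle

variable {EX HX : Type*} [NormedAddCommGroup EX] [NormedSpace ℝ EX]
  [TopologicalSpace HX] {I : ModelWithCorners ℝ EX HX}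
  {EY HY : Type*} [NormedAddCommGroup EY] [NormedSpace ℝ EY] [TopologicalSpace HY]
  {I' : ModelWithCorners ℝ EY HY}
  {EX₁ HX₁ : Type*} [NormedAddCommGroup EX₁] [NormedSpace ℝ EX₁]
  [TopologicalSpace HX₁] {I₁ : ModelWithCorners ℝ EX₁ HX₁}
  {EY₁ HY₁ : Type*} [NormedAddCommGroup EY₁] [NormedSpace ℝ EY₁] [TopologicalSpace HY₁]
  {I₁' : ModelWithCorners ℝ EY₁ HY₁}
  {G X Y X₁ Y₁ : Type u} [CommGroup G] [TopologicalSpace G]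
  [TopologicalSpace X] [ChartedSpace HX X] [MulAction G X]
  [TopologicalSpace Y] [ChartedSpace HY Y]
  [TopologicalSpace X₁] [ChartedSpace HX₁ X₁] [MulAction G X₁]
  [TopologicalSpace Y₁] [ChartedSpace HY₁ Y₁]
  {p : X → Y} {p₁ : X₁ → Y₁} {π₁ : Y → Y₁} {π : X → X₁} {K B : Subgroup G}
  (hπG : ∀ (g : G) (x : X), π (g • x) = g • π x) (hππ₁ : ∀ x : X, π₁ (p x) = p₁ (π x))
  {τ τ' : PontryaginDual B → PontryaginDual G} (V V' : TwistedFamily I₁ I₁' p₁ B)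
  (hτ : IsLift B τ) (hτ' : IsLift B τ')

/-- The comparison of the summands of the augmented pull-back for two lifts of the character `b`,
with respect to an invariant function `f` over an orbit in `X₁`. -/
noncomputable def liftChangeMap (I : ModelWithCorners ℝ EX HX) (I' : ModelWithCorners ℝ EY HY)
    (g : PontryaginDual G) (b : PontryaginDual B) (y : Y)
    (f : (shift I₁ p₁ (τ b * (τ' b)⁻¹)).Fib (π₁ y)) :
    (augSummand I I' p π₁ τ V.W g b).Fib y →ₗ[ℂ] (augSummand I I' p π₁ τ' V.W g b).Fib y :=
  (TensorProduct.map
    (shiftMul I p (χ := (τ b * (τ' b)⁻¹)⁻¹) (χ' := τ b * g⁻¹) (χ'' := τ' b * g⁻¹)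
      (by rw [mul_inv, inv_inv, mul_assoc, mul_left_comm, inv_mul_cancel_left]) y
      (shiftInv (shiftPull hπG hππ₁ I _ f)))
    (V.twistBy (hτ.mul_inv_mem hτ' b) (inv_mul_cancel_right _ _).symm f) :)

/-- The function `f` enters once through the twisting and once, inverted, through the
multiplication, so scalars cancel. Hence the comparison does not depend on which non-zero element of
the fibre of `shf` is taken. -/
theorem liftChangeMap_smul (g : PontryaginDual G) (b : PontryaginDual B) (y : Y)
    (f : (shift I₁ p₁ (τ b * (τ' b)⁻¹)).Fib (π₁ y)) {c : ℂ} (hc : c ≠ 0) :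
    liftChangeMap hπG hππ₁ V hτ hτ' I I' g b y (c • f) =
      liftChangeMap hπG hππ₁ V hτ hτ' I I' g b y f := by
  have h1 : shiftInv (shiftPull hπG hππ₁ I _ (c • f)) =
      c⁻¹ • shiftInv (shiftPull hπG hππ₁ I _ f) :=
    Subtype.ext (funext fun x => mul_inv c _)
  simp only [liftChangeMap]
  rw [h1, map_smul, V.twistBy_smul, TensorProduct.map_smul_left,
    TensorProduct.map_smul_right, smul_smul, inv_mul_cancel₀ hc, one_smul]

theorem bijective_liftChangeMap (g : PontryaginDual G) (b : PontryaginDual B) (y : Y)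
    {f : (shift I₁ p₁ (τ b * (τ' b)⁻¹)).Fib (π₁ y)} (hf : ∀ x, f.1 x ≠ 0) :
    Function.Bijective (liftChangeMap hπG hππ₁ V hτ hτ' I I' g b y f) := by
  refine TensorProduct.map_bijective_of_bijective ?_ (V.bijective_twist_tmul _ _ hf)
  refine Function.bijective_iff_has_inverse.2 ⟨fun s =>
    shiftMul I p (χ := τ b * (τ' b)⁻¹) (χ' := τ' b * g⁻¹) (χ'' := τ b * g⁻¹)
      (by rw [mul_assoc, inv_mul_cancel_left]) y (shiftPull hπG hππ₁ I _ f) s,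
    fun s => Subtype.ext (funext fun x => ?_), fun s => Subtype.ext (funext fun x => ?_)⟩
  · exact mul_inv_cancel_left₀ (hf _) (s.1 x)
  · exact inv_mul_cancel_left₀ (hf _) (s.1 x)

/-- The comparison of the summands for two lifts, as a map of bundles. -/
noncomputable def liftChange (hπ : ContMDiff I I₁ ∞ π) (hπ₁ : ContMDiff I' I₁' ∞ π₁)
    (hp₁ : ∀ x x' : X₁, p₁ x = p₁ x' → ∃ g : G, g • x = x') (hs₁ : Function.Surjective p₁)
    (hsec : ∀ b y₀, ∃ φ : ∀ y, (shift I₁ p₁ (τ b * (τ' b)⁻¹)).Fib y,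
      ∀ᶠ y in 𝓝 y₀, (shift I₁ p₁ (τ b * (τ' b)⁻¹)).SmoothAt φ y ∧ ∀ x, (φ y).1 x ≠ 0)
    {φ₀ : ∀ (b : PontryaginDual B) (y : Y₁), (shift I₁ p₁ (τ b * (τ' b)⁻¹)).Fib y}
    (hφ₀ : ∀ b y x, (φ₀ b y).1 x ≠ 0) (g : PontryaginDual G) (b : PontryaginDual B) :
    augSummand I I' p π₁ τ V.W g b ⟶ augSummand I I' p π₁ τ' V.W g b where
  map y := liftChangeMap hπG hππ₁ V hτ hτ' I I' g b y (φ₀ b (π₁ y))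
  smooth s y hs := by
    -- The family `φ₀` need not be smooth. Near `y` it may be replaced by a smooth section without
    -- zeros, since the two differ by a non-zero scalar over each orbit.
    obtain ⟨φ, hφ⟩ := hsec b (π₁ y)
    have hφ' : ∀ᶠ z in 𝓝 y, (shift I₁ p₁ (τ b * (τ' b)⁻¹)).SmoothAt φ (π₁ z) ∧
        ∀ x, (φ (π₁ z)).1 x ≠ 0 := hπ₁.continuous.continuousAt.eventually hφ
    have key : Generated I' {s' | ∃ t t', (shift I p (τ' b * g⁻¹)).SmoothAt t y ∧
        (PreBundle.pullback I' π₁ (V.W (τ' b))).SmoothAt t' y ∧ s' = fun y => t y ⊗ₜ[ℂ] t' y} y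
        (fun z => liftChangeMap hπG hππ₁ V hτ hτ' I I' g b z (φ (π₁ z)) (s z)) := by
      refine Generated.map (φ := fun z => liftChangeMap hπG hππ₁ V hτ hτ' I I' g b z (φ (π₁ z)))
        ?_ hs
      rintro _ ⟨u, v, hu, hv, rfl⟩
      refine .of _ ⟨fun z => shiftMul I p (χ := (τ b * (τ' b)⁻¹)⁻¹) (χ' := τ b * g⁻¹)
          (χ'' := τ' b * g⁻¹) (by rw [mul_inv, inv_inv, mul_assoc, mul_left_comm,
            inv_mul_cancel_left]) z (shiftInv (shiftPull hπG hππ₁ I _ (φ (π₁ z)))) (u z),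
        fun z => V.twistBy (hτ.mul_inv_mem hτ' b) (inv_mul_cancel_right _ _).symm (φ (π₁ z)) (v z),
        ?_, ?_, rfl⟩
      · have h1 := shiftInv_smoothAt (φ := fun z => shiftPull hπG hππ₁ I _ (φ (π₁ z))) (y := y) <| by
          filter_upwards [hφ'] with z hz
          exact ⟨shiftPull_smoothAt hπG hππ₁ hπ hπ₁ hz.1, fun x => hz.2 _⟩
        filter_upwards [h1, hu] with z h2 h3 x hx
        exact (h2 x hx).mul (h3 x hx)
      · refine Generated.map (φ := fun z => V.twistBy (hτ.mul_inv_mem hτ' b)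
          (inv_mul_cancel_right _ _).symm (φ (π₁ z))) ?_ hv
        rintro _ ⟨t, ht, rfl⟩
        exact .of _ ⟨fun z => V.twistBy (hτ.mul_inv_mem hτ' b)
          (inv_mul_cancel_right _ _).symm (φ z) (t z),
          (V.twist _ _ _ _ _).smooth _ _ (.of _ ⟨φ, t, hφ.self_of_nhds.1, ht, rfl⟩), rfl⟩
    refine Generated.congr _ _ ?_ key
    filter_upwards [hφ'] with z hz
    obtain ⟨x, hx⟩ := hs₁ (π₁ z)
    have h1 : φ (π₁ z) = ((φ (π₁ z)).1 ⟨x, hx⟩ / (φ₀ b (π₁ z)).1 ⟨x, hx⟩) • φ₀ b (π₁ z) := by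
      refine shift_ext hp₁ hx ?_
      exact (div_mul_cancel₀ _ (hφ₀ b _ _)).symm
    rw [h1, liftChangeMap_smul _ _ _ _ _ _ _ _ _ (div_ne_zero (hz.2 _) (hφ₀ b _ _))]

variable (hKB : K ≤ B)

theorem augTwist_liftChange
    (φ₀ : ∀ (b : PontryaginDual B) (y : Y₁), (shift I₁ p₁ (τ b * (τ' b)⁻¹)).Fib y)
    {h g g' : PontryaginDual G} (hm : h ∈ quotientDual K) (e : g' = h * g) (y : Y)
    (f : (shift I p h).Fib y)
    (w : ⨁ b : RestrictsTo hKB g', (augSummand I I' p π₁ τ V.W g' b.1).Fib y) :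
    DirectSum.lmap (fun b : RestrictsTo hKB g =>
        liftChangeMap hπG hππ₁ V hτ hτ' I I' g b.1 y (φ₀ b.1 (π₁ y)))
      (augTwist (I := I) (I' := I') p π₁ hKB τ V.W hm e y f w) =
    augTwist (I := I) (I' := I') p π₁ hKB τ' V.W hm e y f
      (DirectSum.lmap (fun b : RestrictsTo hKB g' =>
        liftChangeMap hπG hππ₁ V hτ hτ' I I' g' b.1 y (φ₀ b.1 (π₁ y))) w) := by
  refine DFinsupp.ext fun b => ?_
  let wb := w ⟨b.1, (restrictsTo_iff hKB hm e b.1).1 b.2⟩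
  change (liftChangeMap hπG hππ₁ V hτ hτ' I I' g b.1 y (φ₀ b.1 (π₁ y)) ∘ₗ
      augSummandMul p π₁ τ V.W e b.1 y f) wb =
    (augSummandMul p π₁ τ' V.W e b.1 y f ∘ₗ
      liftChangeMap hπG hππ₁ V hτ hτ' I I' g' b.1 y (φ₀ b.1 (π₁ y))) wb
  refine LinearMap.congr_fun ?_ wb
  refine TensorProduct.ext' fun u v => ?_
  refine congrArg (· ⊗ₜ[ℂ] _) (Subtype.ext (funext fun x => ?_))
  exact mul_left_comm _ (f.1 x) (u.1 x)

variable {V V'} in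
theorem liftChangeMap_natural (φ : V ⟶ V') (g : PontryaginDual G) (b : PontryaginDual B) (y : Y)
    (f : (shift I₁ p₁ (τ b * (τ' b)⁻¹)).Fib (π₁ y)) :
    liftChangeMap hπG hππ₁ V' hτ hτ' I I' g b y f ∘ₗ
        (((φ.app (τ b)).map (π₁ y)).lTensor ((shift I p (τ b * g⁻¹)).Fib y)) =
      (((φ.app (τ' b)).map (π₁ y)).lTensor ((shift I p (τ' b * g⁻¹)).Fib y)) ∘ₗ
        liftChangeMap hπG hππ₁ V hτ hτ' I I' g b y f := by
  refine TensorProduct.ext' fun u v => ?_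
  refine congrArg (_ ⊗ₜ[ℂ] ·) ?_
  have h1 := φ.natural (τ b * (τ' b)⁻¹) (τ' b) (τ b) (hτ.mul_inv_mem hτ' b)
    (inv_mul_cancel_right _ _).symm
  exact (LinearMap.congr_fun (congrFun (congrArg Hom.map h1) (π₁ y)) (f ⊗ₜ v)).symm

end LiftChange

section LiftChangeIso

open PreBundle

variable {EG HG : Type*} [NormedAddCommGroup EG] [NormedSpace ℝ EG]
  [TopologicalSpace HG] {J : ModelWithCorners ℝ EG HG} [J.Boundaryless]
  {EX : Type} {HX : Type*} [NormedAddCommGroup EX] [NormedSpace ℝ EX] [FiniteDimensional ℝ EX]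
  [TopologicalSpace HX] {I : ModelWithCorners ℝ EX HX}
  {EY HY : Type*} [NormedAddCommGroup EY] [NormedSpace ℝ EY] [TopologicalSpace HY]
  {I' : ModelWithCorners ℝ EY HY}
  {EX₁ : Type} {HX₁ : Type*} [NormedAddCommGroup EX₁] [NormedSpace ℝ EX₁] [FiniteDimensional ℝ EX₁]
  [TopologicalSpace HX₁] {I₁ : ModelWithCorners ℝ EX₁ HX₁}
  {EY₁ HY₁ : Type*} [NormedAddCommGroup EY₁] [NormedSpace ℝ EY₁] [TopologicalSpace HY₁]
  {I₁' : ModelWithCorners ℝ EY₁ HY₁}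
  {G X Y X₁ Y₁ : Type u} [CommGroup G] [TopologicalSpace G] [ChartedSpace HG G] [LieGroup J ∞ G]
  [CompactSpace G] [T2Space G]
  [TopologicalSpace X] [ChartedSpace HX X] [IsManifold I ∞ X] [T2Space X] [MulAction G X]
  [TopologicalSpace Y] [ChartedSpace HY Y]
  [TopologicalSpace X₁] [ChartedSpace HX₁ X₁] [IsManifold I₁ ∞ X₁] [T2Space X₁] [MulAction G X₁]
  [TopologicalSpace Y₁] [ChartedSpace HY₁ Y₁]
  {p : X → Y} {p₁ : X₁ → Y₁} {π₁ : Y → Y₁} {π : X → X₁} {K B : Subgroup G}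

/-- The augmented pull-back of reduced bundles does not depend on the choice of the lifts. -/
theorem nonempty_augPullback_iso
    (hact : ContMDiff (J.prod I) I ∞ (fun z : G × X => z.1 • z.2))
    (hp : IsQuotientWithSections I I' G p) (hK : ∀ x : X, MulAction.stabilizer G x = K)
    (hact₁ : ContMDiff (J.prod I₁) I₁ ∞ (fun z : G × X₁ => z.1 • z.2))
    (hp₁ : IsQuotientWithSections I₁ I₁' G p₁) (hB : ∀ x : X₁, MulAction.stabilizer G x = B)
    (hKB : K ≤ B) (hπ : ContMDiff I I₁ ∞ π) (hπ₁ : ContMDiff I' I₁' ∞ π₁)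
    (hπG : ∀ (g : G) (x : X), π (g • x) = g • π x) (hππ₁ : ∀ x : X, π₁ (p x) = p₁ (π x))
    {τ τ' : PontryaginDual B → PontryaginDual G} (hτ : IsLift B τ) (hτ' : IsLift B τ') :
    Nonempty ((IsReducedBundle I₁ I₁' p₁ B).ι ⋙ augPullback (I := I) (I' := I') p p₁ π₁ hKB τ ≅
      (IsReducedBundle I₁ I₁' p₁ B).ι ⋙ augPullback (I := I) (I' := I') p p₁ π₁ hKB τ') := by
  have horb₁ : ∀ x x' : X₁, p₁ x = p₁ x' → ∃ g : G, g • x = x' := fun x x' => (hp₁.fibres x x').1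
  -- A global choice orbit by orbit, without any smoothness; a smooth section without zeros need not
  -- exist globally. The same choice serves all `V` and `g`, which gives naturality and
  -- compatibility with the twisting.
  have hex : ∀ (b : PontryaginDual B) (y : Y₁), ∃ f : (shift I₁ p₁ (τ b * (τ' b)⁻¹)).Fib y,
      ∀ x, f.1 x ≠ 0 := fun b y => by
    obtain ⟨x, hx⟩ := hp₁.surjective y
    obtain ⟨f, hf⟩ := exists_shift_apply_eq_one (I := I₁) horb₁ hB (hτ.mul_inv_mem hτ' b) hx
    exact ⟨f, shift_ne_zero horb₁ hx (by rw [hf]; exact one_ne_zero)⟩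
  choose φ₀ hφ₀ using hex
  let Φ := fun (V : TwistedFamily I₁ I₁' p₁ B) (g : PontryaginDual G) (b : PontryaginDual B) =>
    liftChange (I := I) (I' := I') hπG hππ₁ V hτ hτ' hπ hπ₁ horb₁ hp₁.surjective
      (fun b y₀ => hp₁.exists_shift_section hact₁ hB (hτ.mul_inv_mem hτ' b) y₀)
      hφ₀ g b
  let Ψ : ∀ V : TwistedFamily I₁ I₁' p₁ B, (augPullback (I := I) (I' := I') p p₁ π₁ hKB τ).obj V ⟶
      (augPullback p p₁ π₁ hKB τ').obj V := fun V =>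
    ⟨fun g => PreBundle.directSumMap fun b : RestrictsTo hKB g => Φ V g b.1,
      fun h g g' hm e => PreBundle.Hom.ext (funext fun y => TensorProduct.ext' fun f w =>
        augTwist_liftChange hπG hππ₁ V hτ hτ' hKB φ₀ hm e y f w)⟩
  have hΨ : ∀ V : BunC I₁ I₁' p₁ B, IsIso (Ψ V.obj) := fun V => by
    refine TwistedFamily.isIso_of_isIso_app _ fun g => ?_
    have h1 : ∀ b : RestrictsTo hKB g, IsIso (Φ V.obj g b.1) := fun b =>
      isIso_of_bijective (isVectorBundle_augSummand hact hp hK hπ₁ τ V.property.1 g b.1)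
        (isVectorBundle_augSummand hact hp hK hπ₁ τ' V.property.1 g b.1) _
        fun y => bijective_liftChangeMap hπG hππ₁ V.obj hτ hτ' g b.1 y (hφ₀ b.1 _)
    exact PreBundle.isIso_directSumMap _
  refine ⟨NatIso.ofComponents (fun V => @asIso _ _ _ _ (Ψ V.obj) (hΨ V)) fun {V V'} φ => ?_⟩
  refine TwistedFamily.Hom.ext (funext fun g => PreBundle.Hom.ext (funext fun y =>
    LinearMap.ext fun w => DFinsupp.ext fun b => ?_))
  exact LinearMap.congr_fun (liftChangeMap_natural hπG hππ₁ hτ hτ' φ.hom g b.1 y (φ₀ b.1 (π₁ y))) _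

end LiftChangeIso


/-! ### Maps out of direct sums with finitely many non-zero summands -/

section DirectSumDesc

theorem DirectSum.toModule_eq_sum {ι : Type*} [DecidableEq ι] {M : ι → Type*} [∀ i, AddCommGroup (M i)]
    [∀ i, Module ℂ (M i)] {N : Type*} [AddCommGroup N] [Module ℂ N] (φ : ∀ i, M i →ₗ[ℂ] N)
    (F : Finset ι) (w : ⨁ i, M i) (h0 : ∀ i ∉ F, w i = 0) :
    DirectSum.toModule ℂ ι N φ w = ∑ i ∈ F, φ i (w i) := by
  have hw : w = ∑ i ∈ F, DirectSum.lof ℂ ι M i (w i) := by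
    refine DFinsupp.ext fun j => ?_
    rw [DFinsupp.finsetSum_apply]
    by_cases hj : j ∈ F
    · rw [Finset.sum_eq_single j]
      · exact (DirectSum.of_eq_same _ _).symm
      · exact fun i _ hij => DirectSum.of_eq_of_ne _ _ _ hij.symm
      · exact fun h => (h hj).elim
    · rw [h0 j hj]
      refine (Finset.sum_eq_zero fun i hi => ?_).symm
      exact DirectSum.of_eq_of_ne _ _ _ fun h => hj (h ▸ hi)
  conv_lhs => rw [hw]
  rw [map_sum]
  exact Finset.sum_congr rfl fun i _ => DirectSum.toModule_lof ℂ i (w i)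

variable {EM HM : Type*} [NormedAddCommGroup EM] [NormedSpace ℝ EM] [TopologicalSpace HM]
  {I : ModelWithCorners ℝ EM HM} {M : Type u} [TopologicalSpace M] [ChartedSpace HM M]

theorem PreBundle.Generated.finset_sum {Fib : M → Type u} [∀ x, AddCommGroup (Fib x)]
    [∀ x, Module ℂ (Fib x)] {S : Set (∀ x, Fib x)} {x : M} {ι : Type*} (F : Finset ι)
    {s : ι → ∀ x, Fib x} (h : ∀ i ∈ F, Generated I S x (s i)) :
    Generated I S x (fun y => ∑ i ∈ F, s i y) := by
  classical
  induction F using Finset.induction_on with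
  | empty => simpa using Generated.zero
  | insert a F ha ih =>
    simp only [Finset.sum_insert ha]
    exact .add _ _ (h a (by simp)) (ih fun i hi => h i (by simp [hi]))

/-- The map from a direct sum with finitely many non-zero summands given by maps of the
summands. -/
noncomputable def PreBundle.directSumDesc {ι : Type u} [DecidableEq ι] {F : ι → PreBundle M} {E : PreBundle M}
    (hE : E.IsVectorBundle I) (φ : ∀ i, F i ⟶ E) {T : Set ι} (hT : T.Finite)
    (h0 : ∀ i ∉ T, ∀ x, Subsingleton ((F i).Fib x)) : directSum F ⟶ E where
  map x := DirectSum.toModule ℂ ι (E.Fib x) fun i => (φ i).map x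
  smooth s x hs := by
    refine hE.generated (.congr (fun y => ∑ i ∈ hT.toFinset, (φ i).map y
      ((show ⨁ i, (F i).Fib y from s y) i)) _ (.of_forall fun y => ?_) (.finset_sum _ fun i _ =>
        .of _ ((φ i).smooth _ _ (hs i))))
    exact (DirectSum.toModule_eq_sum (fun i => (φ i).map y) hT.toFinset (s y)
      fun i hi => @Subsingleton.elim _ (h0 i (fun h => hi (hT.mem_toFinset.2 h)) y) _ _).symm

end DirectSumDesc

/-! ### The multiplication map to the reduction of the pull-back -/

section PullbackReduction

open PreBundle

variable {EG HG : Type*} [NormedAddCommGroup EG] [NormedSpace ℝ EG]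
  [TopologicalSpace HG] {J : ModelWithCorners ℝ EG HG}
  {EX HX : Type*} [NormedAddCommGroup EX] [NormedSpace ℝ EX]
  [TopologicalSpace HX] {I : ModelWithCorners ℝ EX HX}
  {EY HY : Type*} [NormedAddCommGroup EY] [NormedSpace ℝ EY] [TopologicalSpace HY]
  {I' : ModelWithCorners ℝ EY HY}
  {EX₁ HX₁ : Type*} [NormedAddCommGroup EX₁] [NormedSpace ℝ EX₁]
  [TopologicalSpace HX₁] {I₁ : ModelWithCorners ℝ EX₁ HX₁}
  {EY₁ HY₁ : Type*} [NormedAddCommGroup EY₁] [NormedSpace ℝ EY₁] [TopologicalSpace HY₁]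
  {I₁' : ModelWithCorners ℝ EY₁ HY₁}
  {G X Y X₁ Y₁ : Type u} [CommGroup G] [TopologicalSpace G] [ChartedSpace HG G]
  [TopologicalSpace X] [ChartedSpace HX X] [MulAction G X]
  [TopologicalSpace Y] [ChartedSpace HY Y]
  [TopologicalSpace X₁] [ChartedSpace HX₁ X₁] [MulAction G X₁]
  [TopologicalSpace Y₁] [ChartedSpace HY₁ Y₁]
  {p : X → Y} {p₁ : X₁ → Y₁} {π₁ : Y → Y₁} {π : X → X₁} {K B : Subgroup G}
  (hπ : ContMDiff I I₁ ∞ π)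
  (hπG : ∀ (g : G) (x : X), π (g • x) = g • π x) (hππ₁ : ∀ x : X, π₁ (p x) = p₁ (π x))
  {τ : PontryaginDual B → PontryaginDual G} (U : EquivPreBundle J I₁ G X₁)

/-- Multiplication of invariant functions over an orbit in `X` and invariant sections over its
image in `X₁`. -/
noncomputable def pullbackMul (g : PontryaginDual G) (χ : PontryaginDual G) (y : Y) :
    (shift I p (χ * g⁻¹)).Fib y →ₗ[ℂ] (descend I₁ p₁ χ⁻¹ U).Fib (π₁ y) →ₗ[ℂ]
      (descend I p g⁻¹ (EquivPreBundle.pullback π hπ hπG U)).Fib y :=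
  LinearMap.mk₂ ℂ
    (fun f t => ⟨fun x => f.1 x • t.1 ⟨π x.1, by rw [← hππ₁, x.2]⟩, by
      intro a x hx hax
      have h1 := f.2 a x hx hax
      have h0 : p₁ (π x) = π₁ y := by rw [← hππ₁, hx]
      have hap : p₁ (a • π x) = π₁ y := by rw [← hπG, ← hππ₁, hax]
      have h2 : ∀ (z : X₁) (hz : a • π x = z) (hz' : p₁ z = π₁ y),
          t.1 ⟨z, hz'⟩ = cast U.toPreBundle hz (t.1 ⟨a • π x, hap⟩) := by
        rintro _ rfl _
        rfl
      have h3 : (((χ * g⁻¹) a : Circle) : ℂ) * (χ⁻¹ a : ℂ) = (g⁻¹ a : ℂ) := by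
        rw [← PontryaginDual.coe_mul_apply, mul_right_comm, mul_inv_cancel, one_mul]
      change f.1 ⟨a • x, hax⟩ • t.1 ⟨π (a • x), _⟩ = (g⁻¹ a : ℂ) •
        cast U.toPreBundle (hπG a x).symm (U.act a (π x) (f.1 ⟨x, hx⟩ • t.1 ⟨π x, h0⟩))
      rw [h1, h2 _ (hπG a x).symm, t.2 a (π x) h0 hap, map_smul, map_smul, map_smul,
        smul_smul, smul_smul, ← h3]
      congr 1
      ring⟩)
    (fun f₁ f₂ t => Subtype.ext (funext fun x => add_smul (f₁.1 x) (f₂.1 x) (t.1 _)))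
    (fun c f t => Subtype.ext (funext fun x => mul_smul c (f.1 x) (t.1 _)))
    (fun f t₁ t₂ => Subtype.ext (funext fun x => smul_add (f.1 x) (t₁.1 _) (t₂.1 _)))
    (fun c f t => Subtype.ext (funext fun x => smul_comm (f.1 x) c (t.1 _)))

/-- The map of a summand of the augmented pull-back of the reduction of `U` to the reduction of the
pull-back of `U`. -/
noncomputable def pullbackMulHom (hp : ContMDiff I I' ∞ p) (hπ₁ : ContMDiff I' I₁' ∞ π₁)
    (hU : U.toPreBundle.IsVectorBundle I₁)
    (g : PontryaginDual G) (b : PontryaginDual B) :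
    augSummand I I' p π₁ τ (fun g => descend I₁ p₁ g⁻¹ U) g b ⟶
      descend I p g⁻¹ (EquivPreBundle.pullback π hπ hπG U) where
  map y := TensorProduct.lift (pullbackMul hπ hπG hππ₁ U g (τ b) y)
  smooth s y hs := by
    have hU' : (EquivPreBundle.pullback π hπ hπG U).toPreBundle.IsVectorBundle I := hU.pullback hπ
    refine descend_generated hp _ ⟨_, hU'⟩ (Generated.map (φ := fun y =>
      TensorProduct.lift (pullbackMul hπ hπG hππ₁ U g (τ b) y)) ?_ hs)
    rintro _ ⟨f, v, hf, hv, rfl⟩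
    refine Generated.map (φ := fun y => pullbackMul hπ hπG hππ₁ U g (τ b) y (f y)) ?_ hv
    rintro _ ⟨t, ht, rfl⟩
    refine .of _ ?_
    filter_upwards [hf, hπ₁.continuous.continuousAt.eventually ht] with y' h1 h2 x hx
    subst hx
    refine .congr (fun x' => (f (p x')).1 ⟨x', rfl⟩ • (t (p₁ (π x'))).1 ⟨π x', rfl⟩) _
      (.of_forall fun x' => ?_) (.smul _ _ (h1 x rfl)
        (.of _ ⟨_, h2 (π x) (hππ₁ x).symm, rfl⟩))
    exact congrArg ((f (p x')).1 ⟨x', rfl⟩ • ·) (descend_apply_congr t (hππ₁ x').symm).symm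

/-- Twisting keeps the index `b` and only rewrites the restriction condition. With this,
compatibility with the twisting can be checked on generators of the direct sum. -/
theorem augTwist_lof [DecidableEq (PontryaginDual B)] (hKB : K ≤ B)
    {V : PontryaginDual G → PreBundle Y₁} {h g g' : PontryaginDual G} (hm : h ∈ quotientDual K)
    (e : g' = h * g) (y : Y) (f : (shift I p h).Fib y) (b : RestrictsTo hKB g')
    (v : (augSummand I I' p π₁ τ V g' b.1).Fib y) :
    augTwist (I := I) (I' := I') p π₁ hKB τ V hm e y f
        (DirectSum.lof ℂ _ (fun b : RestrictsTo hKB g' => (augSummand I I' p π₁ τ V g' b.1).Fib y)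
          b v) =
      DirectSum.lof ℂ _ (fun b : RestrictsTo hKB g => (augSummand I I' p π₁ τ V g b.1).Fib y)
        ⟨b.1, (restrictsTo_iff hKB hm e b.1).2 b.2⟩ (augSummandMul p π₁ τ V e b.1 y f v) := by
  refine DFinsupp.ext fun c => ?_
  change augSummandMul p π₁ τ V e c.1 y f (DirectSum.lof ℂ _
    (fun b : RestrictsTo hKB g' => (augSummand I I' p π₁ τ V g' b.1).Fib y) b v
      ⟨c.1, (restrictsTo_iff hKB hm e c.1).1 c.2⟩) = _
  obtain ⟨b, hb⟩ := b
  obtain ⟨c, hc⟩ := c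
  by_cases hbc : c = b
  · subst hbc
    exact (congrArg (augSummandMul p π₁ τ V e c y f) (DirectSum.of_eq_same
      (β := fun b : RestrictsTo hKB g' => (augSummand I I' p π₁ τ V g' b.1).Fib y)
      ⟨c, hb⟩ v)).trans
      (DirectSum.of_eq_same (β := fun b : RestrictsTo hKB g =>
        (augSummand I I' p π₁ τ V g b.1).Fib y) ⟨c, hc⟩ _).symm
  · refine (congrArg (augSummandMul p π₁ τ V e c y f) (DirectSum.of_eq_of_ne
      (β := fun b : RestrictsTo hKB g' => (augSummand I I' p π₁ τ V g' b.1).Fib y)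
      ⟨b, hb⟩ ⟨c, (restrictsTo_iff hKB hm e c).1 hc⟩ v fun h => ?_)).trans
      ((map_zero _).trans (DirectSum.of_eq_of_ne (β := fun b : RestrictsTo hKB g =>
        (augSummand I I' p π₁ τ V g b.1).Fib y) _ ⟨c, hc⟩ _ fun h => ?_).symm)
    · exact hbc (congrArg Subtype.val h)
    · exact hbc (congrArg Subtype.val h)

variable (hKB : K ≤ B) [DecidableEq (PontryaginDual B)]

/-- The comparison of the augmented pull-back of the reduction with the reduction of the
pull-back, on fibres. -/
noncomputable def pullbackMulSum (g : PontryaginDual G) (y : Y) :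
    (⨁ b : RestrictsTo hKB g,
      (augSummand I I' p π₁ τ (fun g => descend I₁ p₁ g⁻¹ U) g b.1).Fib y) →ₗ[ℂ]
      (descend I p g⁻¹ (EquivPreBundle.pullback π hπ hπG U)).Fib y :=
  DirectSum.toModule ℂ _ _ fun b => TensorProduct.lift (pullbackMul hπ hπG hππ₁ U g (τ b.1) y)

theorem pullbackMulSum_augTwist {h g g' : PontryaginDual G} (hm : h ∈ quotientDual K)
    (e : g' = h * g) (e' : g⁻¹ = h * g'⁻¹) (y : Y) (f : (shift I p h).Fib y)
    (w : ⨁ b : RestrictsTo hKB g',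
      (augSummand I I' p π₁ τ (fun g => descend I₁ p₁ g⁻¹ U) g' b.1).Fib y) :
    pullbackMulSum (I' := I') hπ hπG hππ₁ U hKB g y
        (augTwist (I := I) (I' := I') p π₁ hKB τ (fun g => descend I₁ p₁ g⁻¹ U) hm e y f w) =
      descendMul I p e' _ y f (pullbackMulSum (I' := I') hπ hπG hππ₁ U hKB g' y w) := by
  have key : pullbackMulSum (I' := I') hπ hπG hππ₁ U hKB g y ∘ₗ
        augTwist (I := I) (I' := I') p π₁ hKB τ (fun g => descend I₁ p₁ g⁻¹ U) hm e y f =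
      descendMul I p e' _ y f ∘ₗ pullbackMulSum (I' := I') hπ hπG hππ₁ U hKB g' y := by
    refine DirectSum.linearMap_ext _ fun b => TensorProduct.ext' fun u t => ?_
    have h1 := augTwist_lof (I := I) (I' := I') (π₁ := π₁) (τ := τ) hKB
      (V := fun g => descend I₁ p₁ g⁻¹ U) hm e y f b (u ⊗ₜ t)
    refine (congrArg (pullbackMulSum (I' := I') hπ hπG hππ₁ U hKB g y) h1).trans ?_
    refine (DirectSum.toModule_lof ℂ _ _).trans ?_
    refine Eq.trans ?_ (congrArg (descendMul I p e' _ y f) (DirectSum.toModule_lof ℂ _ _).symm)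
    refine Subtype.ext (funext fun x => ?_)
    exact mul_smul (f.1 x) (u.1 x) _
  exact LinearMap.congr_fun key w

theorem pullbackMulSum_natural {U U' : EquivPreBundle J I₁ G X₁} (φ : U ⟶ U')
    (g : PontryaginDual G) (y : Y) (w : ⨁ b : RestrictsTo hKB g,
      (augSummand I I' p π₁ τ (fun g => descend I₁ p₁ g⁻¹ U) g b.1).Fib y) :
    pullbackMulSum (I' := I') hπ hπG hππ₁ U' hKB g y
        (DirectSum.lmap (fun b : RestrictsTo hKB g =>
          ((descendMap p₁ (τ b.1)⁻¹ φ).map (π₁ y)).lTensor ((shift I p (τ b.1 * g⁻¹)).Fib y)) w) =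
      (descendMap (U := EquivPreBundle.pullback π hπ hπG U)
        (U' := EquivPreBundle.pullback π hπ hπG U') p g⁻¹
        ((EquivPreBundle.pullbackFunctor π hπ hπG).map φ)).map y
        (pullbackMulSum (I' := I') hπ hπG hππ₁ U hKB g y w) := by
  have key : pullbackMulSum (I' := I') hπ hπG hππ₁ U' hKB g y ∘ₗ
        DirectSum.lmap (fun b : RestrictsTo hKB g =>
          ((descendMap p₁ (τ b.1)⁻¹ φ).map (π₁ y)).lTensor ((shift I p (τ b.1 * g⁻¹)).Fib y)) =
      (descendMap (U := EquivPreBundle.pullback π hπ hπG U)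
        (U' := EquivPreBundle.pullback π hπ hπG U') p g⁻¹
        ((EquivPreBundle.pullbackFunctor π hπ hπG).map φ)).map y ∘ₗ
        pullbackMulSum (I' := I') hπ hπG hππ₁ U hKB g y := by
    refine DirectSum.linearMap_ext _ fun b => TensorProduct.ext' fun u t => ?_
    refine (congrArg (pullbackMulSum (I' := I') hπ hπG hππ₁ U' hKB g y)
      (DirectSum.lmap_lof _ _ _)).trans ?_
    refine (DirectSum.toModule_lof ℂ _ _).trans ?_
    refine Eq.trans ?_ (congrArg ((descendMap (U := EquivPreBundle.pullback π hπ hπG U)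
        (U' := EquivPreBundle.pullback π hπ hπG U') p g⁻¹
        ((EquivPreBundle.pullbackFunctor π hπ hπG).map φ)).map y)
      (DirectSum.toModule_lof ℂ _ _).symm)
    refine Subtype.ext (funext fun x => ?_)
    exact (map_smul (φ.map (π x.1)) (u.1 x) _).symm
  exact LinearMap.congr_fun key w

end PullbackReduction


/-! ### Bijectivity of the comparison on fibres -/

section FibreComparison

open PreBundle

variable {EG HG : Type*} [NormedAddCommGroup EG] [NormedSpace ℝ EG]
  [TopologicalSpace HG] {J : ModelWithCorners ℝ EG HG}
  {EX : Type} {HX : Type*} [NormedAddCommGroup EX] [NormedSpace ℝ EX]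
  [TopologicalSpace HX] {I : ModelWithCorners ℝ EX HX}
  {EY HY : Type*} [NormedAddCommGroup EY] [NormedSpace ℝ EY] [TopologicalSpace HY]
  {I' : ModelWithCorners ℝ EY HY}
  {EX₁ : Type} {HX₁ : Type*} [NormedAddCommGroup EX₁] [NormedSpace ℝ EX₁]
  [TopologicalSpace HX₁] {I₁ : ModelWithCorners ℝ EX₁ HX₁}
  {G X Y X₁ Y₁ : Type u} [CommGroup G] [TopologicalSpace G] [ChartedSpace HG G]
  [TopologicalSpace X] [ChartedSpace HX X] [MulAction G X]
  [TopologicalSpace Y] [ChartedSpace HY Y]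
  [TopologicalSpace X₁] [ChartedSpace HX₁ X₁] [MulAction G X₁]
  [TopologicalSpace Y₁]
  {p : X → Y} {p₁ : X₁ → Y₁} {π₁ : Y → Y₁} {π : X → X₁} {K B : Subgroup G}
  (hπ : ContMDiff I I₁ ∞ π)
  (hπG : ∀ (g : G) (x : X), π (g • x) = g • π x) (hππ₁ : ∀ x : X, π₁ (p x) = p₁ (π x))
  {τ : PontryaginDual B → PontryaginDual G} (U : EquivPreBundle J I₁ G X₁)
  (hKB : K ≤ B)

theorem IsLift.mul_inv_mem_of_restrictsTo (hτ : IsLift B τ) {g : PontryaginDual G}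
    (b : RestrictsTo hKB g) : τ b.1 * g⁻¹ ∈ quotientDual K := by
  intro k hk
  change τ b.1 k * (g k)⁻¹ = 1
  rw [hτ b.1 ⟨k, hKB hk⟩, b.2 k hk, mul_inv_cancel]

theorem stabilizerRep_pullback {x : X} (hKx : ∀ k ∈ K, k • x = x)
    (hBx : ∀ k ∈ B, k • π x = π x) (k : K) (v : U.Fib (π x)) :
    stabilizerRep (EquivPreBundle.pullback π hπ hπG U) hKx k v =
      stabilizerRep U hBx ⟨k, hKB k.2⟩ v := by
  refine eq_of_heq (((cast_heq (PreBundle.pullback I π U.toPreBundle) (hKx k k.2) _).trans ?_).trans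
    (cast_heq U.toPreBundle (hBx k (hKB k.2)) _).symm)
  exact cast_heq U.toPreBundle (hπG k x).symm _

theorem isWeightVector_descend {τ : PontryaginDual B → PontryaginDual G} (hτ : IsLift B τ)
    {x : X₁} {y : Y₁} (hBx : ∀ k ∈ B, k • x = x) (b : PontryaginDual B)
    (t : (descend I₁ p₁ (τ b)⁻¹ U).Fib y) (hx : p₁ x = y) (k : B) :
    stabilizerRep U hBx k (t.1 ⟨x, hx⟩) = (b k : ℂ) • t.1 ⟨x, hx⟩ := by
  rw [← hτ b k, ← twistedAct_eq_iff]
  exact (descend_apply_smul t hx hx (hBx k k.2)).symm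

variable (hp : ∀ x x' : X, p x = p x' → ∃ g : G, g • x = x')
  (hK : ∀ x : X, MulAction.stabilizer G x = K)
  (hp₁ : ∀ x x' : X₁, p₁ x = p₁ x' → ∃ g : G, g • x = x')
  (hB : ∀ x : X₁, MulAction.stabilizer G x = B) (hτ : IsLift B τ)
  [DecidableEq (PontryaginDual B)]

include hp hK hp₁ hB hτ in
-- Evaluation at `x` sends the summand with index `b` to vectors of weight `b` for the action of `B`
-- on the fibre at `π x`. Vectors of different weights are independent, and an invariant section is
-- determined by its value at one point.
theorem injective_pullbackMulSum (g : PontryaginDual G) {x : X} {y : Y} (hx : p x = y) :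
    Function.Injective (pullbackMulSum (I' := I') hπ hπG hππ₁ U hKB (τ := τ) g y) := by
  classical
  have hx₁ : p₁ (π x) = π₁ y := by rw [← hππ₁, hx]
  have hBx : ∀ k ∈ B, k • π x = π x := fun k hk => by
    rw [← hB (π x)] at hk
    exact hk
  refine (injective_iff_map_eq_zero _).2 fun w hw => ?_
  choose f hf using fun b : RestrictsTo hKB g =>
    exists_shift_apply_eq_one (I := I) hp hK (hτ.mul_inv_mem_of_restrictsTo hKB b) hx
  choose t ht using fun b : RestrictsTo hKB g => shift_tmul_eq hp hx (hf b)
    (V := (descend I₁ p₁ (τ b.1)⁻¹ U).Fib (π₁ y)) (w b)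
  let F : Finset (RestrictsTo hKB g) := DFinsupp.support w
  have hF : ∀ b ∉ F, w b = 0 := fun b hb => DFinsupp.notMem_support_iff.1 hb
  -- Extended by zero to all characters of `B`, the form in which independence of weight vectors is
  -- available.
  let v : PontryaginDual B → U.Fib (π x) := fun b =>
    if h : ∀ (k : G) (hk : k ∈ K), b ⟨k, hKB hk⟩ = g k then (t ⟨b, h⟩).1 ⟨π x, hx₁⟩ else 0
  have hv : ∀ b : RestrictsTo hKB g, v b.1 = (t b).1 ⟨π x, hx₁⟩ := fun b => dif_pos b.2
  have hvw : ∀ b ∈ F.map (Function.Embedding.subtype _), ∀ k,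
      stabilizerRep U hBx k (v b) = (b k : ℂ) • v b := by
    intro b hb k
    obtain ⟨b, -, rfl⟩ := Finset.mem_map.1 hb
    rw [Function.Embedding.subtype_apply, hv]
    exact isWeightVector_descend U hτ hBx b.1 (t b) hx₁ k
  have hsum : ∑ b ∈ F.map (Function.Embedding.subtype _), v b = 0 := by
    rw [Finset.sum_map]
    have h1 := DirectSum.toModule_eq_sum
      (fun b : RestrictsTo hKB g => TensorProduct.lift (pullbackMul hπ hπG hππ₁ U g (τ b.1) y))
      F w hF
    have h2 := congrArg (descendEval g⁻¹ (EquivPreBundle.pullback π hπ hπG U) hx) (h1.symm.trans hw)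
    rw [map_sum, map_zero] at h2
    refine Eq.trans (Finset.sum_congr rfl fun b _ => ?_) h2
    rw [Function.Embedding.subtype_apply, hv]
    refine Eq.trans ?_ (congrArg (fun z => descendEval g⁻¹ (EquivPreBundle.pullback π hπ hπG U) hx
      (TensorProduct.lift (pullbackMul hπ hπG hππ₁ U g (τ b.1) y) z)) (ht b)).symm
    change _ = (f b).1 ⟨x, hx⟩ • (t b).1 ⟨π x, hx₁⟩
    rw [hf, one_smul]
  have hzero := eq_zero_of_sum_weightVectors _ v hvw hsum
  refine DFinsupp.ext fun b => ?_
  by_cases hb : b ∈ F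
  · have h1 := hzero b.1 (Finset.mem_map_of_mem _ hb)
    rw [hv] at h1
    have h2 : t b = 0 := descend_ext hp₁ hx₁ h1
    exact (ht b).trans ((congrArg (f b ⊗ₜ[ℂ] ·) h2).trans (TensorProduct.tmul_zero _ _))
  · exact hF b hb

include hp hK hp₁ hB hτ in
-- The value of an invariant section at `x` is decomposed under `B`. Each component of weight `b` is
-- the value at `π x` of an invariant section of `τ(b)⁻¹ ⊗ U` over the orbit in `X₁`, to be
-- multiplied by the function in `shf` with value `1` at `x`.
theorem surjective_pullbackMulSum [IsTopologicalGroup G] [CompactSpace G] [T2Space G]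
    (hact₁ : ContMDiff (J.prod I₁) I₁ ∞ (fun z : G × X₁ => z.1 • z.2))
    (hU : U.toPreBundle.IsVectorBundle I₁) (hBc : IsClosed (B : Set G))
    (g : PontryaginDual G) {x : X} {y : Y} (hx : p x = y) :
    Function.Surjective (pullbackMulSum (I' := I') hπ hπG hππ₁ U hKB (τ := τ) g y) := by
  classical
  have hx₁ : p₁ (π x) = π₁ y := by rw [← hππ₁, hx]
  have hBx : ∀ k ∈ B, k • π x = π x := fun k hk => by
    rw [← hB (π x)] at hk
    exact hk
  have hKx : ∀ k ∈ K, k • x = x := fun k hk => by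
    rw [← hK x] at hk
    exact hk
  have : CompactSpace B := isCompact_iff_compactSpace.1 hBc.isCompact
  have : FiniteDimensional ℂ (U.Fib (π x)) := hU.finiteDimensional (π x)
  intro s
  obtain ⟨w, hw, hwv⟩ := exists_sum_weightVectors
    (continuous_stabilizerRep hact₁ hU hBx) (show U.Fib (π x) from s.1 ⟨x, hx⟩)
  have hs : ∀ k : K, stabilizerRep U hBx ⟨k, hKB k.2⟩ (show U.Fib (π x) from s.1 ⟨x, hx⟩) =
      (g k : ℂ) • (show U.Fib (π x) from s.1 ⟨x, hx⟩) := by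
    intro k
    rw [← stabilizerRep_pullback hπ hπG U hKB hKx hBx]
    refine (twistedAct_eq_iff (EquivPreBundle.pullback π hπ hπG U) hKx g k _).1 ?_
    exact (descend_apply_smul s hx hx (hKx k k.2)).symm
  -- The value has weight `g` under `K`, so applying `k` minus the scalar `g(k)` kills it. By
  -- independence this kills each component, and a non-zero component has `b(k) = g(k)`.
  have hres : ∀ b ∈ w.support, ∀ (k : G) (hk : k ∈ K), b ⟨k, hKB hk⟩ = g k := by
    intro b hb k hk
    have h1 : ∑ χ ∈ w.support, ((χ ⟨k, hKB hk⟩ : ℂ) - (g k : ℂ)) • w χ = 0 := by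
      simp only [sub_smul, Finset.sum_sub_distrib]
      rw [← Finset.smul_sum]
      have h2 := hs ⟨k, hk⟩
      rw [← hwv, Finsupp.sum, map_sum] at h2
      rw [← h2, sub_eq_zero]
      exact Finset.sum_congr rfl fun χ _ => (hw χ _).symm
    have h3 := eq_zero_of_sum_weightVectors (A := stabilizerRep U hBx) w.support
      (fun χ => ((χ ⟨k, hKB hk⟩ : ℂ) - (g k : ℂ)) • w χ)
      (fun χ _ k' => by rw [map_smul, hw, smul_comm]) h1 b hb
    rcases smul_eq_zero.1 h3 with h4 | h4
    · exact Circle.ext (sub_eq_zero.1 h4)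
    · exact (Finsupp.mem_support_iff.1 hb h4).elim
  choose f hf using fun b : RestrictsTo hKB g =>
    exists_shift_apply_eq_one (I := I) hp hK (hτ.mul_inv_mem_of_restrictsTo hKB b) hx
  choose t ht using fun b : RestrictsTo hKB g =>
    exists_descend_apply_eq (χ := (τ b.1)⁻¹) (U := U) hp₁ hx₁ (w b.1) fun k hk => by
      have hkB : k ∈ B := by
        rw [← hB (π x)]
        exact hk
      exact (twistedAct_eq_iff U hBx (τ b.1) ⟨k, hkB⟩ _).2 (by rw [hw, ← hτ])
  let F : Finset (RestrictsTo hKB g) := w.support.subtype _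
  refine ⟨∑ b ∈ F, DirectSum.lof ℂ _ (fun b : RestrictsTo hKB g => (augSummand I I' p π₁ τ
    (fun g => descend I₁ p₁ g⁻¹ U) g b.1).Fib y) b (f b ⊗ₜ t b), descend_ext hp hx ?_⟩
  refine Eq.trans ?_ hwv
  rw [map_sum]
  refine (map_sum (descendEval g⁻¹ (EquivPreBundle.pullback π hπ hπG U) hx) _ _).trans ?_
  rw [Finsupp.sum, ← Finset.sum_subtype_of_mem (fun b => w b) hres]
  refine Finset.sum_congr rfl fun b _ => ?_
  refine (congrArg (descendEval g⁻¹ (EquivPreBundle.pullback π hπ hπG U) hx)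
    (DirectSum.toModule_lof ℂ _ _)).trans ?_
  change (f b).1 ⟨x, hx⟩ • (t b).1 ⟨π x, hx₁⟩ = w b.1
  rw [hf, one_smul, ht]

end FibreComparison


/-! ### The natural isomorphism between reduction of the pull-back and augmented pull-back -/

section ReductionPullback

open PreBundle

variable {EG HG : Type*} [NormedAddCommGroup EG] [NormedSpace ℝ EG]
  [TopologicalSpace HG] {J : ModelWithCorners ℝ EG HG} [J.Boundaryless]
  {EX : Type} {HX : Type*} [NormedAddCommGroup EX] [NormedSpace ℝ EX] [FiniteDimensional ℝ EX]
  [TopologicalSpace HX] {I : ModelWithCorners ℝ EX HX}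
  {EY HY : Type*} [NormedAddCommGroup EY] [NormedSpace ℝ EY] [TopologicalSpace HY]
  {I' : ModelWithCorners ℝ EY HY}
  {EX₁ : Type} {HX₁ : Type*} [NormedAddCommGroup EX₁] [NormedSpace ℝ EX₁] [FiniteDimensional ℝ EX₁]
  [TopologicalSpace HX₁] {I₁ : ModelWithCorners ℝ EX₁ HX₁}
  {EY₁ HY₁ : Type*} [NormedAddCommGroup EY₁] [NormedSpace ℝ EY₁] [TopologicalSpace HY₁]
  {I₁' : ModelWithCorners ℝ EY₁ HY₁}
  {G X Y X₁ Y₁ : Type u} [CommGroup G] [TopologicalSpace G] [ChartedSpace HG G] [LieGroup J ∞ G]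
  [CompactSpace G] [T2Space G]
  [TopologicalSpace X] [ChartedSpace HX X] [IsManifold I ∞ X] [T2Space X] [MulAction G X]
  [TopologicalSpace Y] [ChartedSpace HY Y]
  [TopologicalSpace X₁] [ChartedSpace HX₁ X₁] [IsManifold I₁ ∞ X₁] [T2Space X₁] [CompactSpace X₁]
  [MulAction G X₁]
  [TopologicalSpace Y₁] [ChartedSpace HY₁ Y₁]
  {p : X → Y} {p₁ : X₁ → Y₁} {π₁ : Y → Y₁} {π : X → X₁} {K B : Subgroup G}

/-- The pull-back of equivariant bundles descends to the augmented pull-back. -/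
theorem nonempty_augPullback_reduction_iso
    (hact : ContMDiff (J.prod I) I ∞ (fun z : G × X => z.1 • z.2))
    (hp : IsQuotientWithSections I I' G p) (hK : ∀ x : X, MulAction.stabilizer G x = K)
    (hact₁ : ContMDiff (J.prod I₁) I₁ ∞ (fun z : G × X₁ => z.1 • z.2))
    (hp₁ : IsQuotientWithSections I₁ I₁' G p₁) (hBc : IsClosed (B : Set G))
    (hB : ∀ x : X₁, MulAction.stabilizer G x = B)
    (hKB : K ≤ B) (hπ : ContMDiff I I₁ ∞ π) (hπ₁ : ContMDiff I' I₁' ∞ π₁)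
    (hπG : ∀ (g : G) (x : X), π (g • x) = g • π x) (hππ₁ : ∀ x : X, π₁ (p x) = p₁ (π x))
    {τ : PontryaginDual B → PontryaginDual G} (hτ : IsLift B τ) :
    Nonempty (reduction (J := J) p₁ hp₁.smooth B ⋙
        augPullback (I := I) (I' := I') p p₁ π₁ hKB τ ≅
      BunG.pullback J π hπ hπG ⋙ reduction p hp.smooth K) := by
  classical
  have := topologicalGroup_of_lieGroup (G := G) J ∞
  have hR := fun U : BunG J I₁ G X₁ => hp₁.isReducedBundle_reduction hact₁ hBc hB U
  have hpull : ∀ (U : BunG J I₁ G X₁) (g : PontryaginDual G),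
      (descend I p g⁻¹ (EquivPreBundle.pullback π hπ hπG U.obj)).IsVectorBundle I' := fun U g =>
    hp.isVectorBundle_descend hact hK (U := EquivPreBundle.pullback π hπ hπG U.obj)
      (IsVectorBundle.pullback hπ U.property) g⁻¹
  -- Smoothness of the map out of the sum rests on the finiteness of the support of the reduction
  -- over `X₁`, beyond which the summands vanish.
  let Φ : ∀ (U : BunG J I₁ G X₁) (g : PontryaginDual G),
      PreBundle.directSum (fun b : RestrictsTo hKB g =>
        augSummand I I' p π₁ τ (fun g => descend I₁ p₁ g⁻¹ U.obj) g b.1) ⟶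
      descend I p g⁻¹ (EquivPreBundle.pullback π hπ hπG U.obj) := fun U g =>
    PreBundle.directSumDesc (hpull U g)
      (fun b => pullbackMulHom hπ hπG hππ₁ U.obj hp.smooth hπ₁ U.property g b.1)
      ((hR U).2.1.preimage Subtype.val_injective.injOn)
      fun b hb y => augSummand_subsingleton hτ hb g y
  let Ψ : ∀ U : BunG J I₁ G X₁, (augPullback (I := I) (I' := I') p p₁ π₁ hKB τ).obj
      ((reduction p₁ hp₁.smooth B).obj U) ⟶
      (reduction p hp.smooth K).obj ((BunG.pullback J π hπ hπG).obj U) := fun U =>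
    ⟨fun g => Φ U g, fun h g g' hm e => PreBundle.Hom.ext (funext fun y =>
      TensorProduct.ext' fun f w => pullbackMulSum_augTwist hπ hπG hππ₁ U.obj hKB hm e
        (by rw [e, mul_inv, mul_inv_cancel_left]) y f w)⟩
  have hΨ : ∀ U : BunG J I₁ G X₁, IsIso (Ψ U) := fun U => by
    refine TwistedFamily.isIso_of_isIso_app _ fun g => ?_
    refine isIso_of_bijective ((isReducedBundle_augPullback hact hp hK hKB hπ₁ hτ (hR U)).1 g)
      (hpull U g) (Φ U g) fun y => ?_
    obtain ⟨x, hx⟩ := hp.surjective y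
    have h1 := fun x x' => (hp.fibres x x').1
    have h2 := fun x x' => (hp₁.fibres x x').1
    exact ⟨injective_pullbackMulSum hπ hπG hππ₁ U.obj hKB h1 hK h2 hB hτ g hx,
      surjective_pullbackMulSum hπ hπG hππ₁ U.obj hKB h1 hK h2 hB hτ hact₁ U.property hBc g hx⟩
  refine ⟨NatIso.ofComponents (fun U => @asIso _ _ _ _ (Ψ U) (hΨ U)) fun {U U'} φ => ?_⟩
  refine TwistedFamily.Hom.ext (funext fun g => PreBundle.Hom.ext (funext fun y =>
    LinearMap.ext fun w => ?_))
  exact pullbackMulSum_natural hπ hπG hππ₁ hKB φ.hom g y w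

end ReductionPullback


/-! ### The induced map of the bases and the main theorem -/

/-- Locally `q` is the composite of `q ∘ f` with a smooth section of `f`. -/
theorem IsFibration.contMDiff_of_comp {m n : ℕ} {M N : Type u}
    [TopologicalSpace M] [ChartedSpace (EuclideanQuadrant m) M]
    [TopologicalSpace N] [ChartedSpace (EuclideanQuadrant n) N]
    {E H P : Type*} [NormedAddCommGroup E] [NormedSpace ℝ E] [TopologicalSpace H]
    {I : ModelWithCorners ℝ E H} [TopologicalSpace P] [ChartedSpace H P]
    {f : M → N} (hf : IsFibration (m := m) (n := n) f) {q : N → P}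
    (h : ContMDiff (cornersModel m) I ∞ (fun x => q (f x))) :
    ContMDiff (cornersModel n) I ∞ q := by
  intro y
  obtain ⟨x, rfl⟩ := hf.surjective y
  obtain ⟨σ, -, hσ⟩ := hf.exists_section x
  have h1 : ContMDiffAt (cornersModel n) I ∞ (fun y => q (f (σ y))) (f x) :=
    (h (σ (f x))).comp (f x) hσ.self_of_nhds.1
  exact h1.congr_of_eventuallyEq (hσ.mono fun y hy => (congrArg q hy.2).symm)

theorem mainTheorem7
    -- a compact abelian Lie group
    {d : ℕ} {G : Type u} [CommGroup G] [TopologicalSpace G]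
    [ChartedSpace (EuclideanSpace ℝ (Fin d)) G] [LieGroup (𝓡 d) ∞ G] [CompactSpace G] [T2Space G]
    -- compact manifolds with corners
    {m n m₁ n₁ : ℕ} {X Y X₁ Y₁ : Type u}
    [TopologicalSpace X] [ChartedSpace (EuclideanQuadrant m) X]
    [IsManifold (cornersModel m) ∞ X] [CompactSpace X] [T2Space X]
    [TopologicalSpace Y] [ChartedSpace (EuclideanQuadrant n) Y]
    [IsManifold (cornersModel n) ∞ Y] [CompactSpace Y] [T2Space Y]
    [TopologicalSpace X₁] [ChartedSpace (EuclideanQuadrant m₁) X₁]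
    [IsManifold (cornersModel m₁) ∞ X₁] [CompactSpace X₁] [T2Space X₁]
    [TopologicalSpace Y₁] [ChartedSpace (EuclideanQuadrant n₁) Y₁]
    [IsManifold (cornersModel n₁) ∞ Y₁] [CompactSpace Y₁] [T2Space Y₁]
    -- smooth actions of `G` on `X` and `X₁` with fixed isotropy groups `K ⊆ B`
    [MulAction G X] [MulAction G X₁]
    (hX : ContMDiff ((𝓡 d).prod (cornersModel m)) (cornersModel m) ∞
      (fun z : G × X => z.1 • z.2))
    (hX₁ : ContMDiff ((𝓡 d).prod (cornersModel m₁)) (cornersModel m₁) ∞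
      (fun z : G × X₁ => z.1 • z.2))
    (K B : Subgroup G) (hK : IsClosed (K : Set G)) (hB : IsClosed (B : Set G)) (hKB : K ≤ B)
    (hXK : ∀ x : X, MulAction.stabilizer G x = K)
    (hX₁B : ∀ x : X₁, MulAction.stabilizer G x = B)
    -- the quotients `Y = X / G` and `Y₁ = X₁ / G`
    (p : X → Y) (hp : IsSmoothQuotient G (m := m) (n := n) p)
    (p₁ : X₁ → Y₁) (hp₁ : IsSmoothQuotient G (m := m₁) (n := n₁) p₁)
    -- an equivariant fibration `π`, covering `π₁`
    (π : X → X₁) (hπ : IsFibration (m := m) (n := m₁) π)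
    (hπG : ∀ (g : G) (x : X), π (g • x) = g • π x)
    (π₁ : Y → Y₁) (hπ₁ : ∀ x : X, π₁ (p x) = p₁ (π x)) :
    -- the induced map of the bases is smooth
    ContMDiff (cornersModel n) (cornersModel n₁) ∞ π₁ ∧
    -- every character of `B` lifts to a character of `G`
    (∃ τ : PontryaginDual B → PontryaginDual G, IsLift B τ) ∧
    -- the reductions of equivariant bundles are twisted bundles over `Ĝ × Y₁` and `Ĝ × Y`
    ∃ (hR₁ : ∀ U : BunG (𝓡 d) (cornersModel m₁) G X₁,
        IsReducedBundle (cornersModel m₁) (cornersModel n₁) p₁ B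
          ((reduction p₁ hp₁.fibration.smooth B).obj U))
      (hR : ∀ U : BunG (𝓡 d) (cornersModel m) G X,
        IsReducedBundle (cornersModel m) (cornersModel n) p K
          ((reduction p hp.fibration.smooth K).obj U))
      -- and there is an augmented pull-back functor `Bun_c^B(Ĝ × Y₁) ⥤ Bun_c^K(Ĝ × Y)`
      (aug : BunC (cornersModel m₁) (cornersModel n₁) p₁ B ⥤
        BunC (cornersModel m) (cornersModel n) p K),
      -- to which the pull-back of equivariant bundles descends
      Nonempty
        (BunG.pullback (𝓡 d) π hπ.smooth hπG ⋙
            (IsReducedBundle (cornersModel m) (cornersModel n) p K).lift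
              (reduction p hp.fibration.smooth K) hR ≅
          (IsReducedBundle (cornersModel m₁) (cornersModel n₁) p₁ B).lift
              (reduction p₁ hp₁.fibration.smooth B) hR₁ ⋙ aug) ∧
      -- and which is given, for any choice of lifts, by fibrewise pull-back and summation
      ∀ τ : PontryaginDual B → PontryaginDual G, IsLift B τ →
        Nonempty
          (aug ⋙ (IsReducedBundle (cornersModel m) (cornersModel n) p K).ι ≅
            (IsReducedBundle (cornersModel m₁) (cornersModel n₁) p₁ B).ι ⋙
              augPullback p p₁ π₁ hKB τ) := by

  have := topologicalGroup_of_lieGroup (G := G) (𝓡 d) ∞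
  have hq := hp.isQuotientWithSections
  have hq₁ := hp₁.isQuotientWithSections
  have hπ₁s : ContMDiff (cornersModel n) (cornersModel n₁) ∞ π₁ := by
    refine hp.fibration.contMDiff_of_comp ?_
    rw [funext hπ₁]
    exact hp₁.fibration.smooth.comp hπ.smooth
  choose τ hτ using fun b : PontryaginDual B => PontryaginDual.exists_extension B hB b
  have hR₁ := hq₁.isReducedBundle_reduction (J := 𝓡 d) hX₁ hB hX₁B
  have hR := hq.isReducedBundle_reduction (J := 𝓡 d) hX hK hXK
  obtain ⟨i⟩ := nonempty_augPullback_reduction_iso hX hq hXK hX₁ hq₁ hB hX₁B hKB hπ.smooth hπ₁s hπG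
    hπ₁ (τ := τ) hτ
  -- The functor is fixed with the one lift `τ` given by extension of characters; the description
  -- for any other lift comes from the comparison of lifts.
  refine ⟨hπ₁s, ⟨τ, hτ⟩, hR₁, hR, ObjectProperty.lift _
    ((IsReducedBundle (cornersModel m₁) (cornersModel n₁) p₁ B).ι ⋙ augPullback p p₁ π₁ hKB τ)
    fun V => isReducedBundle_augPullback hX hq hXK hKB hπ₁s hτ V.property,
    ⟨NatIso.ofComponents (fun U => ObjectProperty.isoMk _ (i.symm.app U)) fun {U U'} φ =>
      ObjectProperty.hom_ext _ (i.symm.hom.naturality φ)⟩, fun τ' hτ' => ?_⟩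
  exact nonempty_augPullback_iso hX hq hXK hX₁ hq₁ hX₁B hKB hπ.smooth hπ₁s hπG hπ₁ hτ hτ'
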